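/- Let $d\ge 3$ and let $E\subset[1,2]$ be nonempty. For $f:\mathbb{R}^d\to\mathbb{C}$ put $A_tf(x)=\int_{\mathbb{S}^{d-1}}f(x-ty)\,d\sigma(y)$, where $\sigma$ is the normalized surface measure on the unit sphere, and $M_Ef(x)=\sup_{t\in E}|A_tf(x)|$. For $p,q\in[1,\infty]$ say that $M_E$ is bounded $L^p_{\mathrm{rad}}\to L^q$ if there is a finite constant $C$ such that for every radial $f\in L^p(\mathbb{R}^d)$ the integrals $A_tf(x)$, $t\in E$, converge absolutely for almost every $x$, $M_Ef$ is (Lebesgue) measurable, and $\|M_Ef\|_{L^q(\mathbb{R}^d)}\le C\|f\|_{L^p(\mathbb{R}^d)}$. The radial type set is $$\mathcal{T}_E^{rad}=\{(\tfrac1p,\tfrac1q)\in[0,1]^2:\ M_E\text{ is bounded } L^p_{\mathrm{rad}}\to L^q\}.$$ Let $N(E,\delta)$ be the minimal number of intervals of length $\delta$ needed to cover $E$, and let $$\beta=\dim_{\mathrm{M}}E=\inf\{a>0:\ \exists c>0\ \forall\delta\in(0,1),\ N(E,\delta)\le c\,\delta^{-a}\}$$ be the upper Minkowski dimension of $E$.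 Let $\Delta(\beta)$ be the closed triangle with vertices $$O=(0,0),\quad Q_1(\beta)=\Big(\tfrac{d-1}{d-1+\beta},\tfrac{d-1}{d-1+\beta}\Big),\quad Q_2(\beta)=\Big(\tfrac{d(d-1)}{d^2-1+\beta},\tfrac{d-1}{d^2-1+\beta}\Big),$$ and let $[Q_1(\beta),Q_2(\beta)]$ be the closed segment between $Q_1(\beta)$ and $Q_2(\beta)$. (i) If $\beta<1$ and $\sup_{0<\delta<1}\delta^\beta N(E,\delta)<\infty$, then $\mathcal{T}_E^{rad}=\Delta(\beta)$. (ii) If $\sup_{0<\delta<1}\delta^\beta N(E,\delta)=\infty$, then $\mathcal{T}_E^{rad}=\Delta(\beta)\setminus[Q_1(\beta),Q_2(\beta)]$. (iii) If $\frac{d}{d-1}\le q\le\frac{d^2}{d-1}$, then $M_E$ is bounded $L^{d/(d-1)}_{\mathrm{rad}}\to L^q$ if and only if $$\sup_{0<\delta<1}\big(\log\tfrac1\delta\big)^{q/d}\,\delta\,N(E,\delta)<\infty.$$ -/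

import Mathlib

open MeasureTheory Set
open scoped ENNReal NNReal

noncomputable section

/-- The normalized surface measure on the unit sphere of `ℝ^d`. -/
def sphereProb (d : ℕ) : Measure (Metric.sphere (0 : EuclideanSpace ℝ (Fin d)) 1) :=
  ((volume : Measure (EuclideanSpace ℝ (Fin d))).toSphere univ)⁻¹ •
    (volume : Measure (EuclideanSpace ℝ (Fin d))).toSphere

/-- The spherical mean `A_t f (x) = ∫ f (x - t y) dσ(y)`. -/
def sphericalMean {d : ℕ} (t : ℝ) (f : EuclideanSpace ℝ (Fin d) → ℂ)
    (x : EuclideanSpace ℝ (Fin d)) : ℂ :=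
  ∫ y, f (x - t • (y : EuclideanSpace ℝ (Fin d))) ∂(sphereProb d)

/-- The maximal function `M_E f (x) = sup_{t ∈ E} |A_t f (x)|`, with values in `[0, ∞]`. -/
def sphericalMaximal {d : ℕ} (E : Set ℝ) (f : EuclideanSpace ℝ (Fin d) → ℂ)
    (x : EuclideanSpace ℝ (Fin d)) : ℝ≥0∞ :=
  ⨆ t ∈ E, ‖sphericalMean t f x‖ₑ

/-- `f` is radial: `f x` depends only on `|x|`. -/
def IsRadial {d : ℕ} (f : EuclideanSpace ℝ (Fin d) → ℂ) : Prop :=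
  ∀ x y, ‖x‖ = ‖y‖ → f x = f y

/-- `M_E` is bounded from `L^p_rad(ℝ^d)` to `L^q(ℝ^d)`: there is a finite constant `C` such that
for every radial `f` in `L^p`, all the means `A_t f (x)`, `t ∈ E`, are defined by absolutely
convergent integrals for almost every `x`, and `M_E f` is a measurable function with
`‖M_E f‖_q ≤ C ‖f‖_p`. -/
def RadialBounded (d : ℕ) (E : Set ℝ) (p q : ℝ≥0∞) : Prop :=
  ∃ C : ℝ≥0, ∀ f : EuclideanSpace ℝ (Fin d) → ℂ, IsRadial f → MemLp f p volume →
    (∀ᵐ x : EuclideanSpace ℝ (Fin d), ∀ t ∈ E,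
      Integrable (fun y : Metric.sphere (0 : EuclideanSpace ℝ (Fin d)) 1 =>
        f (x - t • (y : EuclideanSpace ℝ (Fin d)))) (sphereProb d)) ∧
    AEMeasurable (sphericalMaximal E f) volume ∧
    eLpNorm (sphericalMaximal E f) q volume ≤ C * eLpNorm f p volume

/-- The radial type set: all `(1/p, 1/q) ∈ [0,1]²` such that `M_E` is bounded from `L^p_rad`
to `L^q` (the coordinate `0` stands for the exponent `∞`). -/
def radialTypeSet (d : ℕ) (E : Set ℝ) : Set (ℝ × ℝ) :=
  {z | z.1 ∈ Icc (0 : ℝ) 1 ∧ z.2 ∈ Icc (0 : ℝ) 1 ∧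
    RadialBounded d E (ENNReal.ofReal z.1)⁻¹ (ENNReal.ofReal z.2)⁻¹}

/-- `N(E, δ)`: the minimal number of intervals of length `δ` needed to cover the bounded set `E`
(closed intervals are no restriction, as enlarging the intervals keeps a covering). -/
def coverNumber (E : Set ℝ) (δ : ℝ) : ℕ :=
  sInf {n : ℕ | ∃ s : Finset ℝ, s.card = n ∧ E ⊆ ⋃ a ∈ s, Icc a (a + δ)}

/-- The upper Minkowski dimension of a bounded set `E`. -/
def minkowskiDim (E : Set ℝ) : ℝ :=
  sInf {a : ℝ | 0 < a ∧ ∃ c : ℝ, 0 < c ∧ ∀ δ ∈ Ioo (0 : ℝ) 1,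
    (coverNumber E δ : ℝ) ≤ c * δ ^ (-a)}

/-- The `β`-Minkowski characteristic `δ ^ β * N(E, δ)`. -/
def minkowskiChar (E : Set ℝ) (β δ : ℝ) : ℝ :=
  δ ^ β * (coverNumber E δ : ℝ)

/-- The vertex `Q₁(β)`. -/
def vertexQ₁ (d : ℕ) (β : ℝ) : ℝ × ℝ :=
  (((d : ℝ) - 1) / ((d : ℝ) - 1 + β), ((d : ℝ) - 1) / ((d : ℝ) - 1 + β))

/-- The vertex `Q₂(β)`. -/
def vertexQ₂ (d : ℕ) (β : ℝ) : ℝ × ℝ :=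
  ((d : ℝ) * ((d : ℝ) - 1) / ((d : ℝ) ^ 2 - 1 + β), ((d : ℝ) - 1) / ((d : ℝ) ^ 2 - 1 + β))

/-- The closed triangle `Δ(β)` with vertices `O = (0, 0)`, `Q₁(β)`, `Q₂(β)`. -/
def triangle (d : ℕ) (β : ℝ) : Set (ℝ × ℝ) :=
  convexHull ℝ {((0 : ℝ), (0 : ℝ)), vertexQ₁ d β, vertexQ₂ d β}

end

/-! ### Polar coordinates in `V` and in a half plane. -/

noncomputable section

/-! Let f be radial with profile g and let |x| = r. Slicing the sphere of radius t about x by the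
distance s to the origin turns the spherical mean into a one-dimensional integral of g(s) over |r -
t| < s < r + t, with the explicit kernel `radialKernel` (`lintegral_cos_law`,
`map_norm_sub_sphereProb`).

Sufficiency treats three ranges of r. For r ≥ 3 the kernel is bounded and M_E f is controlled by an
average of g over a window of length 4, which maps L^p to L^q for every q ≥ p
(`exists_far_estimate`). For r < 1/2 the kernel is at most 2/r on an interval of length 2r, and a
Hardy type inequality suffices when q ≤ dp (`exists_near_estimate`). For 1/2 ≤ r < 3 the kernel is
at most a multiple of s^(d-2), so up to a harmless term M_E f(x) is bounded by a multiple of the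
integral of |g(s)| s^(d-2) over dist(r,E) < s ≤ 1 (`radialMean_le_middle`). The supremum over t is
gone and only the distance to E remains.

That last integral is cut into shells ρ_{k+1} < s ≤ ρ_k. Hölder gives a factor L^k on the k-th shell
with L > 1, while the set dist(r,E) ≤ ρ_k has measure at most 5 ρ_k N(E,ρ_k). If this measure times
L^(kq) is bounded, convolution with a geometric sequence, which maps ℓ^p to ℓ^q, sums the shells
(`exists_hardy_estimate`). Dyadic shells give the bounds inside the triangle, and on its side Q₁Q₂
when δ^β N(E,δ) is bounded (`radialBounded_of_coverNumber_le`). At p = d/(d-1) powers give no gain,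
and the doubly exponential shells ρ_k = exp(1 - 2^k) produce exactly the logarithmic condition
(`radialBounded_critical`).

Necessity comes from four families of radial functions: large balls force p ≤ q, thin shells |x| ≈ t
force q ≤ dp, small balls bound N(E,δ) (`exists_coverNumber_rpow_le`), and truncations of |x|^(1-d)
give the logarithmic condition (`bddAbove_of_radialBounded_critical`). With z = (1/p,1/q) the
triangle is z₂ ≤ z₁ ≤ d z₂, d z₁ - (1-β) z₂ ≤ d - 1, and equality in the last constraint is the
segment Q₁Q₂ (`mem_triangle_iff`, `mem_segment_vertex_iff`), so the necessary conditions match the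
sufficient ones. -/

/-- Polar coordinates for the lower Lebesgue integral. -/
theorem lintegral_polar {V : Type*} [NormedAddCommGroup V] [NormedSpace ℝ V] [MeasurableSpace V]
    [BorelSpace V] [FiniteDimensional ℝ V] [Nontrivial V] (μ : Measure V) [μ.IsAddHaarMeasure]
    {h : V → ℝ≥0∞} (hh : Measurable h) :
    ∫⁻ x, h x ∂μ = ∫⁻ ω : Metric.sphere (0 : V) 1, (∫⁻ s in Ioi (0 : ℝ),
      ENNReal.ofReal (s ^ (Module.finrank ℝ V - 1)) * h (s • (ω : V))) ∂μ.toSphere := by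
  have h0 : ∫⁻ x, h x ∂μ = ∫⁻ x : ({(0)}ᶜ : Set V), h x.1 ∂(μ.comap (↑)) := by
    rw [lintegral_subtype_comap (measurableSet_singleton _).compl, restrict_compl_singleton]
  have h1 := (μ.measurePreserving_homeomorphUnitSphereProd).symm
    (homeomorphUnitSphereProd V).toMeasurableEquiv
  have h2 := h1.lintegral_comp_emb
    (homeomorphUnitSphereProd V).symm.measurableEmbedding (fun x => h x.1)
  rw [h0, ← h2]
  have hm : Measurable fun z : Metric.sphere (0 : V) 1 × Ioi (0 : ℝ) =>
      h ((homeomorphUnitSphereProd V).symm z).1 :=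
    hh.comp (measurable_subtype_coe.comp (homeomorphUnitSphereProd V).symm.measurable)
  refine (lintegral_prod _ hm.aemeasurable).trans ?_
  refine lintegral_congr fun ω => ?_
  have hm2 : Measurable fun s : Ioi (0 : ℝ) => h ((homeomorphUnitSphereProd V).symm (ω, s)).1 :=
    hm.comp measurable_prodMk_left
  have hm3 : Measurable fun r : Ioi (0 : ℝ) =>
      ENNReal.ofReal (r.1 ^ (Module.finrank ℝ V - 1)) := by fun_prop
  change ∫⁻ s, h ((homeomorphUnitSphereProd V).symm (ω, s)).1 ∂(Measure.volumeIoiPow _) = _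
  rw [Measure.volumeIoiPow, lintegral_withDensity_eq_lintegral_mul _ hm3 hm2]
  rw [← lintegral_subtype_comap measurableSet_Ioi]
  rfl

theorem lintegral_fun_norm {V : Type*} [NormedAddCommGroup V] [NormedSpace ℝ V]
    [MeasurableSpace V] [BorelSpace V] [FiniteDimensional ℝ V] [Nontrivial V] (μ : Measure V)
    [μ.IsAddHaarMeasure] {φ : ℝ → ℝ≥0∞} (hφ : Measurable φ) :
    ∫⁻ x, φ ‖x‖ ∂μ = μ.toSphere univ * ∫⁻ s in Ioi (0 : ℝ),
      ENNReal.ofReal (s ^ (Module.finrank ℝ V - 1)) * φ s := by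
  rw [lintegral_polar μ (h := fun x => φ ‖x‖) (hφ.comp measurable_norm),
    mul_comm (μ.toSphere univ), ← lintegral_const]
  refine lintegral_congr fun ω => setLIntegral_congr_fun measurableSet_Ioi fun s hs => ?_
  have hω : ‖(ω : V)‖ = 1 := by simp
  simp [norm_smul, hω, abs_of_pos (mem_Ioi.1 hs)]

/-- Fubini for the splitting of an inner product space into a line and its complement. -/
theorem lintegral_line_add_orthogonal {V : Type*} [NormedAddCommGroup V] [InnerProductSpace ℝ V]
    [MeasurableSpace V] [BorelSpace V] [FiniteDimensional ℝ V] {e : V} (he : ‖e‖ = 1)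
    {h : V → ℝ≥0∞} (hh : Measurable h) :
    ∫⁻ x, h x = ∫⁻ a : ℝ, ∫⁻ v : (Submodule.span ℝ {e})ᗮ, h (a • e + v) := by
  set K := Submodule.span ℝ {e}
  have h1 : MeasurePreserving (K.orthogonalDecomposition.symm ∘ WithLp.toLp 2)
      (volume : Measure (K × Kᗮ)) (volume : Measure V) :=
    K.orthogonalDecomposition.symm.measurePreserving.comp (WithLp.volume_preserving_toLp _ _)
  rw [← h1.lintegral_comp hh]
  have hm : Measurable fun z : K × Kᗮ => h ((K.orthogonalDecomposition.symm ∘ WithLp.toLp 2) z) :=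
    hh.comp h1.measurable
  refine (lintegral_prod _ hm.aemeasurable).trans ?_
  have h3 := (LinearIsometryEquiv.toSpanUnitSingleton (𝕜 := ℝ) e he).measurePreserving
  have := h3.lintegral_comp (f := fun k : K => ∫⁻ v : Kᗮ,
    h ((K.orthogonalDecomposition.symm ∘ WithLp.toLp 2) (k, v))) hm.lintegral_prod_right'
  refine this.symm.trans ?_
  refine lintegral_congr fun a => lintegral_congr fun v => ?_
  congr 1

theorem lintegral_half_plane_polar {H : ℝ → ℝ → ℝ≥0∞} (hH : Measurable (Function.uncurry H)) :
    ∫⁻ a : ℝ, ∫⁻ b in Ioi (0 : ℝ), H a b =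
      ∫⁻ ρ in Ioi (0 : ℝ), ∫⁻ θ in Ioo 0 Real.pi,
        ENNReal.ofReal ρ * H (ρ * Real.cos θ) (ρ * Real.sin θ) := by
  have h1 : ∫⁻ a : ℝ, ∫⁻ b in Ioi (0 : ℝ), H a b =
      ∫⁻ p : ℝ × ℝ, {q : ℝ × ℝ | 0 < q.2}.indicator (Function.uncurry H) p := by
    have hS : MeasurableSet {q : ℝ × ℝ | 0 < q.2} := measurableSet_lt measurable_const measurable_snd
    refine Eq.symm ((lintegral_prod _ (hH.indicator hS).aemeasurable).trans ?_)
    refine lintegral_congr fun a => ?_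
    rw [← lintegral_indicator measurableSet_Ioi]
    rfl
  rw [h1, ← lintegral_comp_polarCoord_symm]
  change ∫⁻ p in Ioi (0 : ℝ) ×ˢ Ioo (-Real.pi) Real.pi, _ ∂(volume.prod volume) = _
  rw [← Measure.prod_restrict]
  have hmeas : Measurable fun p : ℝ × ℝ => ENNReal.ofReal p.1 •
      {q : ℝ × ℝ | 0 < q.2}.indicator (Function.uncurry H) (polarCoord.symm p) := by
    have hS : MeasurableSet {q : ℝ × ℝ | 0 < q.2} := measurableSet_lt measurable_const measurable_snd
    have : Measurable (polarCoord.symm : ℝ × ℝ → ℝ × ℝ) := continuous_polarCoord_symm.measurable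
    exact (by fun_prop : Measurable fun p : ℝ × ℝ => ENNReal.ofReal p.1).mul
      ((hH.indicator hS).comp this)
  rw [lintegral_prod _ hmeas.aemeasurable]
  refine setLIntegral_congr_fun measurableSet_Ioi fun ρ hρ => ?_
  have hρ : 0 < ρ := hρ
  have hsub : Ioo 0 Real.pi ⊆ Ioo (-Real.pi) Real.pi :=
    Ioo_subset_Ioo_left (by linarith [Real.pi_pos])
  rw [← lintegral_indicator measurableSet_Ioo, ← lintegral_indicator measurableSet_Ioo]
  refine lintegral_congr fun θ => ?_
  by_cases h1 : θ ∈ Ioo 0 Real.pi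
  · have hs := Real.sin_pos_of_mem_Ioo h1
    have : (polarCoord.symm (ρ, θ)) ∈ {q : ℝ × ℝ | 0 < q.2} := by
      simp only [polarCoord_symm_apply, mem_ofPred_eq]; positivity
    rw [indicator_of_mem h1, indicator_of_mem (hsub h1), indicator_of_mem this]
    simp [Function.uncurry]
  · rw [indicator_of_notMem h1]
    by_cases h2 : θ ∈ Ioo (-Real.pi) Real.pi
    · have hs : Real.sin θ ≤ 0 := by
        refine Real.sin_nonpos_of_nonpos_of_neg_pi_le ?_ h2.1.le
        by_contra! h3
        exact h1 ⟨h3, h2.2⟩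
      have : (polarCoord.symm (ρ, θ)) ∉ {q : ℝ × ℝ | 0 < q.2} := by
        simp only [polarCoord_symm_apply, mem_ofPred_eq, not_lt]
        exact mul_nonpos_of_nonneg_of_nonpos hρ.le hs
      rw [indicator_of_mem h2, indicator_of_notMem this]
      simp
    · rw [indicator_of_notMem h2]

end

/-! ### The distribution of a coordinate on the unit sphere. -/

noncomputable section

open scoped RealInnerProductSpace

/-- This is the radial factor that appears on both sides of the computation in
`lintegral_inner_toSphere`; being neither 0 nor ∞, it can be cancelled. -/
theorem lintegral_radial_cutoff_ne (n : ℕ) :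
    (∫⁻ s in Ioi (0 : ℝ), ENNReal.ofReal (s ^ n) * (Iio 1).indicator 1 s) ≠ 0 ∧
    (∫⁻ s in Ioi (0 : ℝ), ENNReal.ofReal (s ^ n) * (Iio 1).indicator 1 s) ≠ ∞ := by
  constructor
  · have hm : Measurable fun s : ℝ => ENNReal.ofReal (s ^ n) * (Iio (1:ℝ)).indicator 1 s :=
      (by fun_prop : Measurable fun s : ℝ => ENNReal.ofReal (s ^ n)).mul
        (measurable_one.indicator measurableSet_Iio)
    rw [← pos_iff_ne_zero, setLIntegral_pos_iff hm]
    refine lt_of_lt_of_le (?_ : 0 < volume (Ioo (0 : ℝ) 1)) (measure_mono ?_)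
    · simp
    · intro s hs
      refine ⟨?_, hs.1⟩
      have : 0 < s ^ n := pow_pos hs.1 n
      simp [hs.2, this]
  · refine ne_top_of_le_ne_top (b := ∫⁻ s in Ioo (0 : ℝ) 1, 1) (by simp) ?_
    rw [← lintegral_indicator measurableSet_Ioo, ← lintegral_indicator measurableSet_Ioi]
    refine lintegral_mono fun s => ?_
    by_cases h0 : s ∈ Ioi (0 : ℝ)
    · by_cases h1 : s < 1
      · have : s ∈ Ioo (0 : ℝ) 1 := ⟨h0, h1⟩
        simp only [indicator_of_mem h0, indicator_of_mem this, indicator_of_mem (mem_Iio.2 h1),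
          Pi.one_apply, mul_one]
        exact ENNReal.ofReal_le_one.2 (pow_le_one₀ (le_of_lt h0) h1.le)
      · have : s ∉ Iio (1 : ℝ) := h1
        rw [indicator_of_mem h0, indicator_of_notMem this, mul_zero]
        exact zero_le
    · simp [indicator_of_notMem h0]

/-- The law of a coordinate under the surface measure, up to a multiplicative constant. -/
theorem lintegral_inner_toSphere {V : Type*} [NormedAddCommGroup V] [InnerProductSpace ℝ V]
    [MeasurableSpace V] [BorelSpace V] [FiniteDimensional ℝ V] (hd : 2 ≤ Module.finrank ℝ V)
    {e : V} (he : ‖e‖ = 1) {φ : ℝ → ℝ≥0∞} (hφ : Measurable φ) :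
    ∫⁻ y : Metric.sphere (0 : V) 1, φ ⟪e, (y : V)⟫ ∂(volume : Measure V).toSphere =
      (volume : Measure (Submodule.span ℝ {e})ᗮ).toSphere univ *
      ∫⁻ θ in Ioo 0 Real.pi,
        ENNReal.ofReal (Real.sin θ ^ (Module.finrank ℝ V - 2)) * φ (Real.cos θ) := by
  set d := Module.finrank ℝ V with hdim
  have he0 : e ≠ 0 := by rintro rfl; simp at he
  have : Nontrivial V := ⟨⟨e, 0, he0⟩⟩
  set F := (Submodule.span ℝ {e})ᗮ with hF
  have hFd : Module.finrank ℝ F = d - 1 := by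
    have h1 := Submodule.finrank_add_finrank_orthogonal (Submodule.span ℝ {e})
    rw [finrank_span_singleton he0] at h1
    rw [hF]; omega
  have : Nontrivial F := Module.finrank_pos_iff (R := ℝ) |>.1 (by omega)
  set A := ∫⁻ s in Ioi (0 : ℝ), ENNReal.ofReal (s ^ (d - 1)) * (Iio 1).indicator 1 s with hA
  obtain ⟨hA0, hA1⟩ := lintegral_radial_cutoff_ne (d - 1)
  have hI : Measurable ((Iio (1 : ℝ)).indicator (1 : ℝ → ℝ≥0∞)) :=
    measurable_one.indicator measurableSet_Iio
  -- A function homogeneous of degree 0, cut off to the unit ball: its integral is computed once in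
  -- spherical and once in cylindrical coordinates about the axis `e`, and the two results are
  -- compared.
  set h : V → ℝ≥0∞ := fun x => φ (⟪e, x⟫ / ‖x‖) * (Iio 1).indicator 1 ‖x‖ with hh
  have hm : Measurable h :=
    (hφ.comp (by fun_prop : Measurable fun x : V => ⟪e, x⟫ / ‖x‖)).mul (hI.comp measurable_norm)
  have L1 : ∫⁻ x, h x = (∫⁻ y : Metric.sphere (0 : V) 1, φ ⟪e, (y : V)⟫
      ∂(volume : Measure V).toSphere) * A := by
    have hm1 : Measurable fun y : Metric.sphere (0 : V) 1 => φ ⟪e, (y : V)⟫ :=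
      hφ.comp (by fun_prop)
    rw [lintegral_polar _ hm, ← lintegral_mul_const _ hm1]
    refine lintegral_congr fun y => ?_
    rw [hA, ← lintegral_const_mul _ (by fun_prop)]
    refine setLIntegral_congr_fun measurableSet_Ioi fun s hs => ?_
    have hs : 0 < s := hs
    have hy : ‖(y : V)‖ = 1 := by simp
    have : s * ⟪e, (y : V)⟫ / s = ⟪e, (y : V)⟫ := by field_simp
    simp only [hh, norm_smul, hy, Real.norm_eq_abs, abs_of_pos hs, mul_one, inner_smul_right, this]
    ring
  have L2 : ∫⁻ x, h x = (volume : Measure F).toSphere univ *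
      ((∫⁻ θ in Ioo 0 Real.pi, ENNReal.ofReal (Real.sin θ ^ (d - 2)) * φ (Real.cos θ)) * A) := by
    set k : ℝ → ℝ → ℝ≥0∞ := fun a b =>
      φ (a / √(a ^ 2 + b ^ 2)) * (Iio 1).indicator 1 (√(a ^ 2 + b ^ 2)) with hk
    have hkm : Measurable (Function.uncurry k) :=
      (hφ.comp (by fun_prop)).mul (hI.comp (by fun_prop))
    have hval : ∀ (a : ℝ) (v : F), h (a • e + v) = k a ‖v‖ := by
      intro a v
      have hv : ⟪e, (v : V)⟫ = 0 := Submodule.mem_orthogonal_singleton_iff_inner_right.1 v.2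
      have hn : ‖a • e + (v : V)‖ = √(a ^ 2 + ‖v‖ ^ 2) := by
        rw [← Real.sqrt_sq (norm_nonneg (a • e + (v : V))), norm_add_sq_real]
        simp [inner_smul_left, hv, norm_smul, he]
      have hi : ⟪e, a • e + (v : V)⟫ = a := by
        rw [inner_add_right, inner_smul_right, hv, real_inner_self_eq_norm_sq, he]; ring
      simp only [hh, hk, hn, hi]
    rw [lintegral_line_add_orthogonal he hm]
    simp_rw [hval]
    have hkb : ∀ a, Measurable (k a) := fun a => hkm.comp measurable_prodMk_left
    have hH : Measurable (Function.uncurry fun a b : ℝ => ENNReal.ofReal (b ^ (d - 2)) * k a b) :=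
      (by fun_prop : Measurable fun p : ℝ × ℝ => ENNReal.ofReal (p.2 ^ (d - 2))).mul hkm
    calc ∫⁻ a : ℝ, ∫⁻ v : F, k a ‖v‖
        = ∫⁻ a : ℝ, (volume : Measure F).toSphere univ *
            ∫⁻ b in Ioi (0 : ℝ), ENNReal.ofReal (b ^ (d - 2)) * k a b := by
          refine lintegral_congr fun a => ?_
          rw [lintegral_fun_norm _ (hkb a), hFd]; rfl
      _ = (volume : Measure F).toSphere univ * ∫⁻ a : ℝ,
            ∫⁻ b in Ioi (0 : ℝ), ENNReal.ofReal (b ^ (d - 2)) * k a b := by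
          exact lintegral_const_mul _ hH.lintegral_prod_right'
      _ = _ := by
          rw [lintegral_half_plane_polar hH, mul_comm _ A, hA,
            ← lintegral_mul_const _ (by fun_prop)]
          congr 1
          refine setLIntegral_congr_fun measurableSet_Ioi fun ρ hρ => ?_
          have hρ : 0 < ρ := hρ
          have hcs : Measurable fun θ : ℝ =>
              ENNReal.ofReal (Real.sin θ ^ (d - 2)) * φ (Real.cos θ) :=
            (by fun_prop : Measurable fun θ : ℝ => ENNReal.ofReal (Real.sin θ ^ (d - 2))).mul
              (hφ.comp Real.measurable_cos)
          rw [← lintegral_const_mul _ hcs]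
          refine setLIntegral_congr_fun measurableSet_Ioo fun θ hθ => ?_
          have hs := Real.sin_pos_of_mem_Ioo hθ
          have hsq : √((ρ * Real.cos θ) ^ 2 + (ρ * Real.sin θ) ^ 2) = ρ := by
            have : (ρ * Real.cos θ) ^ 2 + (ρ * Real.sin θ) ^ 2 = ρ ^ 2 := by
              nlinarith [Real.sin_sq_add_cos_sq θ]
            rw [this, Real.sqrt_sq hρ.le]
          have hc : ρ * Real.cos θ / ρ = Real.cos θ := by field_simp
          simp only [hk, hsq, hc]
          have hpow : ENNReal.ofReal ρ * ENNReal.ofReal ((ρ * Real.sin θ) ^ (d - 2)) =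
              ENNReal.ofReal (ρ ^ (d - 1)) * ENNReal.ofReal (Real.sin θ ^ (d - 2)) := by
            rw [← ENNReal.ofReal_mul hρ.le, ← ENNReal.ofReal_mul (by positivity), mul_pow]
            have : d - 1 = (d - 2) + 1 := by omega
            rw [this, pow_succ]; ring_nf
          calc _ = (ENNReal.ofReal ρ * ENNReal.ofReal ((ρ * Real.sin θ) ^ (d - 2))) *
              (φ (Real.cos θ) * (Iio 1).indicator 1 ρ) := by ring
            _ = _ := by rw [hpow]; ring
  rw [L1, ← mul_assoc] at L2
  exact (ENNReal.mul_left_inj hA0 hA1).1 L2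

/-- The normalizing constant of the density `sin ^ (d - 2)` on `(0, π)`. -/
def capConst (d : ℕ) : ℝ≥0∞ :=
  (∫⁻ θ in Ioo 0 Real.pi, ENNReal.ofReal (Real.sin θ ^ (d - 2)))⁻¹

theorem capConst_ne_top (d : ℕ) : capConst d ≠ ∞ := by
  rw [capConst, ENNReal.inv_ne_top]
  have hm : Measurable fun θ : ℝ => ENNReal.ofReal (Real.sin θ ^ (d - 2)) := by fun_prop
  rw [← pos_iff_ne_zero, setLIntegral_pos_iff hm]
  refine lt_of_lt_of_le (?_ : 0 < volume (Ioo (0 : ℝ) Real.pi)) (measure_mono ?_)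
  · simp [Real.pi_pos]
  · intro s hs
    refine ⟨?_, hs⟩
    have : 0 < Real.sin s ^ (d - 2) := pow_pos (Real.sin_pos_of_mem_Ioo hs) _
    simp [this]

theorem capConst_ne_zero (d : ℕ) : capConst d ≠ 0 := by
  rw [capConst, ne_eq, ENNReal.inv_eq_zero]
  refine ne_top_of_le_ne_top (b := ∫⁻ s in Ioo (0 : ℝ) Real.pi, 1) (by simp) ?_
  refine setLIntegral_mono measurable_const fun θ hθ => ?_
  exact ENNReal.ofReal_le_one.2 (pow_le_one₀ (Real.sin_pos_of_mem_Ioo hθ).le (Real.sin_le_one θ))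

theorem isProbabilityMeasure_sphereProb {d : ℕ} (hd : d ≠ 0) :
    IsProbabilityMeasure (sphereProb d) := by
  have : NeZero d := ⟨hd⟩
  constructor
  rw [sphereProb, Measure.smul_apply, smul_eq_mul]
  refine ENNReal.inv_mul_cancel ?_ (measure_ne_top _ _)
  rw [ne_eq, Measure.measure_univ_eq_zero]
  exact Measure.toSphere_ne_zero _

/-- The law of a coordinate under the normalized surface measure. -/
theorem lintegral_inner_sphereProb {d : ℕ} (hd : 2 ≤ d) {e : EuclideanSpace ℝ (Fin d)}
    (he : ‖e‖ = 1) {φ : ℝ → ℝ≥0∞} (hφ : Measurable φ) :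
    ∫⁻ y, φ ⟪e, (y : EuclideanSpace ℝ (Fin d))⟫ ∂(sphereProb d) =
      capConst d * ∫⁻ θ in Ioo 0 Real.pi,
        ENNReal.ofReal (Real.sin θ ^ (d - 2)) * φ (Real.cos θ) := by
  have hd' : 2 ≤ Module.finrank ℝ (EuclideanSpace ℝ (Fin d)) := by simpa using hd
  have := isProbabilityMeasure_sphereProb (d := d) (by omega)
  have key : ∀ ψ : ℝ → ℝ≥0∞, Measurable ψ → ∫⁻ y, ψ ⟪e, (y : EuclideanSpace ℝ (Fin d))⟫
      ∂(sphereProb d) = (((volume : Measure (EuclideanSpace ℝ (Fin d))).toSphere univ)⁻¹ *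
      (volume : Measure (Submodule.span ℝ {e})ᗮ).toSphere univ) * ∫⁻ θ in Ioo 0 Real.pi,
        ENNReal.ofReal (Real.sin θ ^ (d - 2)) * ψ (Real.cos θ) := by
    intro ψ hψ
    rw [sphereProb, lintegral_smul_measure, lintegral_inner_toSphere hd' he hψ,
      finrank_euclideanSpace_fin, smul_eq_mul, mul_assoc]
  rw [key φ hφ]
  congr 1
  -- The constant is identified without computing sphere areas, by testing against ψ = 1 and using
  -- that the total mass is 1.
  have h1 := key 1 measurable_one
  simp only [Pi.one_apply, lintegral_const, measure_univ, mul_one] at h1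
  exact ENNReal.eq_inv_of_mul_eq_one_left h1.symm

end

/-! ### The kernel of spherical means on radial functions and its size. -/

noncomputable section

open scoped RealInnerProductSpace

/-- The kernel of the spherical mean acting on radial functions. -/
def radialKernel (d : ℕ) (r t s : ℝ) : ℝ :=
  s / (r * t) * (√((s ^ 2 - (r - t) ^ 2) * ((r + t) ^ 2 - s ^ 2)) / (2 * r * t)) ^ (d - 3)

theorem measurable_radialKernel (d : ℕ) (r t : ℝ) : Measurable (radialKernel d r t) := by
  unfold radialKernel; fun_prop

theorem radialKernel_nonneg (d : ℕ) {r t s : ℝ} (hr : 0 < r) (ht : 0 < t) (hs : 0 ≤ s) :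
    0 ≤ radialKernel d r t s := by
  unfold radialKernel; positivity

/-- Law of cosines: θ is the angle between the sides r and t of a triangle whose third side is s.
The substitution s² = r² + t² - 2rt cos θ has ds = (rt sin θ / s) dθ, and the square root in the
kernel equals 2rt sin θ. -/
theorem lintegral_cos_law (d : ℕ) (hd : 3 ≤ d) {r t : ℝ} (hr : 0 < r) (ht : 0 < t)
    (φ : ℝ → ℝ≥0∞) :
    ∫⁻ θ in Ioo 0 Real.pi, ENNReal.ofReal (Real.sin θ ^ (d - 2)) *
      φ (√(r ^ 2 + t ^ 2 - 2 * r * t * Real.cos θ)) =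
    ∫⁻ s in Ioo |r - t| (r + t), ENNReal.ofReal (radialKernel d r t s) * φ s := by
  set S : ℝ → ℝ := fun θ => √(r ^ 2 + t ^ 2 - 2 * r * t * Real.cos θ) with hS
  have hrt : 0 < r * t := mul_pos hr ht
  have hcos : ∀ θ ∈ Ioo 0 Real.pi, -1 < Real.cos θ ∧ Real.cos θ < 1 := by
    intro θ hθ
    have hs := Real.sin_pos_of_mem_Ioo hθ
    have := Real.sin_sq_add_cos_sq θ
    constructor <;> nlinarith
  have hin : ∀ θ ∈ Ioo 0 Real.pi, (r - t) ^ 2 < r ^ 2 + t ^ 2 - 2 * r * t * Real.cos θ ∧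
      r ^ 2 + t ^ 2 - 2 * r * t * Real.cos θ < (r + t) ^ 2 := by
    intro θ hθ
    obtain ⟨h1, h2⟩ := hcos θ hθ
    constructor <;> nlinarith
  have hSpos : ∀ θ ∈ Ioo 0 Real.pi, 0 < S θ := fun θ hθ =>
    Real.sqrt_pos.2 (lt_of_le_of_lt (sq_nonneg _) (hin θ hθ).1)
  have hSsq : ∀ θ ∈ Ioo 0 Real.pi, S θ ^ 2 = r ^ 2 + t ^ 2 - 2 * r * t * Real.cos θ :=
    fun θ hθ => Real.sq_sqrt ((sq_nonneg _).trans (hin θ hθ).1.le)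
  have himg : S '' Ioo 0 Real.pi = Ioo |r - t| (r + t) := by
    ext s
    constructor
    · rintro ⟨θ, hθ, rfl⟩
      refine ⟨abs_lt_of_sq_lt_sq ?_ (hSpos θ hθ).le, ?_⟩
      · rw [hSsq θ hθ]; exact (hin θ hθ).1
      · refine lt_of_pow_lt_pow_left₀ 2 (by positivity) ?_
        rw [hSsq θ hθ]; exact (hin θ hθ).2
    · rintro ⟨h1, h2⟩
      have hs0 : 0 < s := lt_of_le_of_lt (abs_nonneg _) h1
      have h3 : (r - t) ^ 2 < s ^ 2 := by
        rw [← sq_abs (r - t)]; exact pow_lt_pow_left₀ h1 (abs_nonneg _) two_ne_zero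
      have h4 : s ^ 2 < (r + t) ^ 2 := pow_lt_pow_left₀ h2 hs0.le two_ne_zero
      -- The cosine of the angle opposite to s; the strict triangle inequalities put it in (-1, 1).
      set u := (r ^ 2 + t ^ 2 - s ^ 2) / (2 * r * t) with hu
      have hu' : 2 * r * t * u = r ^ 2 + t ^ 2 - s ^ 2 := by rw [hu]; field_simp
      have hu1 : -1 < u := by
        by_contra! h; nlinarith
      have hu2 : u < 1 := by
        by_contra! h; nlinarith
      refine ⟨Real.arccos u, ⟨Real.arccos_pos.2 hu2, ?_⟩, ?_⟩
      · refine lt_of_le_of_ne (Real.arccos_le_pi u) ?_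
        rw [ne_eq, Real.arccos_eq_pi]; linarith
      · simp only [hS, Real.cos_arccos hu1.le hu2.le, hu']
        rw [show r ^ 2 + t ^ 2 - (r ^ 2 + t ^ 2 - s ^ 2) = s ^ 2 by ring, Real.sqrt_sq hs0.le]
  have hinj : InjOn S (Ioo 0 Real.pi) := by
    intro a ha b hb hab
    have h1 := hSsq a ha
    rw [hab, hSsq b hb] at h1
    have : Real.cos a = Real.cos b := by
      have : 2 * (r * t) * (Real.cos a - Real.cos b) = 0 := by linarith
      rcases mul_eq_zero.1 this with h | h
      · linarith
      · linarith
    exact Real.injOn_cos (Ioo_subset_Icc_self ha) (Ioo_subset_Icc_self hb) this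
  have hder : ∀ θ ∈ Ioo 0 Real.pi,
      HasDerivWithinAt S (r * t * Real.sin θ / S θ) (Ioo 0 Real.pi) θ := by
    intro θ hθ
    have h1 : HasDerivAt (fun θ => r ^ 2 + t ^ 2 - 2 * r * t * Real.cos θ)
        (2 * r * t * Real.sin θ) θ := by
      have := ((Real.hasDerivAt_cos θ).const_mul (2 * r * t)).const_sub (r ^ 2 + t ^ 2)
      convert! this using 1
      ring
    have h2 := h1.sqrt (lt_of_le_of_lt (sq_nonneg _) (hin θ hθ).1).ne'
    convert! h2.hasDerivWithinAt using 1
    change _ = _ / (2 * S θ)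
    have := (hSpos θ hθ).ne'
    field_simp
  rw [← himg, lintegral_image_eq_lintegral_abs_deriv_mul measurableSet_Ioo hder hinj]
  refine setLIntegral_congr_fun measurableSet_Ioo fun θ hθ => ?_
  have hs := Real.sin_pos_of_mem_Ioo hθ
  have hS0 := hSpos θ hθ
  have hk : radialKernel d r t (S θ) = S θ / (r * t) * Real.sin θ ^ (d - 3) := by
    have h1 : (S θ ^ 2 - (r - t) ^ 2) * ((r + t) ^ 2 - S θ ^ 2) =
        (2 * r * t * Real.sin θ) ^ 2 := by
      rw [hSsq θ hθ]
      linear_combination 4 * r ^ 2 * t ^ 2 * (-Real.sin_sq_add_cos_sq θ)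
    have h2 : 0 < 2 * r * t * Real.sin θ := by positivity
    rw [radialKernel, h1, Real.sqrt_sq h2.le]
    congr 2
    field_simp
  rw [← mul_assoc, ← ENNReal.ofReal_mul (abs_nonneg _), hk, abs_of_pos (by positivity)]
  congr 2
  have : d - 2 = (d - 3) + 1 := by omega
  rw [this, pow_succ]
  field_simp

/-- The spherical mean of a radial function as a one-dimensional integral. -/
theorem lintegral_norm_sub_sphereProb {d : ℕ} (hd : 3 ≤ d) {x : EuclideanSpace ℝ (Fin d)}
    (hx : x ≠ 0) {t : ℝ} (ht : 0 < t) {φ : ℝ → ℝ≥0∞} (hφ : Measurable φ) :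
    ∫⁻ y, φ ‖x - t • (y : EuclideanSpace ℝ (Fin d))‖ ∂(sphereProb d) =
      capConst d * ∫⁻ s in Ioo |‖x‖ - t| (‖x‖ + t),
        ENNReal.ofReal (radialKernel d ‖x‖ t s) * φ s := by
  have hr : 0 < ‖x‖ := norm_pos_iff.2 hx
  set e := ‖x‖⁻¹ • x with he
  have hen : ‖e‖ = 1 := by rw [he, norm_smul, norm_inv, norm_norm, inv_mul_cancel₀ hr.ne']
  have hxe : x = ‖x‖ • e := by rw [he, smul_smul, mul_inv_cancel₀ hr.ne', one_smul]
  rw [← lintegral_cos_law d hd hr ht, ← lintegral_inner_sphereProb (by omega) hen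
    (φ := fun u => φ (√(‖x‖ ^ 2 + t ^ 2 - 2 * ‖x‖ * t * u))) (hφ.comp (by fun_prop))]
  refine lintegral_congr fun y => ?_
  have hy : ‖(y : EuclideanSpace ℝ (Fin d))‖ = 1 := by simp
  congr 1
  rw [← Real.sqrt_sq (norm_nonneg (x - t • (y : EuclideanSpace ℝ (Fin d)))), norm_sub_sq_real,
    norm_smul, hy, inner_smul_right]
  congr 1
  have : ⟪x, (y : EuclideanSpace ℝ (Fin d))⟫ = ‖x‖ * ⟪e, (y : EuclideanSpace ℝ (Fin d))⟫ := by
    conv_lhs => rw [hxe, inner_smul_left]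
    simp
  rw [this, Real.norm_eq_abs, mul_one, sq_abs]
  ring

theorem map_norm_sub_sphereProb {d : ℕ} (hd : 3 ≤ d) {x : EuclideanSpace ℝ (Fin d)}
    (hx : x ≠ 0) {t : ℝ} (ht : 0 < t) :
    (sphereProb d).map (fun y : Metric.sphere (0 : EuclideanSpace ℝ (Fin d)) 1 => ‖x - t • (y : EuclideanSpace ℝ (Fin d))‖) =
      capConst d • (volume.restrict (Ioo |‖x‖ - t| (‖x‖ + t))).withDensity
        (fun s => ENNReal.ofReal (radialKernel d ‖x‖ t s)) := by
  ext A hA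
  have hm : Measurable fun y : Metric.sphere (0 : EuclideanSpace ℝ (Fin d)) 1 =>
      ‖x - t • (y : EuclideanSpace ℝ (Fin d))‖ := by fun_prop
  rw [Measure.map_apply hm hA, Measure.smul_apply, withDensity_apply _ hA,
    ← lintegral_indicator_one (hm hA), smul_eq_mul, ← lintegral_indicator hA]
  have := lintegral_norm_sub_sphereProb hd hx ht (measurable_one.indicator hA)
  refine (lintegral_congr fun y => ?_).trans (this.trans ?_)
  · rfl
  · congr 1
    refine lintegral_congr fun s => ?_
    by_cases h : s ∈ A <;> simp [h]

theorem integral_norm_sub_sphereProb {d : ℕ} (hd : 3 ≤ d) {x : EuclideanSpace ℝ (Fin d)}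
    (hx : x ≠ 0) {t : ℝ} (ht : 0 < t) {g : ℝ → ℂ} (hg : Measurable g) :
    ∫ y : Metric.sphere (0 : EuclideanSpace ℝ (Fin d)) 1,
      g ‖x - t • (y : EuclideanSpace ℝ (Fin d))‖ ∂(sphereProb d) =
      (capConst d).toReal • ∫ s in Ioo |‖x‖ - t| (‖x‖ + t), radialKernel d ‖x‖ t s • g s := by
  have hm : Measurable fun y : Metric.sphere (0 : EuclideanSpace ℝ (Fin d)) 1 =>
      ‖x - t • (y : EuclideanSpace ℝ (Fin d))‖ := by fun_prop
  rw [← integral_map (f := g) hm.aemeasurable hg.aestronglyMeasurable,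
    map_norm_sub_sphereProb hd hx ht, integral_smul_measure,
    integral_withDensity_eq_integral_toReal_smul
      (measurable_radialKernel d ‖x‖ t).ennreal_ofReal (by simp)]
  congr 1
  refine setIntegral_congr_fun measurableSet_Ioo fun s hs => ?_
  have : 0 ≤ radialKernel d ‖x‖ t s :=
    radialKernel_nonneg d (norm_pos_iff.2 hx) ht ((abs_nonneg _).trans hs.1.le)
  simp only [ENNReal.toReal_ofReal this]

/-- The distance to the origin has a density on the translated sphere, so null sets of radii are
invisible to spherical means. This allows a radial function to be replaced by a Borel profile at
every centre x ≠ 0. -/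
theorem ae_norm_sub_sphereProb {d : ℕ} (hd : 3 ≤ d) {x : EuclideanSpace ℝ (Fin d)}
    (hx : x ≠ 0) {t : ℝ} (ht : 0 < t) {P : ℝ → Prop} (hP : ∀ᵐ s ∂(volume.restrict (Ioi 0)), P s) :
    ∀ᵐ y : Metric.sphere (0 : EuclideanSpace ℝ (Fin d)) 1 ∂(sphereProb d),
      P ‖x - t • (y : EuclideanSpace ℝ (Fin d))‖ := by
  have hm : Measurable fun y : Metric.sphere (0 : EuclideanSpace ℝ (Fin d)) 1 =>
      ‖x - t • (y : EuclideanSpace ℝ (Fin d))‖ := by fun_prop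
  refine ae_of_ae_map hm.aemeasurable ?_
  rw [map_norm_sub_sphereProb hd hx ht]
  refine Measure.ae_smul_measure ?_ _
  refine (withDensity_absolutelyContinuous _ _).ae_le ?_
  exact ae_restrict_of_ae_restrict_of_subset
    (fun s hs => lt_of_le_of_lt (abs_nonneg _) hs.1) hP

/-- The radicand equals (2rt)² - (s² - r² - t²)². -/
theorem sqrt_radialKernel_le {r t s : ℝ} (hr : 0 < r) (ht : 0 < t) :
    √((s ^ 2 - (r - t) ^ 2) * ((r + t) ^ 2 - s ^ 2)) / (2 * r * t) ≤ 1 := by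
  rw [div_le_one (by positivity)]
  refine Real.sqrt_le_iff.2 ⟨by positivity, ?_⟩
  nlinarith [sq_nonneg (s ^ 2 - r ^ 2 - t ^ 2)]

theorem radialKernel_le (d : ℕ) {r t s : ℝ} (hr : 0 < r) (ht : 0 < t) (hs : 0 ≤ s) :
    radialKernel d r t s ≤ s / (r * t) := by
  unfold radialKernel
  refine mul_le_of_le_one_right (by positivity) (pow_le_one₀ (by positivity) ?_)
  exact sqrt_radialKernel_le hr ht

/-- Away from r = 0 both factors of the kernel are at most 2s; for the square root this uses s² -
(r-t)² ≤ s² and r + t ≤ 4rt. -/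
theorem radialKernel_le_pow {d : ℕ} (hd : 3 ≤ d) {r t s : ℝ} (hr : 1 / 2 ≤ r) (ht : 1 ≤ t)
    (hs : 0 ≤ s) : radialKernel d r t s ≤ 2 ^ (d - 2) * s ^ (d - 2) := by
  have hr0 : 0 < r := by linarith
  have ht0 : 0 < t := by linarith
  have h1 : s / (r * t) ≤ 2 * s := by
    rw [div_le_iff₀ (by positivity)]
    have : 1 / 2 ≤ r * t := by nlinarith
    nlinarith
  have h2 : √((s ^ 2 - (r - t) ^ 2) * ((r + t) ^ 2 - s ^ 2)) / (2 * r * t) ≤ 2 * s := by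
    rw [div_le_iff₀ (by positivity)]
    refine Real.sqrt_le_iff.2 ⟨by positivity, ?_⟩
    have h3 : r + t ≤ 2 * s * 0 + 4 * r * t := by nlinarith
    have h4 : (r + t) ^ 2 ≤ (4 * r * t) ^ 2 := pow_le_pow_left₀ (by positivity) (by linarith) 2
    by_cases h5 : 0 ≤ (r + t) ^ 2 - s ^ 2
    · have : (s ^ 2 - (r - t) ^ 2) * ((r + t) ^ 2 - s ^ 2) ≤ s ^ 2 * (4 * r * t) ^ 2 := by
        refine mul_le_mul ?_ ?_ h5 (sq_nonneg s)
        · nlinarith [sq_nonneg (r - t)]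
        · nlinarith [sq_nonneg s]
      calc _ ≤ _ := this
        _ = _ := by ring
    · push Not at h5
      have : 0 ≤ s ^ 2 - (r - t) ^ 2 := by nlinarith
      have := mul_nonpos_of_nonneg_of_nonpos this h5.le
      exact this.trans (sq_nonneg _)
  unfold radialKernel
  calc _ ≤ (2 * s) * (2 * s) ^ (d - 3) := by gcongr
    _ = _ := by
      have : d - 2 = (d - 3) + 1 := by omega
      rw [this]; ring

/-- The converse of `radialKernel_le_pow`, valid once s is at least twice the lower endpoint |r -
t|. It drives the lower bounds for the test functions concentrated near the origin. -/
theorem le_radialKernel {d : ℕ} (hd : 3 ≤ d) {r t s : ℝ} (hr : 1 / 2 ≤ r) (hr3 : r ≤ 3)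
    (ht : 1 ≤ t) (ht2 : t ≤ 2) (hs : 2 * |r - t| ≤ s) (hs2 : s ≤ 1 / 2) :
    (s / 24) ^ (d - 2) ≤ radialKernel d r t s := by
  have hr0 : 0 < r := by linarith
  have ht0 : 0 < t := by linarith
  have hs0 : 0 ≤ s := (by positivity : 0 ≤ 2 * |r - t|).trans hs
  have hrt : r * t ≤ 6 := by nlinarith
  have h1 : s / 24 ≤ s / (r * t) := by
    apply div_le_div_of_nonneg_left hs0 (by positivity); linarith
  have h2 : s / 24 ≤ √((s ^ 2 - (r - t) ^ 2) * ((r + t) ^ 2 - s ^ 2)) / (2 * r * t) := by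
    rw [le_div_iff₀ (by positivity)]
    refine (?_ : _ ≤ s / 2).trans ?_
    · nlinarith
    · refine Real.le_sqrt_of_sq_le ?_
      have h3 : (r - t) ^ 2 ≤ s ^ 2 / 4 := by
        rw [← sq_abs (r - t)]
        nlinarith [abs_nonneg (r - t)]
      have h4 : 1 ≤ (r + t) ^ 2 - s ^ 2 := by nlinarith
      have h5 : s ^ 2 / 4 ≤ s ^ 2 - (r - t) ^ 2 := by nlinarith
      nlinarith [sq_nonneg s]
  unfold radialKernel
  have : d - 2 = (d - 3) + 1 := by omega
  rw [this, pow_succ']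
  gcongr

end

/-! ### Borel profiles, continuity in t, and measurability of the maximal function. -/

noncomputable section

open Filter Topology

section NormLaw

variable {V : Type*} [NormedAddCommGroup V] [NormedSpace ℝ V] [MeasurableSpace V]
  [BorelSpace V] [FiniteDimensional ℝ V] [Nontrivial V] (μ : Measure V) [μ.IsAddHaarMeasure]

theorem ae_norm_of_ae_Ioi {P : ℝ → Prop} (hP : ∀ᵐ s ∂(volume.restrict (Ioi 0)), P s) :
    ∀ᵐ x ∂μ, P ‖x‖ := by
  obtain ⟨N, hN1, hN2, hN3⟩ := exists_measurable_superset_of_null hP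
  have h := lintegral_fun_norm μ (measurable_one.indicator hN2 : Measurable (N.indicator 1))
  have h0 : ∫⁻ s in Ioi (0 : ℝ), ENNReal.ofReal (s ^ (Module.finrank ℝ V - 1)) *
      N.indicator 1 s = 0 := by
    refine (lintegral_eq_zero_iff ((by fun_prop : Measurable fun s : ℝ => ENNReal.ofReal
      (s ^ (Module.finrank ℝ V - 1))).mul (measurable_one.indicator hN2))).2 ?_
    filter_upwards [measure_eq_zero_iff_ae_notMem.1 hN3] with s hs
    simp [hs]
  rw [h0, mul_zero] at h
  replace h := (lintegral_eq_zero_iff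
    ((measurable_one.indicator hN2 : Measurable (N.indicator 1)).comp measurable_norm)).1 h
  filter_upwards [h] with x hx
  by_contra hc
  have : ‖x‖ ∈ N := hN1 hc
  simp [this] at hx

theorem ae_Ioi_of_ae_norm {P : ℝ → Prop} (hm : MeasurableSet {s | P s}) (hP : ∀ᵐ x ∂μ, P ‖x‖) :
    ∀ᵐ s ∂(volume.restrict (Ioi 0)), P s := by
  have hi : Measurable ({s | P s}ᶜ.indicator (1 : ℝ → ℝ≥0∞)) := measurable_one.indicator hm.compl
  have h := lintegral_fun_norm μ hi
  have h0 : ∫⁻ x, {s | P s}ᶜ.indicator (1 : ℝ → ℝ≥0∞) ‖x‖ ∂μ = 0 := by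
    refine (lintegral_eq_zero_iff (hi.comp measurable_norm)).2 ?_
    filter_upwards [hP] with x hx
    simp [hx]
  rw [h0, eq_comm, mul_eq_zero, or_iff_right
    (by rw [Measure.measure_univ_eq_zero]; exact μ.toSphere_ne_zero)] at h
  replace h := (lintegral_eq_zero_iff ((by fun_prop : Measurable fun s : ℝ => ENNReal.ofReal
      (s ^ (Module.finrank ℝ V - 1))).mul hi)).1 h
  filter_upwards [h, ae_restrict_mem measurableSet_Ioi] with s hs hs0
  by_contra hc
  have h2 : s ∈ {s | P s}ᶜ := hc
  have h3 : 0 < s ^ (Module.finrank ℝ V - 1) := pow_pos hs0 _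
  simp [indicator_of_mem h2, h3.not_ge] at hs

/-- A measurable radial function has a Borel radial profile. -/
theorem exists_measurable_profile {f : V → ℂ} (hrad : ∀ x y, ‖x‖ = ‖y‖ → f x = f y)
    (hf : AEStronglyMeasurable f μ) :
    ∃ g : ℝ → ℂ, Measurable g ∧
      ∀ᵐ s ∂(volume.restrict (Ioi 0)), ∀ x : V, ‖x‖ = s → f x = g s := by
  obtain ⟨N, hN1, hN2, hN3⟩ := exists_measurable_superset_of_null
    (hf.ae_eq_mk : ∀ᵐ x ∂μ, f x = hf.mk f x)
  have hi : Measurable (N.indicator (1 : V → ℝ≥0∞)) := measurable_one.indicator hN2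
  have h := lintegral_polar μ hi
  rw [lintegral_indicator_one hN2, hN3, eq_comm] at h
  have hw : Measurable fun s : ℝ => ENNReal.ofReal (s ^ (Module.finrank ℝ V - 1)) := by fun_prop
  have hm : Measurable fun q : Metric.sphere (0 : V) 1 × ℝ =>
      ENNReal.ofReal (q.2 ^ (Module.finrank ℝ V - 1)) * N.indicator 1 (q.2 • (q.1 : V)) :=
    (by fun_prop : Measurable fun q : Metric.sphere (0 : V) 1 × ℝ =>
      ENNReal.ofReal (q.2 ^ (Module.finrank ℝ V - 1))).mul (hi.comp (by fun_prop))
  rw [lintegral_eq_zero_iff hm.lintegral_prod_right'] at h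
  have : (ae μ.toSphere).NeBot := ae_neBot.2 μ.toSphere_ne_zero
  -- By Fubini almost every ray meets the exceptional set in a null set. One such ray defines the
  -- profile, and radiality carries it to all other directions.
  obtain ⟨ω, hω⟩ := h.exists
  have hω1 : ‖(ω : V)‖ = 1 := by simp
  replace hω := (lintegral_eq_zero_iff
    (hw.mul (hi.comp (by fun_prop : Measurable fun s : ℝ => s • (ω : V))))).1 hω
  refine ⟨fun s => hf.mk f (s • (ω : V)),
    hf.stronglyMeasurable_mk.measurable.comp (by fun_prop), ?_⟩
  filter_upwards [hω, ae_restrict_mem measurableSet_Ioi] with s hs hs0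
  have hs0 : 0 < s := hs0
  intro x hx
  rw [hrad x (s • (ω : V)) (by rw [hx, norm_smul, hω1, mul_one, Real.norm_of_nonneg hs0.le])]
  by_contra hc
  have h2 : s • (ω : V) ∈ N := hN1 hc
  have h3 : 0 < s ^ (Module.finrank ℝ V - 1) := pow_pos hs0 _
  simp [indicator_of_mem h2, h3.not_ge] at hs

end NormLaw

variable {d : ℕ}

/-- `g` is a Borel profile of the radial function `f`. -/
def IsProfile (f : EuclideanSpace ℝ (Fin d) → ℂ) (g : ℝ → ℂ) : Prop :=
  Measurable g ∧
    ∀ᵐ s ∂(volume.restrict (Ioi 0)), ∀ x : EuclideanSpace ℝ (Fin d), ‖x‖ = s → f x = g s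

variable {f : EuclideanSpace ℝ (Fin d) → ℂ} {g : ℝ → ℂ}

theorem IsProfile.ae_eq_sphere (hd : 3 ≤ d) (h : IsProfile f g) {x : EuclideanSpace ℝ (Fin d)}
    (hx : x ≠ 0) {t : ℝ} (ht : 0 < t) :
    (fun y : Metric.sphere (0 : EuclideanSpace ℝ (Fin d)) 1 =>
      f (x - t • (y : EuclideanSpace ℝ (Fin d)))) =ᵐ[sphereProb d] fun y => g ‖x - t • y.1‖ := by
  filter_upwards [ae_norm_sub_sphereProb hd hx ht h.2] with y hy using hy _ rfl

theorem IsProfile.sphericalMean_eq (hd : 3 ≤ d) (h : IsProfile f g)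
    {x : EuclideanSpace ℝ (Fin d)} (hx : x ≠ 0) {t : ℝ} (ht : 0 < t) :
    sphericalMean t f x = ∫ y, g ‖x - t • y.1‖ ∂(sphereProb d) :=
  integral_congr_ae (h.ae_eq_sphere hd hx ht)

/-- The one-dimensional form of the spherical mean of a nonnegative radial function. -/
def radialMean (d : ℕ) (F : ℝ → ℝ≥0∞) (r t : ℝ) : ℝ≥0∞ :=
  ∫⁻ s in Ioo |r - t| (r + t), ENNReal.ofReal (radialKernel d r t s) * F s

theorem IsProfile.lintegral_enorm (hd : 3 ≤ d) (h : IsProfile f g)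
    {x : EuclideanSpace ℝ (Fin d)} (hx : x ≠ 0) {t : ℝ} (ht : 0 < t) :
    ∫⁻ y : Metric.sphere (0 : EuclideanSpace ℝ (Fin d)) 1,
      ‖f (x - t • (y : EuclideanSpace ℝ (Fin d)))‖ₑ ∂(sphereProb d) =
    capConst d * radialMean d (fun s => ‖g s‖ₑ) ‖x‖ t := by
  rw [radialMean, ← lintegral_norm_sub_sphereProb hd hx ht h.1.enorm]
  refine lintegral_congr_ae ?_
  filter_upwards [h.ae_eq_sphere hd hx ht] with y hy
  rw [hy]

theorem IsProfile.enorm_sphericalMean_le (hd : 3 ≤ d) (h : IsProfile f g)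
    {x : EuclideanSpace ℝ (Fin d)} (hx : x ≠ 0) {t : ℝ} (ht : 0 < t) :
    ‖sphericalMean t f x‖ₑ ≤ capConst d * radialMean d (fun s => ‖g s‖ₑ) ‖x‖ t :=
  (enorm_integral_le_lintegral_enorm _).trans (h.lintegral_enorm hd hx ht).le

theorem radialMean_ne_top {F : ℝ → ℝ≥0∞}
    (hF : ∀ a b : ℝ, 0 < a → ∫⁻ s in Icc a b, F s ≠ ∞)
    {r t : ℝ} (hr : 0 < r) (ht : 0 < t) (hrt : r ≠ t) : radialMean d F r t ≠ ∞ := by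
  have h0 : 0 < |r - t| := abs_pos.2 (sub_ne_zero.2 hrt)
  have : radialMean d F r t ≤
      ENNReal.ofReal ((r + t) / (r * t)) * ∫⁻ s in Icc |r - t| (r + t), F s := by
    rw [radialMean, ← lintegral_const_mul' _ _ ENNReal.ofReal_ne_top]
    refine (setLIntegral_mono' measurableSet_Ioo fun s hs => ?_).trans
      (lintegral_mono_set Ioo_subset_Icc_self)
    gcongr
    have hs0 : 0 ≤ s := h0.le.trans hs.1.le
    refine (radialKernel_le d hr ht hs0).trans ?_
    have := hs.2.le
    gcongr
  exact ne_top_of_le_ne_top (ENNReal.mul_ne_top ENNReal.ofReal_ne_top (hF _ _ h0)) this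

theorem IsProfile.integrable (hd : 3 ≤ d) (h : IsProfile f g)
    (hg : ∀ a b : ℝ, 0 < a → ∫⁻ s in Icc a b, ‖g s‖ₑ ≠ ∞)
    {x : EuclideanSpace ℝ (Fin d)} (hx : x ≠ 0) {t : ℝ} (ht : 0 < t) (hxt : ‖x‖ ≠ t) :
    Integrable (fun y : Metric.sphere (0 : EuclideanSpace ℝ (Fin d)) 1 =>
      f (x - t • (y : EuclideanSpace ℝ (Fin d)))) (sphereProb d) := by
  have hm : Measurable fun y : Metric.sphere (0 : EuclideanSpace ℝ (Fin d)) 1 =>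
      g ‖x - t • y.1‖ := h.1.comp (by fun_prop)
  refine ⟨hm.aestronglyMeasurable.congr (h.ae_eq_sphere hd hx ht).symm, ?_⟩
  rw [hasFiniteIntegral_iff_enorm, h.lintegral_enorm hd hx ht]
  exact ENNReal.mul_lt_top (capConst_ne_top d).lt_top
    (radialMean_ne_top hg (norm_pos_iff.2 hx) ht hxt).lt_top

theorem continuousAt_indicator_Ioo_kernel {r t₀ s : ℝ} (hr : 0 < r) (ht₀ : 0 < t₀)
    (h1 : s ≠ |r - t₀|) (h2 : s ≠ r + t₀) (z : ℂ) :
    ContinuousAt (fun t => (Ioo |r - t| (r + t)).indicator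
      (fun s => radialKernel d r t s • z) s) t₀ := by
  have c1 : ContinuousAt (fun t : ℝ => |r - t|) t₀ := by fun_prop
  have c2 : ContinuousAt (fun t : ℝ => r + t) t₀ := by fun_prop
  by_cases hs : s ∈ Ioo |r - t₀| (r + t₀)
  · have hev : ∀ᶠ t in 𝓝 t₀, s ∈ Ioo |r - t| (r + t) :=
      (c1.eventually_lt_const hs.1).and (c2.eventually_const_lt hs.2)
    have hc : ContinuousAt (fun t => radialKernel d r t s • z) t₀ := by
      unfold radialKernel
      have e1 : r * t₀ ≠ 0 := (mul_pos hr ht₀).ne'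
      have e2 : 2 * r * t₀ ≠ 0 := by positivity
      fun_prop (disch := assumption)
    refine hc.congr ?_
    filter_upwards [hev] with t ht
    rw [indicator_of_mem ht]
  · have hev : ∀ᶠ t in 𝓝 t₀, s ∉ Ioo |r - t| (r + t) := by
      by_cases h3 : s < |r - t₀|
      · filter_upwards [c1.eventually_const_lt h3] with t ht h
        exact lt_asymm ht h.1
      · have h4 : |r - t₀| < s := lt_of_le_of_ne (not_lt.1 h3) h1.symm
        have h5 : r + t₀ < s := by
          refine lt_of_le_of_ne ?_ h2.symm
          by_contra! h6
          exact hs ⟨h4, h6⟩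
        filter_upwards [c2.eventually_lt_const h5] with t ht h
        exact lt_asymm ht h.2
    refine (continuousAt_const : ContinuousAt (fun _ => (0 : ℂ)) t₀).congr ?_
    filter_upwards [hev] with t ht
    rw [indicator_of_notMem ht]

/-- For t near t₀ the integration range stays in a compact interval away from 0, where g is
integrable and the kernel is uniformly bounded. The integrand is continuous at t₀ for all s except
the two endpoints, so dominated convergence applies. The assumption ‖x‖ ≠ t₀ keeps s = 0, where g
need not be integrable, out of the range. -/
theorem IsProfile.continuousAt_sphericalMean (hd : 3 ≤ d) (h : IsProfile f g)
    (hg : ∀ a b : ℝ, 0 < a → ∫⁻ s in Icc a b, ‖g s‖ₑ ≠ ∞)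
    {x : EuclideanSpace ℝ (Fin d)} (hx : x ≠ 0) {t₀ : ℝ} (ht₀ : 0 < t₀) (hxt : ‖x‖ ≠ t₀) :
    ContinuousAt (fun t => sphericalMean t f x) t₀ := by
  have hr : 0 < ‖x‖ := norm_pos_iff.2 hx
  set r := ‖x‖ with hrdef
  have hη : 0 < |r - t₀| := abs_pos.2 (sub_ne_zero.2 hxt)
  have hpos : ∀ᶠ t in 𝓝 t₀, 0 < t := lt_mem_nhds ht₀
  have heq : (fun t => sphericalMean t f x) =ᶠ[𝓝 t₀] fun t => (capConst d).toReal •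
      ∫ s, (Ioo |r - t| (r + t)).indicator (fun s => radialKernel d r t s • g s) s := by
    filter_upwards [hpos] with t ht
    rw [h.sphericalMean_eq hd hx ht, integral_norm_sub_sphereProb hd hx ht h.1,
      integral_indicator measurableSet_Ioo]
  suffices hc : ContinuousAt (fun t =>
      ∫ s, (Ioo |r - t| (r + t)).indicator (fun s => radialKernel d r t s • g s) s) t₀ from
    ContinuousAt.congr (hc.const_smul (capConst d).toReal) heq.symm
  have ev : ∀ᶠ t in 𝓝 t₀, t₀ / 2 < t ∧ t < 2 * t₀ ∧ |r - t₀| / 2 < |r - t| := by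
    have c1 : ContinuousAt (fun t : ℝ => |r - t|) t₀ := by fun_prop
    filter_upwards [lt_mem_nhds (half_lt_self ht₀), gt_mem_nhds (by linarith : t₀ < 2 * t₀),
      c1.eventually_const_lt (half_lt_self hη)] with t h1 h2 h3
    exact ⟨h1, h2, h3⟩
  refine continuousAt_of_dominated
    (bound := (Icc (|r - t₀| / 2) (r + 2 * t₀)).indicator
      fun s => (r + 2 * t₀) / (r * (t₀ / 2)) * ‖g s‖) ?_ ?_ ?_ ?_
  · refine Eventually.of_forall fun t => ?_
    exact (((measurable_radialKernel d r t).smul h.1).indicator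
      measurableSet_Ioo).aestronglyMeasurable
  · filter_upwards [ev] with t ⟨h1, h2, h3⟩
    refine Eventually.of_forall fun s => ?_
    have ht : 0 < t := by linarith
    by_cases hs : s ∈ Ioo |r - t| (r + t)
    · have hs' : s ∈ Icc (|r - t₀| / 2) (r + 2 * t₀) :=
        ⟨by linarith [hs.1], by linarith [hs.2]⟩
      have hs0 : 0 ≤ s := (abs_nonneg _).trans hs.1.le
      rw [indicator_of_mem hs, indicator_of_mem hs', norm_smul,
        Real.norm_of_nonneg (radialKernel_nonneg d hr ht hs0)]
      have := hs'.2
      gcongr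
      refine (radialKernel_le d hr ht hs0).trans ?_
      gcongr
    · rw [indicator_of_notMem hs, norm_zero]
      exact indicator_nonneg (fun s _ => by positivity) s
  · rw [integrable_indicator_iff measurableSet_Icc]
    refine Integrable.const_mul ?_ _
    refine ⟨h.1.norm.aestronglyMeasurable, ?_⟩
    rw [hasFiniteIntegral_iff_enorm]
    simp only [enorm_norm]
    exact (hg _ _ (by positivity)).lt_top
  · have : ∀ᵐ s : ℝ, s ≠ |r - t₀| ∧ s ≠ r + t₀ :=
      (Measure.ae_ne volume _).and (Measure.ae_ne volume _)
    filter_upwards [this] with s hs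
    exact continuousAt_indicator_Ioo_kernel hr ht₀ hs.1 hs.2 (g s)

theorem IsProfile.aemeasurable_sphericalMean (hd : 3 ≤ d) (h : IsProfile f g) {t : ℝ}
    (ht : 0 < t) : AEMeasurable (sphericalMean t f) volume := by
  have := isProbabilityMeasure_sphereProb (d := d) (by omega)
  have : NeZero d := ⟨by omega⟩
  have hm : StronglyMeasurable fun q : EuclideanSpace ℝ (Fin d) ×
      Metric.sphere (0 : EuclideanSpace ℝ (Fin d)) 1 => g ‖q.1 - t • q.2.1‖ :=
    (h.1.comp (by fun_prop)).stronglyMeasurable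
  refine ⟨fun x => ∫ y, g ‖x - t • y.1‖ ∂(sphereProb d),
    hm.integral_prod_right'.measurable, ?_⟩
  filter_upwards [Measure.ae_ne volume (0 : EuclideanSpace ℝ (Fin d))] with x hx
  exact h.sphericalMean_eq hd hx ht

/-- Since the closure of E is null, almost every x has ‖x‖ outside it. For such x the means are
continuous at each point of E, and the supremum may be taken over a countable dense subset. -/
theorem IsProfile.aemeasurable_sphericalMaximal (hd : 3 ≤ d) (h : IsProfile f g)
    (hg : ∀ a b : ℝ, 0 < a → ∫⁻ s in Icc a b, ‖g s‖ₑ ≠ ∞)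
    {E : Set ℝ} (hE : E ⊆ Ioi 0) (hE0 : volume (closure E) = 0) :
    AEMeasurable (sphericalMaximal E f) volume := by
  have : NeZero d := ⟨by omega⟩
  obtain ⟨D, hDE, hDc, hDd⟩ := (TopologicalSpace.IsSeparable.of_separableSpace E).exists_countable_dense_subset
  have hm : AEMeasurable (fun x => ⨆ t ∈ D, ‖sphericalMean t f x‖ₑ) volume :=
    AEMeasurable.biSup D hDc fun t ht => (h.aemeasurable_sphericalMean hd (hE (hDE ht))).enorm
  refine hm.congr ?_
  have hN : ∀ᵐ s ∂(volume.restrict (Ioi (0:ℝ))), s ∉ closure E :=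
    ae_restrict_of_ae (measure_eq_zero_iff_ae_notMem.1 hE0)
  filter_upwards [Measure.ae_ne volume (0 : EuclideanSpace ℝ (Fin d)),
    ae_norm_of_ae_Ioi volume hN] with x hx hxE
  refine le_antisymm (biSup_mono hDE) (iSup₂_le fun t ht => ?_)
  have hc : ContinuousAt (fun t => ‖sphericalMean t f x‖ₑ) t :=
    (h.continuousAt_sphericalMean hd hg hx (hE ht)
      (fun h => hxE (h ▸ subset_closure ht))).enorm
  have : (𝓝[D] t).NeBot :=
    mem_closure_iff_nhdsWithin_neBot.1 (hDd ht)
  have hc' : Tendsto (fun t => ‖sphericalMean t f x‖ₑ) (𝓝[D] t) (𝓝 ‖sphericalMean t f x‖ₑ) :=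
    hc.tendsto.mono_left nhdsWithin_le_nhds
  refine le_of_tendsto hc' ?_
  filter_upwards [self_mem_nhdsWithin] with u hu
  exact le_iSup₂ (f := fun t (_ : t ∈ D) => ‖sphericalMean t f x‖ₑ) u hu

theorem IsProfile.ae_integrable (hd : 3 ≤ d) (h : IsProfile f g)
    (hg : ∀ a b : ℝ, 0 < a → ∫⁻ s in Icc a b, ‖g s‖ₑ ≠ ∞)
    {E : Set ℝ} (hE : E ⊆ Ioi 0) (hE0 : volume (closure E) = 0) :
    ∀ᵐ x : EuclideanSpace ℝ (Fin d), ∀ t ∈ E,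
      Integrable (fun y : Metric.sphere (0 : EuclideanSpace ℝ (Fin d)) 1 =>
        f (x - t • (y : EuclideanSpace ℝ (Fin d)))) (sphereProb d) := by
  have : NeZero d := ⟨by omega⟩
  have hN : ∀ᵐ s ∂(volume.restrict (Ioi (0:ℝ))), s ∉ closure E :=
    ae_restrict_of_ae (measure_eq_zero_iff_ae_notMem.1 hE0)
  filter_upwards [Measure.ae_ne volume (0 : EuclideanSpace ℝ (Fin d)),
    ae_norm_of_ae_Ioi volume hN] with x hx hxE t ht
  exact h.integrable hd hg hx (hE ht) fun h => hxE (h ▸ subset_closure ht)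

end

/-! ### Interpolation by powers, layer cake, and a Hardy type inequality. -/

noncomputable section

open Filter Topology

section Convexity

variable {α : Type*} [MeasurableSpace α] {μ : Measure α} {X : α → ℝ≥0∞}

/-- Jensen's inequality for the power `p` on a measure space of arbitrary mass. -/
theorem rpow_lintegral_le {p : ℝ} (hp : 1 ≤ p) (hX : AEMeasurable X μ) :
    (∫⁻ a, X a ∂μ) ^ p ≤ μ univ ^ (p - 1) * ∫⁻ a, X a ^ p ∂μ := by
  rcases hp.eq_or_lt with rfl | hp
  · simp
  have hpq := Real.HolderConjugate.conjExponent hp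
  have h := ENNReal.lintegral_mul_le_Lp_mul_Lq μ hpq hX (aemeasurable_const (b := (1 : ℝ≥0∞)))
  simp only [Pi.mul_apply, mul_one, ENNReal.one_rpow, lintegral_const, one_mul] at h
  have hp0 : 0 < p := hpq.pos
  calc (∫⁻ a, X a ∂μ) ^ p
      ≤ ((∫⁻ a, X a ^ p ∂μ) ^ (1 / p) * μ univ ^ (1 / p.conjExponent)) ^ p := by gcongr
    _ = _ := by
      rw [ENNReal.mul_rpow_of_nonneg _ _ hp0.le, ← ENNReal.rpow_mul, ← ENNReal.rpow_mul,
        one_div_mul_cancel hp0.ne', ENNReal.rpow_one, mul_comm]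
      congr 2
      rw [Real.conjExponent]
      field_simp

/-- Interpolation between an L^p → L^∞ and an L^p → L^p bound, by writing X^q = (X^p)^(q/p-1) X^p.
It gives the passage from p to q both in the far region and in the sequence inequality. -/
theorem lintegral_rpow_le_mul_rpow {p q : ℝ} (hp : 0 < p) (hpq : p ≤ q) {A B I : ℝ≥0∞}
    (hX : AEMeasurable X μ) (h1 : ∀ᵐ a ∂μ, X a ^ p ≤ A * I) (h2 : ∫⁻ a, X a ^ p ∂μ ≤ B * I) :
    ∫⁻ a, X a ^ q ∂μ ≤ A ^ (q / p - 1) * B * I ^ (q / p) := by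
  have hk : 0 ≤ q / p - 1 := by rw [sub_nonneg, le_div_iff₀ hp]; linarith
  have hpow : ∀ a, X a ^ q = (X a ^ p) ^ (q / p - 1) * X a ^ p := by
    intro a
    rw [← ENNReal.rpow_mul, ← ENNReal.rpow_add_of_nonneg _ _ (by positivity) hp.le]
    congr 1
    field_simp
    ring
  have hI : I ^ (q / p) = I ^ (q / p - 1) * I := by
    conv_rhs => rw [← ENNReal.rpow_one I, ← ENNReal.rpow_mul,
      ← ENNReal.rpow_add_of_nonneg _ _ (by simpa using hk) zero_le_one]
    congr 1
    ring
  calc ∫⁻ a, X a ^ q ∂μ ≤ ∫⁻ a, (A * I) ^ (q / p - 1) * X a ^ p ∂μ := by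
        refine lintegral_mono_ae ?_
        filter_upwards [h1] with a ha
        rw [hpow]
        gcongr
    _ = (A * I) ^ (q / p - 1) * ∫⁻ a, X a ^ p ∂μ := lintegral_const_mul'' _ (hX.pow_const p)
    _ ≤ (A * I) ^ (q / p - 1) * (B * I) := by gcongr
    _ = _ := by
        rw [ENNReal.mul_rpow_of_nonneg _ _ hk, hI]
        ring

end Convexity

/-- Layer cake representation of a power. -/
theorem lintegral_Ioi_rpow_of_lt {a : ℝ} (ha : 0 < a) {x : ℝ≥0∞} (hx : x ≠ ∞) :
    ∫⁻ l in Ioi (0 : ℝ), {l : ℝ | ENNReal.ofReal l < x}.indicator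
      (fun l => ENNReal.ofReal (l ^ (a - 1))) l = x ^ a / ENNReal.ofReal a := by
  lift x to ℝ≥0 using hx
  have h1 : ∀ l ∈ Ioi (0 : ℝ), {l : ℝ | ENNReal.ofReal l < x}.indicator
      (fun l => ENNReal.ofReal (l ^ (a - 1))) l =
      (Ioo 0 (x : ℝ)).indicator (fun l => ENNReal.ofReal (l ^ (a - 1))) l := by
    intro l hl
    have hiff : ENNReal.ofReal l < x ↔ l < x := by
      rw [ENNReal.ofReal, ENNReal.coe_lt_coe, Real.toNNReal_lt_iff_lt_coe (le_of_lt hl)]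
    by_cases h : l < x
    · have h1 : l ∈ {l : ℝ | ENNReal.ofReal l < x} := hiff.2 h
      have h2 : l ∈ Ioo 0 (x : ℝ) := ⟨hl, h⟩
      rw [indicator_of_mem h1, indicator_of_mem h2]
    · have h1 : l ∉ {l : ℝ | ENNReal.ofReal l < x} := fun h' => h (hiff.1 h')
      rw [indicator_of_notMem h1, indicator_of_notMem (fun h' => h h'.2)]
  rw [setLIntegral_congr_fun measurableSet_Ioi h1, lintegral_indicator measurableSet_Ioo,
    Measure.restrict_restrict measurableSet_Ioo, inter_eq_left.2 Ioo_subset_Ioi_self,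
    Measure.restrict_congr_set Ioo_ae_eq_Ioc]
  have hi := intervalIntegral.intervalIntegrable_rpow' (a := 0) (b := (x : ℝ))
    (by linarith : -1 < a - 1)
  rw [← ofReal_integral_eq_lintegral_ofReal hi.1
    ((ae_restrict_mem measurableSet_Ioc).mono fun l hl => Real.rpow_nonneg hl.1.le _),
    ← intervalIntegral.integral_of_le (NNReal.coe_nonneg x), integral_rpow (Or.inl (by linarith)),
    sub_add_cancel, Real.zero_rpow ha.ne', sub_zero, ENNReal.ofReal_div_of_pos ha,
    ← ENNReal.ofReal_rpow_of_nonneg (NNReal.coe_nonneg x) ha.le, ENNReal.ofReal_coe_nnreal]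

theorem lintegral_Ioi_rpow_of_lt_le {a : ℝ} (ha : 0 < a) (x : ℝ≥0∞) :
    ∫⁻ l in Ioi (0 : ℝ), {l : ℝ | ENNReal.ofReal l < x}.indicator
      (fun l => ENNReal.ofReal (l ^ (a - 1))) l ≤ x ^ a / ENNReal.ofReal a := by
  by_cases hx : x = ∞
  · rw [hx, ENNReal.top_rpow_of_pos ha, ENNReal.top_div_of_ne_top ENNReal.ofReal_ne_top]
    exact le_top
  · exact (lintegral_Ioi_rpow_of_lt ha hx).le

/-- The largest average of `F` over intervals of length `2 * r`, up to a factor `2`. -/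
def maxAverage (F : ℝ → ℝ≥0∞) (r : ℝ) : ℝ≥0∞ :=
  ENNReal.ofReal r⁻¹ * ⨆ a : ℝ, ∫⁻ s in Ioo (a - r) (a + r), F s

theorem measurable_maxAverage (F : ℝ → ℝ≥0∞) : Measurable (maxAverage F) := by
  refine (by fun_prop : Measurable fun r : ℝ => ENNReal.ofReal r⁻¹).mul (Monotone.measurable ?_)
  intro r r' h
  refine iSup_mono fun a => lintegral_mono_set (Ioo_subset_Ioo ?_ ?_) <;> linarith

variable {F : ℝ → ℝ≥0∞}

/-- Hölder on an interval of length 2r. -/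
theorem rpow_maxAverage_le (hF : Measurable F) {p : ℝ} (hp : 1 ≤ p) {r : ℝ} (hr : 0 < r) :
    maxAverage F r ^ p ≤ ENNReal.ofReal (2 ^ (p - 1) / r) * ∫⁻ s, F s ^ p := by
  have hp0 : 0 < p := by linarith
  have h1 : ∀ a : ℝ, (∫⁻ s in Ioo (a - r) (a + r), F s) ≤
      (ENNReal.ofReal (2 * r) ^ (p - 1) * ∫⁻ s, F s ^ p) ^ (1 / p) := by
    intro a
    rw [one_div, ENNReal.le_rpow_inv_iff hp0]
    refine (rpow_lintegral_le hp hF.aemeasurable).trans ?_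
    rw [Measure.restrict_apply_univ, Real.volume_Ioo, show a + r - (a - r) = 2 * r by ring]
    gcongr
    exact Measure.restrict_le_self
  have h2 : maxAverage F r ≤ ENNReal.ofReal r⁻¹ *
      (ENNReal.ofReal (2 * r) ^ (p - 1) * ∫⁻ s, F s ^ p) ^ (1 / p) := by
    unfold maxAverage
    gcongr
    exact iSup_le h1
  calc maxAverage F r ^ p ≤ _ := ENNReal.rpow_le_rpow h2 hp0.le
    _ = ENNReal.ofReal r⁻¹ ^ p * (ENNReal.ofReal (2 * r) ^ (p - 1)) * ∫⁻ s, F s ^ p := by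
      rw [ENNReal.mul_rpow_of_nonneg _ _ hp0.le, ← ENNReal.rpow_mul, one_div_mul_cancel hp0.ne',
        ENNReal.rpow_one, mul_assoc]
    _ = _ := by
      congr 1
      rw [ENNReal.ofReal_rpow_of_pos (by positivity), ENNReal.ofReal_rpow_of_pos (by positivity),
        ← ENNReal.ofReal_mul (by positivity), Real.mul_rpow (by norm_num) hr.le,
        Real.inv_rpow hr.le, Real.rpow_sub_one hr.ne']
      congr 1
      have := Real.rpow_pos_of_pos hr p
      field_simp

/-- The weak type estimate behind `lintegral_rpow_maxAverage_le`. -/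
theorem volume_lt_maxAverage_le {l : ℝ} (hl : 0 < l) :
    volume (Ioi 0 ∩ {r | ENNReal.ofReal l < maxAverage F r}) ≤
      ENNReal.ofReal (2 / l) * ∫⁻ s, {s | ENNReal.ofReal l < 4 * F s}.indicator F s := by
  set Φ := ∫⁻ s, {s | ENNReal.ofReal l < 4 * F s}.indicator F s with hΦ
  by_cases hfin : Φ = ∞
  · rw [hfin, ENNReal.mul_top (by simp [hl])]
    exact le_top
  have hsub : Ioi 0 ∩ {r | ENNReal.ofReal l < maxAverage F r} ⊆ Icc 0 (2 / l * Φ.toReal) := by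
    rintro r ⟨hr, hlr⟩
    have hr : 0 < r := hr
    refine ⟨hr.le, ?_⟩
    have hlr : ENNReal.ofReal l < maxAverage F r := hlr
    rw [maxAverage, ENNReal.mul_iSup, lt_iSup_iff] at hlr
    obtain ⟨a, ha⟩ := hlr
    -- Where 4F ≤ l the integrand is at most l/4, which contributes lr/2 over length 2r and is
    -- absorbed below by lr. The supremum runs over all centres, so the level set in r lies in one
    -- interval and no covering argument is needed.
    have h1 : ∫⁻ s in Ioo (a - r) (a + r), F s ≤ ENNReal.ofReal (l * r / 2) + Φ := by
      calc ∫⁻ s in Ioo (a - r) (a + r), F s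
          ≤ ∫⁻ s in Ioo (a - r) (a + r), (ENNReal.ofReal (l / 4) +
              {s | ENNReal.ofReal l < 4 * F s}.indicator F s) := by
            refine lintegral_mono fun s => ?_
            by_cases h : ENNReal.ofReal l < 4 * F s
            · simp [indicator, h]
            · refine le_add_right ?_
              rw [ENNReal.ofReal_div_of_pos (by norm_num), ENNReal.le_div_iff_mul_le (by simp)
                (by simp), mul_comm]
              simpa using h
        _ = ENNReal.ofReal (l / 4) * ENNReal.ofReal (2 * r) +
              ∫⁻ s in Ioo (a - r) (a + r), {s | ENNReal.ofReal l < 4 * F s}.indicator F s := by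
            rw [lintegral_add_left measurable_const, setLIntegral_const, Real.volume_Ioo,
              show a + r - (a - r) = 2 * r by ring]
        _ ≤ _ := by
            rw [← ENNReal.ofReal_mul (by positivity), show l / 4 * (2 * r) = l * r / 2 by ring]
            gcongr
            exact setLIntegral_le_lintegral _ _
    have h2 : ENNReal.ofReal (l * r) < ENNReal.ofReal (l * r / 2 + Φ.toReal) := by
      rw [ENNReal.ofReal_add (by positivity) ENNReal.toReal_nonneg, ENNReal.ofReal_toReal hfin]
      refine lt_of_lt_of_le ?_ h1
      calc ENNReal.ofReal (l * r) = ENNReal.ofReal r * ENNReal.ofReal l := by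
            rw [← ENNReal.ofReal_mul hr.le, mul_comm]
        _ < ENNReal.ofReal r * (ENNReal.ofReal r⁻¹ * ∫⁻ s in Ioo (a - r) (a + r), F s) :=
            ENNReal.mul_lt_mul_right (by simpa using hr) ENNReal.ofReal_ne_top ha
        _ = _ := by
            rw [← mul_assoc, ← ENNReal.ofReal_mul hr.le, mul_inv_cancel₀ hr.ne', ENNReal.ofReal_one,
              one_mul]
    have h3 := (ENNReal.ofReal_lt_ofReal_iff_of_nonneg (by positivity)).1 h2
    rw [div_mul_eq_mul_div, le_div_iff₀ hl]
    linarith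
  calc _ ≤ volume (Icc 0 (2 / l * Φ.toReal)) := measure_mono hsub
    _ = _ := by
      rw [Real.volume_Icc, sub_zero, ENNReal.ofReal_mul (by positivity), ENNReal.ofReal_toReal hfin]

/-- A Hardy type inequality for `maxAverage`. -/
theorem lintegral_rpow_maxAverage_le {p : ℝ} (hp : 1 < p) :
    ∃ C : ℝ≥0∞, C ≠ ∞ ∧ ∀ F : ℝ → ℝ≥0∞, Measurable F →
      ∫⁻ r in Ioi (0 : ℝ), maxAverage F r ^ p ≤ C * ∫⁻ s, F s ^ p := by
  have hp0 : 0 < p := by linarith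
  have hp1 : 0 < p - 1 := by linarith
  -- The summand 1 makes the constant nonzero, so that the case of infinite right-hand side is
  -- trivial.
  refine ⟨ENNReal.ofReal p * (2 * (4 ^ (p - 1) / ENNReal.ofReal (p - 1))) + 1, ?_,
    fun F hF => ?_⟩
  · refine ENNReal.add_ne_top.2 ⟨ENNReal.mul_ne_top ENNReal.ofReal_ne_top
      (ENNReal.mul_ne_top (by simp) (ENNReal.div_ne_top ?_ (by simpa using hp1))), by simp⟩
    exact ENNReal.rpow_ne_top_of_nonneg hp1.le (by simp)
  by_cases hN : ∫⁻ s, F s ^ p = ∞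
  · rw [hN, ENNReal.mul_top (by simp)]; exact le_top
  have hA := measurable_maxAverage F
  have hAfin : ∀ r ∈ Ioi (0 : ℝ), maxAverage F r ≠ ∞ := by
    intro r hr h
    have := rpow_maxAverage_le hF hp.le hr
    rw [h, ENNReal.top_rpow_of_pos hp0, top_le_iff] at this
    exact ENNReal.mul_ne_top ENNReal.ofReal_ne_top hN this
  have hpne : ENNReal.ofReal p ≠ 0 := by simpa using hp0
  have hset : MeasurableSet {q : ℝ × ℝ | ENNReal.ofReal q.2 < maxAverage F q.1} :=
    measurableSet_lt (by fun_prop) (hA.comp measurable_fst)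
  have hset2 : MeasurableSet {q : ℝ × ℝ | ENNReal.ofReal q.1 < 4 * F q.2} :=
    measurableSet_lt (by fun_prop) ((hF.comp measurable_snd).const_mul 4)
  have key : ∫⁻ r in Ioi (0 : ℝ), maxAverage F r ^ p / ENNReal.ofReal p ≤
      2 * (4 ^ (p - 1) / ENNReal.ofReal (p - 1)) * ∫⁻ s, F s ^ p := by
    -- As in Marcinkiewicz interpolation: layer cake, the weak type bound at each height l, then
    -- Tonelli. The remaining integral of l^(p-2) over l < 4F(s) converges because p > 1.
    calc ∫⁻ r in Ioi (0 : ℝ), maxAverage F r ^ p / ENNReal.ofReal p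
        = ∫⁻ r in Ioi (0 : ℝ), ∫⁻ l in Ioi (0 : ℝ),
            {l : ℝ | ENNReal.ofReal l < maxAverage F r}.indicator
              (fun l => ENNReal.ofReal (l ^ (p - 1))) l :=
          setLIntegral_congr_fun measurableSet_Ioi fun r hr =>
            (lintegral_Ioi_rpow_of_lt hp0 (hAfin r hr)).symm
      _ = ∫⁻ l in Ioi (0 : ℝ), ∫⁻ r in Ioi (0 : ℝ),
            {l : ℝ | ENNReal.ofReal l < maxAverage F r}.indicator
              (fun l => ENNReal.ofReal (l ^ (p - 1))) l := by
          refine lintegral_lintegral_swap ?_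
          exact ((by fun_prop : Measurable fun q : ℝ × ℝ =>
            ENNReal.ofReal (q.2 ^ (p - 1))).indicator hset).aemeasurable
      _ = ∫⁻ l in Ioi (0 : ℝ), ENNReal.ofReal (l ^ (p - 1)) *
            volume (Ioi 0 ∩ {r | ENNReal.ofReal l < maxAverage F r}) := by
          refine lintegral_congr fun l => ?_
          have hs : MeasurableSet {r | ENNReal.ofReal l < maxAverage F r} :=
            measurableSet_lt measurable_const hA
          rw [inter_comm, ← Measure.restrict_apply hs, ← lintegral_indicator_const hs]
          rfl
      _ ≤ ∫⁻ l in Ioi (0 : ℝ), 2 * (ENNReal.ofReal (l ^ (p - 1 - 1)) *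
            ∫⁻ s, {s | ENNReal.ofReal l < 4 * F s}.indicator F s) := by
          refine setLIntegral_mono' measurableSet_Ioi fun l hl => ?_
          have hl : 0 < l := hl
          grw [volume_lt_maxAverage_le hl]
          rw [← mul_assoc, ← mul_assoc, ← ENNReal.ofReal_mul (by positivity)]
          gcongr
          rw [show (2 : ℝ≥0∞) = ENNReal.ofReal 2 by simp, ← ENNReal.ofReal_mul (by norm_num)]
          rw [Real.rpow_sub_one hl.ne' (p - 1)]
          apply le_of_eq
          congr 1
          ring
      _ = 2 * ∫⁻ l in Ioi (0 : ℝ), ∫⁻ s, F s * {l : ℝ | ENNReal.ofReal l < 4 * F s}.indicator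
            (fun l => ENNReal.ofReal (l ^ (p - 1 - 1))) l := by
          rw [lintegral_const_mul' _ _ (by simp)]
          congr 1
          refine lintegral_congr fun l => ?_
          rw [← lintegral_const_mul' _ _ ENNReal.ofReal_ne_top]
          refine lintegral_congr fun s => ?_
          simp [indicator, mul_comm]
      _ = 2 * ∫⁻ s, ∫⁻ l in Ioi (0 : ℝ), F s * {l : ℝ | ENNReal.ofReal l < 4 * F s}.indicator
            (fun l => ENNReal.ofReal (l ^ (p - 1 - 1))) l := by
          congr 1
          refine lintegral_lintegral_swap ?_
          exact ((hF.comp measurable_snd).mul ((by fun_prop : Measurable fun q : ℝ × ℝ =>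
            ENNReal.ofReal (q.1 ^ (p - 1 - 1))).indicator hset2)).aemeasurable
      _ ≤ 2 * ∫⁻ s, 4 ^ (p - 1) / ENNReal.ofReal (p - 1) * F s ^ p := by
          gcongr with s
          have hm : Measurable fun l : ℝ => {l : ℝ | ENNReal.ofReal l < 4 * F s}.indicator
              (fun l => ENNReal.ofReal (l ^ (p - 1 - 1))) l :=
            (by fun_prop : Measurable fun l : ℝ => ENNReal.ofReal (l ^ (p - 1 - 1))).indicator
              (measurableSet_lt (by fun_prop) measurable_const)
          rw [lintegral_const_mul _ hm]
          grw [lintegral_Ioi_rpow_of_lt_le hp1]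
          rw [ENNReal.mul_rpow_of_nonneg _ _ hp1.le]
          have : F s ^ p = F s * F s ^ (p - 1) := by
            conv_rhs => rw [← ENNReal.rpow_one (F s), ← ENNReal.rpow_mul,
              ← ENNReal.rpow_add_of_nonneg _ _ zero_le_one (by linarith)]
            congr 1; ring
          rw [this, div_eq_mul_inv, div_eq_mul_inv]
          apply le_of_eq
          ring
      _ = _ := by
          rw [lintegral_const_mul _ (hF.pow_const p), mul_assoc]
  calc ∫⁻ r in Ioi (0 : ℝ), maxAverage F r ^ p
      = ENNReal.ofReal p * ∫⁻ r in Ioi (0 : ℝ), maxAverage F r ^ p / ENNReal.ofReal p := by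
        rw [← lintegral_const_mul' _ _ ENNReal.ofReal_ne_top]
        refine lintegral_congr fun r => ?_
        rw [ENNReal.mul_div_cancel hpne ENNReal.ofReal_ne_top]
    _ ≤ ENNReal.ofReal p * (2 * (4 ^ (p - 1) / ENNReal.ofReal (p - 1)) * ∫⁻ s, F s ^ p) := by
        gcongr
    _ ≤ _ := by
        rw [← mul_assoc]
        gcongr
        exact le_self_add

end

/-! ### Large |x| and small |x|. -/

noncomputable section

open Filter Topology

/-- The `p`-th power of the `L^p` norm of a radial function, up to a constant. -/
def radialEnergy (d : ℕ) (p : ℝ) (F : ℝ → ℝ≥0∞) : ℝ≥0∞ :=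
  ∫⁻ s in Ioi (0 : ℝ), ENNReal.ofReal (s ^ (d - 1)) * F s ^ p

variable {d : ℕ} {p q : ℝ}

theorem setLIntegral_rpow_le_radialEnergy (F : ℝ → ℝ≥0∞) {a : ℝ} (ha : 0 < a) {S : Set ℝ}
    (hS : MeasurableSet S) (hSa : S ⊆ Ici a) :
    ∫⁻ s in S, F s ^ p ≤ ENNReal.ofReal (a⁻¹ ^ (d - 1)) * radialEnergy d p F := by
  have hsub : S ⊆ Ioi 0 := fun s hs => lt_of_lt_of_le ha (hSa hs)
  calc ∫⁻ s in S, F s ^ p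
      ≤ ∫⁻ s in S, ENNReal.ofReal (a⁻¹ ^ (d - 1)) * (ENNReal.ofReal (s ^ (d - 1)) * F s ^ p) := by
        refine setLIntegral_mono' hS fun s hs => ?_
        rw [← mul_assoc, ← ENNReal.ofReal_mul (by positivity), ← mul_pow]
        refine le_mul_of_one_le_left zero_le ?_
        rw [ENNReal.one_le_ofReal]
        refine one_le_pow₀ ?_
        rw [inv_mul_eq_div, one_le_div ha]
        exact hSa hs
    _ = ENNReal.ofReal (a⁻¹ ^ (d - 1)) * ∫⁻ s in S, ENNReal.ofReal (s ^ (d - 1)) * F s ^ p :=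
        lintegral_const_mul' _ _ ENNReal.ofReal_ne_top
    _ ≤ _ := by
        rw [radialEnergy]
        gcongr

theorem rpow_setLIntegral_le_radialEnergy {F : ℝ → ℝ≥0∞} (hF : Measurable F) (hp : 1 ≤ p)
    {a : ℝ} (ha : 0 < a) {S : Set ℝ} (hS : MeasurableSet S) (hSa : S ⊆ Ici a) :
    (∫⁻ s in S, F s) ^ p ≤
      volume S ^ (p - 1) * (ENNReal.ofReal (a⁻¹ ^ (d - 1)) * radialEnergy d p F) := by
  refine (rpow_lintegral_le hp hF.aemeasurable).trans ?_
  rw [Measure.restrict_apply_univ]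
  gcongr
  exact setLIntegral_rpow_le_radialEnergy F ha hS hSa

/-- The contribution of large `|x|`. -/
theorem exists_far_estimate (d : ℕ) (hp : 1 ≤ p) (hpq : p ≤ q) :
    ∃ C : ℝ≥0∞, C ≠ ∞ ∧ ∀ F : ℝ → ℝ≥0∞, Measurable F →
      ∫⁻ r in Ici (3 : ℝ), ENNReal.ofReal (r ^ (d - 1)) *
        (∫⁻ s in Ioo (r - 2) (r + 2), F s) ^ q ≤ C * radialEnergy d p F ^ (q / p) := by
  have hp0 : 0 < p := by linarith
  have hk : 0 ≤ q / p - 1 := by rw [sub_nonneg, le_div_iff₀ hp0]; linarith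
  set A : ℝ≥0∞ := ENNReal.ofReal 4 ^ (p - 1) with hA
  have hAfin : A ≠ ∞ := ENNReal.rpow_ne_top_of_nonneg (by linarith) ENNReal.ofReal_ne_top
  set B : ℝ≥0∞ := A * (ENNReal.ofReal (3 ^ (d - 1)) * ENNReal.ofReal 4) with hB
  refine ⟨A ^ (q / p - 1) * B, ENNReal.mul_ne_top (ENNReal.rpow_ne_top_of_nonneg hk hAfin)
    (ENNReal.mul_ne_top hAfin (ENNReal.mul_ne_top ENNReal.ofReal_ne_top ENNReal.ofReal_ne_top)),
    fun F hF => ?_⟩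
  set w : ℝ → ℝ≥0∞ := fun r => ENNReal.ofReal (r ^ (d - 1)) with hw
  have hwm : Measurable w := by rw [hw]; fun_prop
  set μ : Measure ℝ := (volume.restrict (Ici (3 : ℝ))).withDensity w with hμ
  set X : ℝ → ℝ≥0∞ := fun r => ∫⁻ s in Ioo (r - 2) (r + 2), F s with hX
  have hset : MeasurableSet {z : ℝ × ℝ | z.2 ∈ Ioo (z.1 - 2) (z.1 + 2)} :=
    (measurableSet_lt (f := fun z : ℝ × ℝ => z.1 - 2) (g := fun z => z.2)
      (by fun_prop) (by fun_prop)).inter (measurableSet_lt (f := fun z : ℝ × ℝ => z.2)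
      (g := fun z => z.1 + 2) (by fun_prop) (by fun_prop))
  have hX' : X = fun r => ∫⁻ s, {z : ℝ × ℝ | z.2 ∈ Ioo (z.1 - 2) (z.1 + 2)}.indicator
      (fun z => F z.2) (r, s) := by
    ext r
    rw [hX]
    exact (lintegral_indicator measurableSet_Ioo F).symm
  have hXm : Measurable X := by
    rw [hX']
    exact ((hF.comp measurable_snd).indicator hset).lintegral_prod_right'
  have hvol : ∀ r : ℝ, volume (Ioo (r - 2) (r + 2)) = ENNReal.ofReal 4 := fun r => by
    rw [Real.volume_Ioo]; congr 1; ring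
  have hXp : ∀ r, X r ^ p ≤ A * ∫⁻ s in Ioo (r - 2) (r + 2), F s ^ p := by
    intro r
    refine (rpow_lintegral_le hp hF.aemeasurable).trans ?_
    rw [Measure.restrict_apply_univ, hvol]
  have h1 : ∀ᵐ r ∂μ, X r ^ p ≤ A * radialEnergy d p F := by
    refine (withDensity_absolutelyContinuous _ _).ae_le ?_
    filter_upwards [ae_restrict_mem measurableSet_Ici] with r hr
    refine (hXp r).trans ?_
    gcongr
    refine (setLIntegral_rpow_le_radialEnergy F one_pos measurableSet_Ioo ?_).trans
      (by simp : ENNReal.ofReal (1⁻¹ ^ (d - 1)) * radialEnergy d p F ≤ _)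
    intro s hs
    have : (3 : ℝ) ≤ r := hr
    exact (by linarith [hs.1] : (1 : ℝ) ≤ s)
  have h2 : ∫⁻ r, X r ^ p ∂μ ≤ B * radialEnergy d p F := by
    rw [hμ, lintegral_withDensity_eq_lintegral_mul _ hwm (hXm.pow_const p)]
    calc ∫⁻ r in Ici (3 : ℝ), (w * fun r => X r ^ p) r
        ≤ ∫⁻ r in Ici (3 : ℝ), A * ∫⁻ s, {z : ℝ × ℝ | z.2 ∈ Ioo (z.1 - 2) (z.1 + 2)}.indicator
            (fun z => (Ioi (0 : ℝ)).indicator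
              (fun s => ENNReal.ofReal (3 ^ (d - 1)) * (w s * F s ^ p)) z.2) (r, s) := by
          refine setLIntegral_mono' measurableSet_Ici fun r hr => ?_
          have hr : (3 : ℝ) ≤ r := hr
          simp only [Pi.mul_apply]
          grw [hXp r]
          rw [mul_left_comm]
          gcongr
          rw [← lintegral_const_mul' _ _ ENNReal.ofReal_ne_top,
            ← lintegral_indicator measurableSet_Ioo]
          refine lintegral_mono fun s => ?_
          by_cases hs : s ∈ Ioo (r - 2) (r + 2)
          -- Here s > r - 2 ≥ 1 gives r < s + 2 < 3s, so the weights at r and s are comparable.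
          · have hs0 : 1 < s := by linarith [hs.1]
            have hs' : ((r, s) : ℝ × ℝ) ∈ {z : ℝ × ℝ | z.2 ∈ Ioo (z.1 - 2) (z.1 + 2)} := hs
            have hs1 : s ∈ Ioi (0 : ℝ) := by simp; linarith
            rw [indicator_of_mem hs, indicator_of_mem hs', indicator_of_mem hs1, ← mul_assoc,
              hw, ← ENNReal.ofReal_mul (by positivity), ← mul_pow]
            gcongr
            linarith [hs.2, hs.1]
          · rw [indicator_of_notMem hs]; exact zero_le
      _ ≤ ∫⁻ r, A * ∫⁻ s, {z : ℝ × ℝ | z.2 ∈ Ioo (z.1 - 2) (z.1 + 2)}.indicator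
            (fun z => (Ioi (0 : ℝ)).indicator
              (fun s => ENNReal.ofReal (3 ^ (d - 1)) * (w s * F s ^ p)) z.2) (r, s) :=
          setLIntegral_le_lintegral _ _
      _ = A * ∫⁻ s, ∫⁻ r, {z : ℝ × ℝ | z.2 ∈ Ioo (z.1 - 2) (z.1 + 2)}.indicator
            (fun z => (Ioi (0 : ℝ)).indicator
              (fun s => ENNReal.ofReal (3 ^ (d - 1)) * (w s * F s ^ p)) z.2) (r, s) := by
          rw [lintegral_const_mul' _ _ hAfin]
          congr 1
          refine lintegral_lintegral_swap (f := fun r s =>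
            {z : ℝ × ℝ | z.2 ∈ Ioo (z.1 - 2) (z.1 + 2)}.indicator
            (fun z => (Ioi (0 : ℝ)).indicator
              (fun s => ENNReal.ofReal (3 ^ (d - 1)) * (w s * F s ^ p)) z.2) (r, s)) ?_
          refine Measurable.aemeasurable (Measurable.indicator ?_ hset)
          exact ((((hwm.mul (hF.pow_const p)).const_mul _).indicator measurableSet_Ioi).comp
            measurable_snd)
      _ = A * ∫⁻ s, (Ioi (0 : ℝ)).indicator
              (fun s => ENNReal.ofReal (3 ^ (d - 1)) * (w s * F s ^ p)) s * ENNReal.ofReal 4 := by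
          congr 1
          refine lintegral_congr fun s => ?_
          rw [← hvol s, ← lintegral_indicator_const measurableSet_Ioo]
          refine lintegral_congr fun r => ?_
          have hiff : s ∈ Ioo (r - 2) (r + 2) ↔ r ∈ Ioo (s - 2) (s + 2) := by
            simp only [mem_Ioo]; constructor <;> rintro ⟨h1, h2⟩ <;> constructor <;> linarith
          by_cases h : s ∈ Ioo (r - 2) (r + 2)
          · have hs' : ((r, s) : ℝ × ℝ) ∈ {z : ℝ × ℝ | z.2 ∈ Ioo (z.1 - 2) (z.1 + 2)} := h
            rw [indicator_of_mem hs', indicator_of_mem (hiff.1 h)]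
          · have hs' : ((r, s) : ℝ × ℝ) ∉ {z : ℝ × ℝ | z.2 ∈ Ioo (z.1 - 2) (z.1 + 2)} := h
            rw [indicator_of_notMem hs', indicator_of_notMem (fun h' => h (hiff.2 h'))]
      _ = B * radialEnergy d p F := by
          rw [lintegral_mul_const' _ _ ENNReal.ofReal_ne_top,
            lintegral_indicator measurableSet_Ioi,
            lintegral_const_mul' _ _ ENNReal.ofReal_ne_top, hB, radialEnergy]
          ring
  have h3 := lintegral_rpow_le_mul_rpow hp0 hpq hXm.aemeasurable h1 h2
  rw [hμ, lintegral_withDensity_eq_lintegral_mul _ hwm (hXm.pow_const q)] at h3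
  exact h3

/-- The contribution of small `|x|`. -/
theorem exists_near_estimate (hd : 2 ≤ d) (hp : 1 ≤ p) (hpq : p ≤ q) (hq : q ≤ d * p)
    (h1 : 1 < p ∨ q = 1) :
    ∃ C : ℝ≥0∞, C ≠ ∞ ∧ ∀ F : ℝ → ℝ≥0∞, Measurable F →
      ∫⁻ r in Ioo (0 : ℝ) (1 / 2), ENNReal.ofReal (r ^ (d - 1)) *
        maxAverage ((Ioo (1 / 2) (5 / 2)).indicator F) r ^ q ≤
        C * radialEnergy d p F ^ (q / p) := by
  have hp0 : 0 < p := by linarith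
  have hk : 0 ≤ q / p - 1 := by rw [sub_nonneg, le_div_iff₀ hp0]; linarith
  set D : ℝ≥0∞ := ENNReal.ofReal ((1 / 2 : ℝ)⁻¹ ^ (d - 1)) with hD
  have hE : ∀ F : ℝ → ℝ≥0∞, ∫⁻ s, (Ioo (1 / 2) (5 / 2)).indicator F s ^ p ≤
      D * radialEnergy d p F := by
    intro F
    refine le_trans (le_of_eq ?_) (setLIntegral_rpow_le_radialEnergy F (S := Ioo (1 / 2) (5 / 2))
      (by norm_num : (0 : ℝ) < 1 / 2) measurableSet_Ioo (fun s hs => hs.1.le))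
    rw [← lintegral_indicator measurableSet_Ioo]
    refine lintegral_congr fun s => ?_
    by_cases hs : s ∈ Ioo (1 / 2 : ℝ) (5 / 2)
    · rw [indicator_of_mem hs, indicator_of_mem hs]
    · rw [indicator_of_notMem hs, indicator_of_notMem hs, ENNReal.zero_rpow_of_pos hp0]
  rcases h1 with h1 | h1
  · obtain ⟨C, hC, hmain⟩ := lintegral_rpow_maxAverage_le h1
    set A : ℝ≥0∞ := ENNReal.ofReal (2 ^ (p - 1)) * D with hA
    have hAfin : A ≠ ∞ := ENNReal.mul_ne_top ENNReal.ofReal_ne_top ENNReal.ofReal_ne_top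
    refine ⟨A ^ (q / p - 1) * (C * D), ENNReal.mul_ne_top
      (ENNReal.rpow_ne_top_of_nonneg hk hAfin) (ENNReal.mul_ne_top hC ENNReal.ofReal_ne_top),
      fun F hF => ?_⟩
    have hFm : Measurable ((Ioo (1 / 2 : ℝ) (5 / 2)).indicator F) := hF.indicator measurableSet_Ioo
    set X := maxAverage ((Ioo (1 / 2 : ℝ) (5 / 2)).indicator F) with hX
    set I := radialEnergy d p F with hI
    have hXm : Measurable X := measurable_maxAverage _
    calc ∫⁻ r in Ioo (0 : ℝ) (1 / 2), ENNReal.ofReal (r ^ (d - 1)) * X r ^ q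
        ≤ ∫⁻ r in Ioo (0 : ℝ) (1 / 2), (A * I) ^ (q / p - 1) * X r ^ p := by
          refine setLIntegral_mono' measurableSet_Ioo fun r hr => ?_
          have hr0 : 0 < r := hr.1
          have e1 : X r ^ q = (X r ^ p) ^ (q / p - 1) * X r ^ p := by
            rw [← ENNReal.rpow_mul, ← ENNReal.rpow_add_of_nonneg _ _ (by positivity) hp0.le]
            congr 1
            field_simp
            ring
          -- Here q ≤ dp enters: since r < 1, the weight absorbs the factor r^(-(q/p-1)) lost in
          -- bounding X^(q-p) pointwise.
          have e2 : ENNReal.ofReal (r ^ (d - 1)) ≤ ENNReal.ofReal r ^ (q / p - 1) := by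
            rw [ENNReal.ofReal_rpow_of_pos hr0, ← Real.rpow_natCast]
            refine ENNReal.ofReal_le_ofReal ?_
            refine Real.rpow_le_rpow_of_exponent_ge hr0 (by linarith [hr.2]) ?_
            rw [Nat.cast_sub (by omega)]
            have : q / p ≤ d := by rwa [div_le_iff₀ hp0]
            push_cast
            linarith
          rw [e1, ← mul_assoc]
          gcongr
          grw [e2]
          rw [← ENNReal.mul_rpow_of_nonneg _ _ hk]
          refine ENNReal.rpow_le_rpow ?_ hk
          grw [rpow_maxAverage_le hFm hp hr0, hE F]
          rw [hA, ← mul_assoc, ← mul_assoc, ← ENNReal.ofReal_mul hr0.le,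
            mul_div_cancel₀ _ hr0.ne']
      _ = (A * I) ^ (q / p - 1) * ∫⁻ r in Ioo (0 : ℝ) (1 / 2), X r ^ p :=
          lintegral_const_mul _ (hXm.pow_const p)
      _ ≤ (A * I) ^ (q / p - 1) * ((C * D) * I) := by
          gcongr
          calc ∫⁻ r in Ioo (0 : ℝ) (1 / 2), X r ^ p ≤ ∫⁻ r in Ioi (0 : ℝ), X r ^ p :=
                lintegral_mono_set Ioo_subset_Ioi_self
            _ ≤ C * (D * I) := (hmain _ hFm).trans (by gcongr; exact hE F)
            _ = _ := (mul_assoc _ _ _).symm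
      _ = _ := by
          have hII : I ^ (q / p) = I ^ (q / p - 1) * I := by
            conv_rhs => rw [← ENNReal.rpow_one I, ← ENNReal.rpow_mul,
              ← ENNReal.rpow_add_of_nonneg _ _ (by simpa using hk) zero_le_one]
            congr 1
            ring
          rw [ENNReal.mul_rpow_of_nonneg _ _ hk, hII]
          ring
  -- For p = q = 1 the Hardy inequality is not available, but the weight r^(d-1) already cancels the
  -- factor 1/r of `rpow_maxAverage_le`.
  · have hp1 : p = 1 := by linarith
    subst h1 hp1
    refine ⟨D * volume (Ioo (0 : ℝ) (1 / 2)), ENNReal.mul_ne_top ENNReal.ofReal_ne_top (by simp),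
      fun F hF => ?_⟩
    have hFm : Measurable ((Ioo (1 / 2 : ℝ) (5 / 2)).indicator F) := hF.indicator measurableSet_Ioo
    calc _ ≤ ∫⁻ r in Ioo (0 : ℝ) (1 / 2), D * radialEnergy d 1 F := by
          refine setLIntegral_mono' measurableSet_Ioo fun r hr => ?_
          have hr0 : 0 < r := hr.1
          grw [rpow_maxAverage_le hFm le_rfl hr0, hE F]
          rw [← mul_assoc, ← ENNReal.ofReal_mul (by positivity)]
          refine mul_le_of_le_one_left zero_le ?_
          rw [ENNReal.ofReal_le_one]
          have : d - 1 = (d - 2) + 1 := by omega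
          rw [this, pow_succ]
          have h3 : r ^ (d - 2) ≤ 1 := pow_le_one₀ hr0.le (by linarith [hr.2])
          simp only [sub_self, Real.rpow_zero]
          field_simp
          exact h3
      _ = _ := by
          rw [setLIntegral_const, div_one, ENNReal.rpow_one]
          ring

end

/-! ### The Hardy inequality governed by the distance to E. -/

noncomputable section

open Filter Topology

variable {d : ℕ} {p q : ℝ}

/-- Discrete convolution with a geometric sequence maps `ℓ^p` to `ℓ^q`. -/
theorem exists_geometric_convolution_le (hp : 1 ≤ p) (hpq : p ≤ q) {θ : ℝ≥0∞} (hθ : θ < 1) :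
    ∃ C : ℝ≥0∞, C ≠ ∞ ∧ ∀ a : ℕ → ℝ≥0∞,
      ∑' k, (∑ j ∈ Finset.range (k + 1), θ ^ (k - j) * a j) ^ q ≤ C * (∑' j, a j ^ p) ^ (q / p) := by
  have hp0 : 0 < p := by linarith
  have hk : 0 ≤ q / p - 1 := by rw [sub_nonneg, le_div_iff₀ hp0]; linarith
  set W : ℝ≥0∞ := ∑' k, θ ^ k with hW
  have hWfin : W ≠ ∞ := by
    rw [hW, ENNReal.tsum_geometric, ENNReal.inv_ne_top]
    exact (tsub_pos_of_lt hθ).ne'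
  set A : ℝ≥0∞ := W ^ (p - 1) with hA
  have hAfin : A ≠ ∞ := ENNReal.rpow_ne_top_of_nonneg (by linarith) hWfin
  refine ⟨A ^ (q / p - 1) * (A * W), ENNReal.mul_ne_top (ENNReal.rpow_ne_top_of_nonneg hk hAfin)
    (ENNReal.mul_ne_top hAfin hWfin), fun a => ?_⟩
  set X : ℕ → ℝ≥0∞ := fun k => ∑ j ∈ Finset.range (k + 1), θ ^ (k - j) * a j with hX
  have hXp : ∀ k, X k ^ p ≤ A * ∑ j ∈ Finset.range (k + 1), θ ^ (k - j) * a j ^ p := by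
    intro k
    -- Jensen is applied to the atomic measure with weights θ^(k-j), whose mass is at most the full
    -- geometric sum W.
    set ν : Measure ℕ := ∑ j ∈ Finset.range (k + 1), θ ^ (k - j) • Measure.dirac j with hν
    have h := rpow_lintegral_le (μ := ν) hp (X := a) (measurable_from_nat).aemeasurable
    simp only [hν, lintegral_finsetSum_measure, lintegral_smul_measure, lintegral_dirac,
      smul_eq_mul] at h
    refine h.trans ?_
    gcongr
    rw [hA]
    refine ENNReal.rpow_le_rpow ?_ (by linarith)
    rw [Measure.finsetSum_apply]
    simp only [Measure.smul_apply, measure_univ, smul_eq_mul, mul_one]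
    refine le_trans (le_of_eq ?_) (ENNReal.sum_le_tsum (Finset.range (k + 1)))
    rw [← Finset.sum_range_reflect (fun j => θ ^ j) (k + 1)]
    simp
  have h1 : ∀ᵐ k ∂(Measure.count : Measure ℕ), X k ^ p ≤ A * ∑' j, a j ^ p := by
    refine Eventually.of_forall fun k => (hXp k).trans ?_
    gcongr
    refine le_trans (Finset.sum_le_sum fun j _ => ?_) (ENNReal.sum_le_tsum (Finset.range (k + 1)))
    exact mul_le_of_le_one_left zero_le (pow_le_one₀ zero_le hθ.le)
  have h2 : ∫⁻ k, X k ^ p ∂(Measure.count : Measure ℕ) ≤ A * W * ∑' j, a j ^ p := by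
    rw [lintegral_count]
    calc ∑' k, X k ^ p ≤ ∑' k, A * ∑' j, (if j ≤ k then θ ^ (k - j) else 0) * a j ^ p := by
          refine ENNReal.tsum_le_tsum fun k => (hXp k).trans ?_
          gcongr
          refine le_trans (le_of_eq (Finset.sum_congr rfl fun j hj => ?_))
            (ENNReal.sum_le_tsum (Finset.range (k + 1)))
          rw [if_pos (Nat.lt_succ_iff.1 (Finset.mem_range.1 hj))]
      _ = A * ∑' j, ∑' k, (if j ≤ k then θ ^ (k - j) else 0) * a j ^ p := by
          rw [ENNReal.tsum_mul_left, ENNReal.tsum_comm]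
      _ = A * ∑' j, W * a j ^ p := by
          congr 1
          refine tsum_congr fun j => ?_
          rw [ENNReal.tsum_mul_right]
          congr 1
          rw [← ENNReal.summable.sum_add_tsum_nat_add' (k := j) (f := fun k =>
            if j ≤ k then θ ^ (k - j) else 0)]
          rw [Finset.sum_eq_zero (fun k hk => if_neg (by simpa using hk)), zero_add]
          simp [hW]
      _ = _ := by rw [ENNReal.tsum_mul_left, mul_assoc]
  have h3 := lintegral_rpow_le_mul_rpow hp0 hpq (measurable_from_nat).aemeasurable h1 h2
  rwa [lintegral_count] at h3

/-- The truncated integral which controls the spherical means near the diagonal `|x| = t`. -/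
def tailIntegral (d : ℕ) (F : ℝ → ℝ≥0∞) (δ : ℝ) : ℝ≥0∞ :=
  ∫⁻ s in Ioc δ 1, F s * ENNReal.ofReal (s ^ (d - 2))

theorem measurable_tailIntegral (d : ℕ) (F : ℝ → ℝ≥0∞) : Measurable (tailIntegral d F) :=
  Antitone.measurable fun _ _ h => lintegral_mono_set (Ioc_subset_Ioc_left h)

theorem tailIntegral_le_sum {ρ : ℕ → ℝ} (h0 : ρ 0 = 1) (F : ℝ → ℝ≥0∞) (k : ℕ) :
    tailIntegral d F (ρ k) ≤ ∑ j ∈ Finset.range k,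
      ∫⁻ s in Ioc (ρ (j + 1)) (ρ j), F s * ENNReal.ofReal (s ^ (d - 2)) := by
  induction k with
  | zero => simp [tailIntegral, h0]
  | succ k ih =>
    rw [Finset.sum_range_succ]
    calc _ ≤ ∫⁻ s in Ioc (ρ (k + 1)) (ρ k) ∪ Ioc (ρ k) 1, F s * ENNReal.ofReal (s ^ (d - 2)) :=
          lintegral_mono_set Ioc_subset_Ioc_union_Ioc
      _ ≤ _ := (lintegral_union_le _ _ _).trans (by rw [add_comm]; gcongr; exact ih)

/-- A Hardy inequality adapted to the distance to a set `E` of small dimension. -/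
theorem exists_hardy_estimate (hp : 1 ≤ p) (hpq : p ≤ q) {E : Set ℝ} (hne : E.Nonempty)
    (hE0 : volume (closure E) = 0) {ρ : ℕ → ℝ} (h0 : ρ 0 = 1) (hanti : Antitone ρ)
    (hpos : ∀ k, 0 < ρ k) (hlim : Tendsto ρ atTop (𝓝 0)) {L D B : ℝ≥0∞} (hL : 1 < L) (hLt : L ≠ ∞)
    (hD : D ≠ ∞) (hB : B ≠ ∞)
    (H1 : ∀ k, ∀ F : ℝ → ℝ≥0∞, Measurable F →
      (∫⁻ s in Ioc (ρ (k + 1)) (ρ k), F s * ENNReal.ofReal (s ^ (d - 2))) ^ p ≤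
        D * (L ^ k) ^ p * ∫⁻ s in Ioc (ρ (k + 1)) (ρ k), ENNReal.ofReal (s ^ (d - 1)) * F s ^ p)
    (H2 : ∀ k, volume (Ico (1 / 2) 3 ∩ {r | Metric.infDist r E ≤ ρ k}) * (L ^ k) ^ q ≤ B) :
    ∃ C : ℝ≥0∞, C ≠ ∞ ∧ ∀ F : ℝ → ℝ≥0∞, Measurable F →
      ∫⁻ r in Ico (1 / 2 : ℝ) 3, tailIntegral d F (Metric.infDist r E) ^ q ≤
        C * radialEnergy d p F ^ (q / p) := by
  have hp0 : 0 < p := by linarith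
  have hq0 : 0 < q := by linarith
  have hL0 : L ≠ 0 := (zero_lt_one.trans hL).ne'
  obtain ⟨C, hC, hconv⟩ := exists_geometric_convolution_le hp hpq (ENNReal.inv_lt_one.2 hL)
  refine ⟨B * D ^ (q / p) * C, ENNReal.mul_ne_top (ENNReal.mul_ne_top hB
    (ENNReal.rpow_ne_top_of_nonneg (by positivity) hD)) hC, fun F hF => ?_⟩
  set e : ℕ → ℝ≥0∞ := fun j =>
    ∫⁻ s in Ioc (ρ (j + 1)) (ρ j), ENNReal.ofReal (s ^ (d - 1)) * F s ^ p with he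
  set a : ℕ → ℝ≥0∞ := fun j => e j ^ (1 / p) with ha
  set b : ℕ → ℝ≥0∞ := fun k => ∑ j ∈ Finset.range (k + 1),
    ∫⁻ s in Ioc (ρ (j + 1)) (ρ j), F s * ENNReal.ofReal (s ^ (d - 2)) with hb
  have hap : ∀ j, a j ^ p = e j := fun j => by
    rw [ha, ← ENNReal.rpow_mul, one_div_mul_cancel hp0.ne', ENNReal.rpow_one]
  have hsum : ∑' j, a j ^ p ≤ radialEnergy d p F := by
    simp_rw [hap]
    refine le_trans (le_of_eq (lintegral_iUnion (fun j => measurableSet_Ioc)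
      hanti.pairwise_disjoint_on_Ioc_succ _).symm) ?_
    exact lintegral_mono_set (iUnion_subset fun j s hs => (hpos _).trans hs.1)
  -- Relative to the last shell the earlier ones decay geometrically. Pulling out L^k leaves a
  -- convolution with ratio L⁻¹, and L^(kq) is what the measure bound `H2` pays for.
  have hbk : ∀ k, b k ≤ D ^ (1 / p) * L ^ k *
      ∑ j ∈ Finset.range (k + 1), L⁻¹ ^ (k - j) * a j := by
    intro k
    rw [Finset.mul_sum]
    refine Finset.sum_le_sum fun j hj => ?_
    have hjk : j ≤ k := Nat.lt_succ_iff.1 (Finset.mem_range.1 hj)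
    have h3 : ∫⁻ s in Ioc (ρ (j + 1)) (ρ j), F s * ENNReal.ofReal (s ^ (d - 2)) ≤
        D ^ (1 / p) * L ^ j * a j := by
      rw [← ENNReal.rpow_le_rpow_iff hp0]
      refine (H1 j F hF).trans (le_of_eq ?_)
      rw [ENNReal.mul_rpow_of_nonneg _ _ hp0.le, ENNReal.mul_rpow_of_nonneg _ _ hp0.le, hap,
        ← ENNReal.rpow_mul, one_div_mul_cancel hp0.ne', ENNReal.rpow_one]
    refine h3.trans (le_of_eq ?_)
    have h4 : L ^ k * L⁻¹ ^ (k - j) = L ^ j := by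
      obtain ⟨i, rfl⟩ := Nat.exists_eq_add_of_le hjk
      rw [Nat.add_sub_cancel_left, pow_add, mul_assoc, ← mul_pow, ENNReal.mul_inv_cancel hL0 hLt,
        one_pow, mul_one]
    rw [← h4]
    ring
  set S : ℕ → Set ℝ := fun k => Ico (1 / 2) 3 ∩ {r | Metric.infDist r E ≤ ρ k} with hS
  have hSm : ∀ k, MeasurableSet {r : ℝ | Metric.infDist r E ≤ ρ k} := fun k =>
    measurableSet_le (Metric.continuous_infDist_pt E).measurable measurable_const
  calc ∫⁻ r in Ico (1 / 2 : ℝ) 3, tailIntegral d F (Metric.infDist r E) ^ q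
      ≤ ∫⁻ r in Ico (1 / 2 : ℝ) 3,
          -- Sublevel sets of the distance may replace its level sets: the sum only becomes larger,
          -- and `H2` controls exactly their measures.
          ∑' k, {r | Metric.infDist r E ≤ ρ k}.indicator (fun _ => b k ^ q) r := by
        refine lintegral_mono_ae ?_
        filter_upwards [ae_restrict_of_ae (measure_eq_zero_iff_ae_notMem.1 hE0)] with r hr
        have hδ : 0 < Metric.infDist r E := by
          refine lt_of_le_of_ne Metric.infDist_nonneg fun h => hr ?_
          exact (Metric.mem_closure_iff_infDist_zero hne).2 h.symm
        set δ := Metric.infDist r E with hδdef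
        by_cases hδ1 : 1 < δ
        · rw [tailIntegral, Ioc_eq_empty (by simpa using hδ1.le)]
          simp [ENNReal.zero_rpow_of_pos hq0]
        -- The first index with ρ n < δ is not 0 because δ ≤ 1 = ρ 0. Its predecessor k satisfies ρ
        -- (k+1) < δ ≤ ρ k.
        · have hex : ∃ n, ρ n < δ := ((hlim.eventually_lt_const hδ)).exists
          classical
          have hn := Nat.find_spec hex
          have hmin : ∀ m < Nat.find hex, ¬ ρ m < δ := fun m hm => Nat.find_min hex hm
          obtain ⟨k, hk⟩ : ∃ k, Nat.find hex = k + 1 := by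
            refine Nat.exists_eq_succ_of_ne_zero fun h => ?_
            rw [h, h0] at hn
            exact hδ1 hn
          rw [hk] at hn
          have hk' : δ ≤ ρ k := not_lt.1 (hmin k (by omega))
          refine le_trans ?_ (ENNReal.le_tsum k)
          have hmem : r ∈ {r | Metric.infDist r E ≤ ρ k} := hk'
          rw [indicator_of_mem hmem]
          gcongr
          exact (lintegral_mono_set (Ioc_subset_Ioc_left hn.le)).trans
            (tailIntegral_le_sum h0 F (k + 1))
    _ = ∑' k, b k ^ q * volume (S k) := by
        rw [lintegral_tsum fun k => (measurable_const.indicator (hSm k)).aemeasurable]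
        refine tsum_congr fun k => ?_
        rw [lintegral_indicator_const (hSm k), Measure.restrict_apply (hSm k), inter_comm]
    _ ≤ ∑' k, B * D ^ (q / p) * (∑ j ∈ Finset.range (k + 1), L⁻¹ ^ (k - j) * a j) ^ q := by
        refine ENNReal.tsum_le_tsum fun k => ?_
        grw [hbk k]
        rw [ENNReal.mul_rpow_of_nonneg _ _ hq0.le, ENNReal.mul_rpow_of_nonneg _ _ hq0.le,
          ← ENNReal.rpow_mul, one_div_mul_eq_div]
        grw [← H2 k]
        apply le_of_eq
        ring
    _ = B * D ^ (q / p) * ∑' k, (∑ j ∈ Finset.range (k + 1), L⁻¹ ^ (k - j) * a j) ^ q :=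
        ENNReal.tsum_mul_left
    _ ≤ B * D ^ (q / p) * (C * (∑' j, a j ^ p) ^ (q / p)) := by grw [hconv a]
    _ ≤ _ := by
        rw [← mul_assoc]
        gcongr

end

/-! ### From the three regions to boundedness of the maximal operator. -/

noncomputable section

open Filter Topology

variable {d : ℕ} {p q : ℝ}

theorem radialMean_le_far (F : ℝ → ℝ≥0∞) {r t : ℝ} (hr : 3 ≤ r) (ht : t ∈ Icc (1 : ℝ) 2) :
    radialMean d F r t ≤ 2 * ∫⁻ s in Ioo (r - 2) (r + 2), F s := by
  have hr0 : 0 < r := by linarith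
  have ht0 : 0 < t := by linarith [ht.1]
  rw [radialMean, ← lintegral_const_mul' _ _ (by simp)]
  refine (setLIntegral_mono' measurableSet_Ioo fun s hs => ?_).trans
    (lintegral_mono_set (Ioo_subset_Ioo ?_ (by linarith [ht.2])))
  · gcongr
    rw [← ENNReal.ofReal_ofNat 2]
    refine ENNReal.ofReal_le_ofReal ?_
    have hs0 : 0 ≤ s := (abs_nonneg _).trans hs.1.le
    refine (radialKernel_le d hr0 ht0 hs0).trans ?_
    rw [div_le_iff₀ (by positivity)]
    nlinarith [hs.2, ht.1, ht.2]
  · rw [abs_of_nonneg (by linarith [ht.2])]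
    linarith [ht.2]

/-- Here t - r < s < t + r, which lies in (1/2, 5/2), and the kernel is at most s/(rt) ≤ 2/r. Taking
the supremum over all interval centres in `maxAverage` removes the dependence on t. -/
theorem radialMean_le_near (F : ℝ → ℝ≥0∞) {r t : ℝ} (hr : r ∈ Ioo (0 : ℝ) (1 / 2))
    (ht : t ∈ Icc (1 : ℝ) 2) :
    radialMean d F r t ≤ 2 * maxAverage ((Ioo (1 / 2) (5 / 2)).indicator F) r := by
  have hr0 : 0 < r := hr.1
  have hr1 := hr.2
  have ht0 : 0 < t := by linarith [ht.1]
  have habs : |r - t| = t - r := by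
    rw [abs_sub_comm, abs_of_nonneg]; linarith [ht.1]
  have h2 : (2 : ℝ≥0∞) = ENNReal.ofReal 2 := by simp
  rw [radialMean, habs, maxAverage, add_comm r t, h2, ← mul_assoc,
    ← ENNReal.ofReal_mul (by norm_num)]
  refine le_trans ?_ (mul_le_mul_right (le_iSup (fun a : ℝ => ∫⁻ s in Ioo (a - r) (a + r),
    (Ioo (1 / 2 : ℝ) (5 / 2)).indicator F s) t) _)
  rw [← lintegral_const_mul' _ _ ENNReal.ofReal_ne_top]
  refine setLIntegral_mono' measurableSet_Ioo fun s hs => ?_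
  have hs' : s ∈ Ioo (1 / 2 : ℝ) (5 / 2) :=
    ⟨by linarith [hs.1, ht.1], by linarith [hs.2, ht.2]⟩
  rw [indicator_of_mem hs']
  gcongr
  have hs0 : 0 ≤ s := by linarith [hs'.1]
  refine (radialKernel_le d hr0 ht0 hs0).trans ?_
  rw [← div_eq_mul_inv, div_le_div_iff₀ (by positivity) hr0]
  nlinarith [hs.2, ht.1, ht.2]

/-- The bound s^(d-2) for the kernel does not involve t, which survives only in the lower limit |r -
t| ≥ dist(r, E). The part s > 1 lies in a fixed bounded interval and is a constant in r. -/
theorem radialMean_le_middle (hd : 3 ≤ d) {F : ℝ → ℝ≥0∞} (hF : Measurable F) {E : Set ℝ}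
    (hE : E ⊆ Icc 1 2) {r t : ℝ} (hr : r ∈ Ico (1 / 2 : ℝ) 3) (ht : t ∈ E) :
    radialMean d F r t ≤ ENNReal.ofReal (2 ^ (d - 2)) *
      (tailIntegral d F (Metric.infDist r E) +
        ENNReal.ofReal (5 ^ (d - 2)) * ∫⁻ s in Ioo 1 5, F s) := by
  have ht' := hE ht
  have hr0 : 0 < r := by linarith [hr.1]
  have ht0 : 0 < t := by linarith [ht'.1]
  have hδ : Metric.infDist r E ≤ |r - t| := by
    rw [← Real.dist_eq]; exact Metric.infDist_le_dist_of_mem ht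
  calc radialMean d F r t
      ≤ ∫⁻ s in Ioo |r - t| (r + t),
          ENNReal.ofReal (2 ^ (d - 2)) * (F s * ENNReal.ofReal (s ^ (d - 2))) := by
        refine setLIntegral_mono' measurableSet_Ioo fun s hs => ?_
        rw [mul_comm (F s), ← mul_assoc, ← ENNReal.ofReal_mul (by positivity)]
        gcongr
        exact radialKernel_le_pow hd hr.1 ht'.1 ((abs_nonneg _).trans hs.1.le)
    _ ≤ ∫⁻ s in Ioc (Metric.infDist r E) 1 ∪ Ioo 1 5,
          ENNReal.ofReal (2 ^ (d - 2)) * (F s * ENNReal.ofReal (s ^ (d - 2))) := by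
        refine lintegral_mono_set fun s hs => ?_
        by_cases h1 : s ≤ 1
        · exact Or.inl ⟨lt_of_le_of_lt hδ hs.1, h1⟩
        · exact Or.inr ⟨not_le.1 h1, by linarith [hs.2, hr.2, ht'.2]⟩
    _ = ENNReal.ofReal (2 ^ (d - 2)) * ∫⁻ s in Ioc (Metric.infDist r E) 1 ∪ Ioo 1 5,
          F s * ENNReal.ofReal (s ^ (d - 2)) := lintegral_const_mul' _ _ ENNReal.ofReal_ne_top
    _ ≤ ENNReal.ofReal (2 ^ (d - 2)) * (tailIntegral d F (Metric.infDist r E) +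
          ∫⁻ s in Ioo 1 5, F s * ENNReal.ofReal (s ^ (d - 2))) := by
        gcongr
        exact lintegral_union_le _ _ _
    _ ≤ _ := by
        gcongr
        rw [← lintegral_const_mul _ hF]
        refine setLIntegral_mono' measurableSet_Ioo fun s hs => ?_
        rw [mul_comm]
        have := hs.1
        have := hs.2
        gcongr

/-- A radial majorant of the maximal function of a radial function. -/
def radialMajorant (d : ℕ) (E : Set ℝ) (F : ℝ → ℝ≥0∞) (r : ℝ) : ℝ≥0∞ :=
  (Iio (1 / 2)).indicator (fun r => 2 * maxAverage ((Ioo (1 / 2) (5 / 2)).indicator F) r) r +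
  (Ico (1 / 2) 3).indicator (fun r => ENNReal.ofReal (2 ^ (d - 2)) *
      (tailIntegral d F (Metric.infDist r E) +
        ENNReal.ofReal (5 ^ (d - 2)) * ∫⁻ s in Ioo 1 5, F s)) r +
  (Ici 3).indicator (fun r => 2 * ∫⁻ s in Ioo (r - 2) (r + 2), F s) r

theorem measurable_lintegral_Ioo_sub_add {F : ℝ → ℝ≥0∞} (hF : Measurable F) :
    Measurable fun r : ℝ => ∫⁻ s in Ioo (r - 2) (r + 2), F s := by
  have hset : MeasurableSet {z : ℝ × ℝ | z.2 ∈ Ioo (z.1 - 2) (z.1 + 2)} :=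
    (measurableSet_lt (f := fun z : ℝ × ℝ => z.1 - 2) (g := fun z => z.2)
      (by fun_prop) (by fun_prop)).inter (measurableSet_lt (f := fun z : ℝ × ℝ => z.2)
      (g := fun z => z.1 + 2) (by fun_prop) (by fun_prop))
  have hX' : (fun r => ∫⁻ s in Ioo (r - 2) (r + 2), F s) = fun r => ∫⁻ s,
      {z : ℝ × ℝ | z.2 ∈ Ioo (z.1 - 2) (z.1 + 2)}.indicator (fun z => F z.2) (r, s) := by
    ext r
    exact (lintegral_indicator measurableSet_Ioo F).symm
  rw [hX']
  exact ((hF.comp measurable_snd).indicator hset).lintegral_prod_right'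

theorem measurable_radialMajorant (d : ℕ) (E : Set ℝ) {F : ℝ → ℝ≥0∞} (hF : Measurable F) :
    Measurable (radialMajorant d E F) := by
  refine Measurable.add (Measurable.add ?_ ?_) ?_
  · exact ((measurable_maxAverage _).const_mul 2).indicator measurableSet_Iio
  · exact ((((measurable_tailIntegral d F).comp
      (Metric.continuous_infDist_pt E).measurable).add_const _).const_mul _).indicator
      measurableSet_Ico
  · exact ((measurable_lintegral_Ioo_sub_add hF).const_mul 2).indicator measurableSet_Ici

theorem radialMean_le_radialMajorant (hd : 3 ≤ d) {F : ℝ → ℝ≥0∞} (hF : Measurable F) {E : Set ℝ}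
    (hE : E ⊆ Icc 1 2) {r t : ℝ} (hr : 0 < r) (ht : t ∈ E) :
    radialMean d F r t ≤ radialMajorant d E F r := by
  unfold radialMajorant
  rcases lt_or_ge r (1 / 2) with h1 | h1
  · have h : r ∈ Iio (1 / 2 : ℝ) := h1
    refine le_add_right (le_add_right ?_)
    rw [indicator_of_mem h]
    exact radialMean_le_near F ⟨hr, h1⟩ (hE ht)
  rcases lt_or_ge r 3 with h2 | h2
  · have h : r ∈ Ico (1 / 2 : ℝ) 3 := ⟨h1, h2⟩
    refine le_add_right (le_add_left ?_)
    rw [indicator_of_mem h]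
    exact radialMean_le_middle hd hF hE h ht
  · have h : r ∈ Ici (3 : ℝ) := h2
    refine le_add_left ?_
    rw [indicator_of_mem h]
    exact radialMean_le_far F h2 (hE ht)

theorem exists_radialMajorant_estimate (hd : 3 ≤ d) (hp : 1 ≤ p) (hpq : p ≤ q) (hq : q ≤ d * p)
    (h1 : 1 < p ∨ q = 1) {E : Set ℝ} (hardy : ∃ C : ℝ≥0∞, C ≠ ∞ ∧ ∀ F : ℝ → ℝ≥0∞, Measurable F →
      ∫⁻ r in Ico (1 / 2 : ℝ) 3, tailIntegral d F (Metric.infDist r E) ^ q ≤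
        C * radialEnergy d p F ^ (q / p)) :
    ∃ C : ℝ≥0∞, C ≠ ∞ ∧ ∀ F : ℝ → ℝ≥0∞, Measurable F →
      ∫⁻ r in Ioi (0 : ℝ), ENNReal.ofReal (r ^ (d - 1)) * radialMajorant d E F r ^ q ≤
        C * radialEnergy d p F ^ (q / p) := by
  have hp0 : 0 < p := by linarith
  have hq0 : 0 ≤ q := by linarith
  obtain ⟨Ca, hCa, ha⟩ := exists_far_estimate d hp hpq
  obtain ⟨Cb, hCb, hb⟩ := exists_near_estimate (by omega) hp hpq hq h1
  obtain ⟨Cc, hCc, hc⟩ := hardy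
  set T : ℝ≥0∞ := ENNReal.ofReal (2 ^ (d - 2)) with hT
  set R : ℝ≥0∞ := ENNReal.ofReal (5 ^ (d - 2)) with hR
  set W : ℝ≥0∞ := ENNReal.ofReal (3 ^ (d - 1)) with hW
  set P : ℝ≥0∞ := (volume (Ioo (1 : ℝ) 5) ^ (p - 1)) ^ (q / p) with hP
  have hPfin : P ≠ ∞ := ENNReal.rpow_ne_top_of_nonneg (by positivity)
    (ENNReal.rpow_ne_top_of_nonneg (by linarith) (by simp))
  set Cm : ℝ≥0∞ := W * (T ^ q * (2 ^ (q - 1) * (Cc + R ^ q * P * volume (Ico (1 / 2 : ℝ) 3))))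
    with hCm
  have hfin : ∀ x : ℝ≥0∞, x ≠ ∞ → x ^ q ≠ ∞ := fun x hx => ENNReal.rpow_ne_top_of_nonneg hq0 hx
  have hCmfin : Cm ≠ ∞ := by
    refine ENNReal.mul_ne_top ENNReal.ofReal_ne_top (ENNReal.mul_ne_top
      (hfin _ ENNReal.ofReal_ne_top) (ENNReal.mul_ne_top
      (ENNReal.rpow_ne_top_of_nonneg (by linarith) (by simp)) (ENNReal.add_ne_top.2 ⟨hCc,
      ENNReal.mul_ne_top (ENNReal.mul_ne_top (hfin _ ENNReal.ofReal_ne_top) hPfin) (by simp)⟩)))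
  refine ⟨2 ^ q * Cb + (Cm + 2 ^ q * Ca), ENNReal.add_ne_top.2
    ⟨ENNReal.mul_ne_top (hfin _ (by simp)) hCb, ENNReal.add_ne_top.2 ⟨hCmfin,
      ENNReal.mul_ne_top (hfin _ (by simp)) hCa⟩⟩, fun F hF => ?_⟩
  set I := radialEnergy d p F with hI
  have hsplit : Ioi (0 : ℝ) = Ioo 0 (1 / 2) ∪ (Ico (1 / 2) 3 ∪ Ici 3) := by
    rw [Ico_union_Ici_eq_Ici (by norm_num), Ioo_union_Ici_eq_Ioi (by norm_num)]
  rw [hsplit]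
  refine (lintegral_union_le _ _ _).trans ?_
  rw [add_mul]
  refine add_le_add ?_ ((lintegral_union_le _ _ _).trans ?_)
  · calc _ = ∫⁻ r in Ioo (0 : ℝ) (1 / 2), 2 ^ q * (ENNReal.ofReal (r ^ (d - 1)) *
          maxAverage ((Ioo (1 / 2) (5 / 2)).indicator F) r ^ q) := by
          refine setLIntegral_congr_fun measurableSet_Ioo fun r hr => ?_
          have e1 : r ∈ Iio (1 / 2 : ℝ) := hr.2
          have e2 : r ∉ Ico (1 / 2 : ℝ) 3 := fun h => absurd h.1 (not_le.2 hr.2)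
          have e3 : r ∉ Ici (3 : ℝ) := fun h => by
            have : (3 : ℝ) ≤ r := h
            linarith [hr.2]
          simp only [radialMajorant]
          rw [indicator_of_mem e1, indicator_of_notMem e2, indicator_of_notMem e3, add_zero,
            add_zero, ENNReal.mul_rpow_of_nonneg _ _ hq0]
          ring
      _ ≤ _ := by
          rw [lintegral_const_mul' _ _ (hfin _ (by simp)), mul_assoc]
          gcongr
          exact hb F hF
  rw [add_mul]
  refine add_le_add ?_ ?_
  · set Q := ∫⁻ s in Ioo (1 : ℝ) 5, F s with hQ
    have hQI : Q ^ q ≤ P * I ^ (q / p) := by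
      have e1 : Q ^ q = (Q ^ p) ^ (q / p) := by
        rw [← ENNReal.rpow_mul]; congr 1; field_simp
      rw [e1, hP, ← ENNReal.mul_rpow_of_nonneg _ _ (by positivity)]
      refine ENNReal.rpow_le_rpow ?_ (by positivity)
      refine (rpow_setLIntegral_le_radialEnergy (d := d) hF hp one_pos measurableSet_Ioo
        (fun s hs => hs.1.le)).trans ?_
      simp [hI]
    have hGm : Measurable fun r : ℝ => tailIntegral d F (Metric.infDist r E) ^ q :=
      ((measurable_tailIntegral d F).comp
        (Metric.continuous_infDist_pt E).measurable).pow_const q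
    calc _ ≤ ∫⁻ r in Ico (1 / 2 : ℝ) 3, W * (T ^ q * (2 ^ (q - 1) *
          (tailIntegral d F (Metric.infDist r E) ^ q + R ^ q * P * I ^ (q / p)))) := by
          refine setLIntegral_mono' measurableSet_Ico fun r hr => ?_
          have e1 : r ∉ Iio (1 / 2 : ℝ) := fun h => absurd hr.1 (not_le.2 h)
          have e3 : r ∉ Ici (3 : ℝ) := fun h => absurd hr.2 (not_lt.2 h)
          have hr0 : 0 ≤ r := by linarith [hr.1]
          have hr3 := hr.2.le
          simp only [radialMajorant]
          rw [indicator_of_mem hr, indicator_of_notMem e1, indicator_of_notMem e3, add_zero,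
            zero_add, ENNReal.mul_rpow_of_nonneg _ _ hq0]
          refine mul_le_mul' (ENNReal.ofReal_le_ofReal (by gcongr)) ?_
          gcongr
          grw [ENNReal.rpow_add_le_mul_rpow_add_rpow _ _ (hp.trans hpq),
            ENNReal.mul_rpow_of_nonneg _ _ hq0, hQI]
          rw [mul_assoc]
      _ = W * (T ^ q * (2 ^ (q - 1) * ((∫⁻ r in Ico (1 / 2 : ℝ) 3,
          tailIntegral d F (Metric.infDist r E) ^ q) +
          R ^ q * P * I ^ (q / p) * volume (Ico (1 / 2 : ℝ) 3)))) := by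
          rw [lintegral_const_mul' _ _ ENNReal.ofReal_ne_top,
            lintegral_const_mul' _ _ (hfin _ ENNReal.ofReal_ne_top),
            lintegral_const_mul' _ _ (ENNReal.rpow_ne_top_of_nonneg (by linarith) (by simp)),
            lintegral_add_left hGm, setLIntegral_const]
      _ ≤ W * (T ^ q * (2 ^ (q - 1) * (Cc * I ^ (q / p) +
          R ^ q * P * I ^ (q / p) * volume (Ico (1 / 2 : ℝ) 3)))) := by grw [hc F hF]
      _ = _ := by rw [hCm]; ring
  · calc _ = ∫⁻ r in Ici (3 : ℝ), 2 ^ q * (ENNReal.ofReal (r ^ (d - 1)) *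
          (∫⁻ s in Ioo (r - 2) (r + 2), F s) ^ q) := by
          refine setLIntegral_congr_fun measurableSet_Ici fun r hr => ?_
          have hr' : (3 : ℝ) ≤ r := hr
          have e1 : r ∉ Iio (1 / 2 : ℝ) := fun h => by
            have : r < 1 / 2 := h
            linarith
          have e2 : r ∉ Ico (1 / 2 : ℝ) 3 := fun h => absurd h.2 (not_lt.2 hr')
          simp only [radialMajorant]
          rw [indicator_of_mem hr, indicator_of_notMem e1, indicator_of_notMem e2, add_zero,
            zero_add, ENNReal.mul_rpow_of_nonneg _ _ hq0]
          ring
      _ ≤ _ := by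
          rw [lintegral_const_mul' _ _ (hfin _ (by simp)), mul_assoc]
          gcongr
          exact ha F hF

/-- Polar coordinates reduce both norms to one-dimensional integrals. Finite energy also makes the
profile integrable on compact intervals away from 0, as the measurability and integrability clauses
require. -/
theorem radialBounded_of_hardy (hd : 3 ≤ d) (hp : 1 ≤ p) (hpq : p ≤ q) (hq : q ≤ d * p)
    (h1 : 1 < p ∨ q = 1) {E : Set ℝ} (hE : E ⊆ Icc 1 2) (hE0 : volume (closure E) = 0)
    (hardy : ∃ C : ℝ≥0∞, C ≠ ∞ ∧ ∀ F : ℝ → ℝ≥0∞, Measurable F →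
      ∫⁻ r in Ico (1 / 2 : ℝ) 3, tailIntegral d F (Metric.infDist r E) ^ q ≤
        C * radialEnergy d p F ^ (q / p)) :
    RadialBounded d E (ENNReal.ofReal p) (ENNReal.ofReal q) := by
  have hp0 : 0 < p := by linarith
  have hq0 : 0 < q := by linarith
  have : NeZero d := ⟨by omega⟩
  obtain ⟨C, hC, hmain⟩ := exists_radialMajorant_estimate hd hp hpq hq h1 hardy
  set K : ℝ≥0∞ := (volume : Measure (EuclideanSpace ℝ (Fin d))).toSphere univ with hK
  have hK0 : K ≠ 0 := by
    rw [hK, ne_eq, Measure.measure_univ_eq_zero]; exact Measure.toSphere_ne_zero _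
  have hKt : K ≠ ∞ := measure_ne_top _ _
  have hEpos : E ⊆ Ioi 0 := fun t ht => lt_of_lt_of_le one_pos (hE ht).1
  -- The factor K^(-1/p) appears because the L^p norm of f is (K * energy)^(1/p), with K the mass of
  -- the sphere.
  set M : ℝ≥0∞ := (capConst d ^ q * (K * C)) ^ (1 / q) * (K ^ (1 / p))⁻¹ with hM
  have hMt : M ≠ ∞ := by
    refine ENNReal.mul_ne_top (ENNReal.rpow_ne_top_of_nonneg (by positivity)
      (ENNReal.mul_ne_top (ENNReal.rpow_ne_top_of_nonneg hq0.le (capConst_ne_top d))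
      (ENNReal.mul_ne_top hKt hC))) ?_
    rw [ENNReal.inv_ne_top]
    exact (ENNReal.rpow_pos (pos_iff_ne_zero.2 hK0) hKt).ne'
  refine ⟨M.toNNReal, fun f hrad hf => ?_⟩
  obtain ⟨g, hg⟩ := exists_measurable_profile volume hrad hf.1
  have hprof : IsProfile f g := hg
  set F : ℝ → ℝ≥0∞ := fun s => ‖g s‖ₑ with hF
  have hFm : Measurable F := hg.1.enorm
  have hfg : ∀ᵐ x, f x = g ‖x‖ := by
    filter_upwards [ae_norm_of_ae_Ioi volume hg.2] with x hx using hx x rfl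
  have hpne : ENNReal.ofReal p ≠ 0 := by simpa using hp0
  have hqne : ENNReal.ofReal q ≠ 0 := by simpa using hq0
  have henergy : eLpNorm f (ENNReal.ofReal p) volume = (K * radialEnergy d p F) ^ (1 / p) := by
    rw [eLpNorm_eq_lintegral_rpow_enorm_toReal hpne ENNReal.ofReal_ne_top,
      ENNReal.toReal_ofReal hp0.le]
    congr 1
    have h2 := lintegral_fun_norm (volume : Measure (EuclideanSpace ℝ (Fin d)))
      (hFm.pow_const p)
    rw [finrank_euclideanSpace_fin] at h2
    rw [radialEnergy, ← h2]
    refine lintegral_congr_ae ?_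
    filter_upwards [hfg] with x hx
    rw [hx]
  have hIfin : radialEnergy d p F ≠ ∞ := by
    intro h
    have := hf.2
    rw [henergy, h, ENNReal.mul_top hK0, ENNReal.top_rpow_of_pos (by positivity)] at this
    exact lt_irrefl _ this
  have hloc : ∀ a b : ℝ, 0 < a → ∫⁻ s in Icc a b, ‖g s‖ₑ ≠ ∞ := by
    intro a b ha h
    have h3 := rpow_setLIntegral_le_radialEnergy (d := d) hFm hp ha measurableSet_Icc
      (Icc_subset_Ici_self : Icc a b ⊆ Ici a)
    rw [h, ENNReal.top_rpow_of_pos hp0, top_le_iff] at h3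
    exact ENNReal.mul_ne_top (ENNReal.rpow_ne_top_of_nonneg (by linarith) (by simp))
      (ENNReal.mul_ne_top ENNReal.ofReal_ne_top hIfin) h3
  refine ⟨hprof.ae_integrable hd hloc hEpos hE0,
    hprof.aemeasurable_sphericalMaximal hd hloc hEpos hE0, ?_⟩
  have hbound : ∀ x : EuclideanSpace ℝ (Fin d), x ≠ 0 →
      sphericalMaximal E f x ≤ capConst d * radialMajorant d E F ‖x‖ := by
    intro x hx
    refine iSup₂_le fun t ht => (hprof.enorm_sphericalMean_le hd hx (hEpos ht)).trans ?_
    gcongr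
    exact radialMean_le_radialMajorant hd hFm hE (norm_pos_iff.2 hx) ht
  have hint : ∫⁻ x, sphericalMaximal E f x ^ q ≤
      capConst d ^ q * (K * C) * radialEnergy d p F ^ (q / p) := by
    calc ∫⁻ x, sphericalMaximal E f x ^ q
        ≤ ∫⁻ x : EuclideanSpace ℝ (Fin d), capConst d ^ q * radialMajorant d E F ‖x‖ ^ q := by
          refine lintegral_mono_ae ?_
          filter_upwards [Measure.ae_ne volume (0 : EuclideanSpace ℝ (Fin d))] with x hx
          rw [← ENNReal.mul_rpow_of_nonneg _ _ hq0.le]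
          exact ENNReal.rpow_le_rpow (hbound x hx) hq0.le
      _ = capConst d ^ q * (K * ∫⁻ r in Ioi (0 : ℝ),
            ENNReal.ofReal (r ^ (d - 1)) * radialMajorant d E F r ^ q) := by
          rw [lintegral_const_mul' _ _ (ENNReal.rpow_ne_top_of_nonneg hq0.le (capConst_ne_top d))]
          have h2 := lintegral_fun_norm (volume : Measure (EuclideanSpace ℝ (Fin d)))
            ((measurable_radialMajorant d E hFm).pow_const q)
          rw [h2, finrank_euclideanSpace_fin]
      _ ≤ capConst d ^ q * (K * (C * radialEnergy d p F ^ (q / p))) := by grw [hmain F hFm]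
      _ = _ := by ring
  rw [eLpNorm_eq_lintegral_rpow_enorm_toReal hqne ENNReal.ofReal_ne_top,
    ENNReal.toReal_ofReal hq0.le, ENNReal.coe_toNNReal hMt, henergy]
  simp only [enorm_eq_self]
  calc _ ≤ (capConst d ^ q * (K * C) * radialEnergy d p F ^ (q / p)) ^ (1 / q) :=
        ENNReal.rpow_le_rpow hint (by positivity)
    _ = (capConst d ^ q * (K * C)) ^ (1 / q) * radialEnergy d p F ^ (1 / p) := by
        rw [ENNReal.mul_rpow_of_nonneg _ _ (by positivity), ← ENNReal.rpow_mul]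
        congr 2
        field_simp
    _ = _ := by
        have hKp : K ^ (1 / p) ≠ 0 := (ENNReal.rpow_pos (pos_iff_ne_zero.2 hK0) hKt).ne'
        have hKp' : K ^ (1 / p) ≠ ∞ := ENNReal.rpow_ne_top_of_nonneg (by positivity) hKt
        rw [ENNReal.mul_rpow_of_nonneg K _ (by positivity), hM, mul_assoc _ (K ^ (1 / p))⁻¹,
          ← mul_assoc (K ^ (1 / p))⁻¹, ENNReal.inv_mul_cancel hKp hKp', one_mul]

/-- The trivial bound for `p = q = ∞`. -/
theorem radialBounded_top (hd : 3 ≤ d) {E : Set ℝ} (hE : E ⊆ Icc 1 2)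
    (hE0 : volume (closure E) = 0) : RadialBounded d E ∞ ∞ := by
  have : NeZero d := ⟨by omega⟩
  have := isProbabilityMeasure_sphereProb (d := d) (by omega)
  have hEpos : E ⊆ Ioi 0 := fun t ht => lt_of_lt_of_le one_pos (hE ht).1
  refine ⟨1, fun f hrad hf => ?_⟩
  obtain ⟨g, hg⟩ := exists_measurable_profile volume hrad hf.1
  have hprof : IsProfile f g := hg
  set N := eLpNorm f ∞ volume with hN
  have hNt : N ≠ ∞ := hf.2.ne
  have hgN : ∀ᵐ s ∂(volume.restrict (Ioi (0 : ℝ))), ‖g s‖ₑ ≤ N := by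
    refine ae_Ioi_of_ae_norm (volume : Measure (EuclideanSpace ℝ (Fin d)))
      (measurableSet_le hg.1.enorm measurable_const) ?_
    filter_upwards [ae_norm_of_ae_Ioi volume hg.2,
      enorm_ae_le_eLpNormEssSup f (volume : Measure (EuclideanSpace ℝ (Fin d)))] with x hx hx2
    rw [← hx x rfl, hN, eLpNorm_exponent_top]
    exact hx2
  have hloc : ∀ a b : ℝ, 0 < a → ∫⁻ s in Icc a b, ‖g s‖ₑ ≠ ∞ := by
    intro a b ha
    refine ne_top_of_le_ne_top (b := ∫⁻ s in Icc a b, N) ?_ ?_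
    · rw [setLIntegral_const]
      exact ENNReal.mul_ne_top hNt (by simp)
    · refine lintegral_mono_ae ?_
      exact ae_restrict_of_ae_restrict_of_subset (fun s hs => lt_of_lt_of_le ha hs.1) hgN
  refine ⟨hprof.ae_integrable hd hloc hEpos hE0,
    hprof.aemeasurable_sphericalMaximal hd hloc hEpos hE0, ?_⟩
  rw [ENNReal.coe_one, one_mul, eLpNorm_exponent_top]
  refine eLpNormEssSup_le_of_ae_enorm_bound ?_
  filter_upwards [Measure.ae_ne volume (0 : EuclideanSpace ℝ (Fin d))] with x hx
  rw [enorm_eq_self]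
  refine iSup₂_le fun t ht => ?_
  rw [hprof.sphericalMean_eq hd hx (hEpos ht)]
  refine (enorm_integral_le_lintegral_enorm _).trans ?_
  calc ∫⁻ y, ‖g ‖x - t • y.1‖‖ₑ ∂(sphereProb d) ≤ ∫⁻ _, N ∂(sphereProb d) :=
        lintegral_mono_ae (ae_norm_sub_sphereProb hd hx (hEpos ht) hgN)
    _ = N := by simp

end

/-! ### Covering numbers, shells, and the sufficient conditions. -/

noncomputable section

open Filter Topology

variable {E : Set ℝ}

theorem floor_grid_finite (hE : E ⊆ Icc 1 2) {δ : ℝ} (hδ : 0 < δ) :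
    ((fun t : ℝ => ⌊t / δ⌋) '' E).Finite := by
  refine (finite_Icc ⌊1 / δ⌋ ⌊2 / δ⌋).subset ?_
  rintro _ ⟨t, ht, rfl⟩
  have h1 := (hE ht).1
  have h2 := (hE ht).2
  exact ⟨Int.floor_le_floor (by gcongr), Int.floor_le_floor (by gcongr)⟩

theorem coverNumber_le_card_grid (hE : E ⊆ Icc 1 2) {δ : ℝ} (hδ : 0 < δ) :
    ∃ s : Finset ℝ, s.card ≤ (floor_grid_finite hE hδ).toFinset.card ∧
      E ⊆ ⋃ a ∈ s, Icc a (a + δ) := by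
  classical
  refine ⟨(floor_grid_finite hE hδ).toFinset.image fun k : ℤ => (k : ℝ) * δ,
    Finset.card_image_le, fun t ht => ?_⟩
  simp only [mem_iUnion, Finset.mem_image, Finite.mem_toFinset, exists_prop]
  refine ⟨⌊t / δ⌋ * δ, ⟨_, ⟨t, ht, rfl⟩, rfl⟩, ?_, ?_⟩
  · rw [← le_div_iff₀ hδ]; exact Int.floor_le _
  · have := (Int.lt_floor_add_one (t / δ)).le
    rw [div_le_iff₀ hδ] at this
    linarith

/-- A finite cover exists, so `coverNumber` is an attained minimum and not the default value 0 of an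
infimum over the empty set. -/
theorem exists_cover_card_eq (hE : E ⊆ Icc 1 2) {δ : ℝ} (hδ : 0 < δ) :
    ∃ s : Finset ℝ, s.card = coverNumber E δ ∧ E ⊆ ⋃ a ∈ s, Icc a (a + δ) := by
  obtain ⟨s, -, hs⟩ := coverNumber_le_card_grid hE hδ
  exact Nat.sInf_mem (s := {n : ℕ | ∃ s : Finset ℝ, s.card = n ∧ E ⊆ ⋃ a ∈ s, Icc a (a + δ)})
    ⟨_, s, rfl, hs⟩

theorem one_le_coverNumber (hne : E.Nonempty) (hE : E ⊆ Icc 1 2) {δ : ℝ} (hδ : 0 < δ) :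
    1 ≤ coverNumber E δ := by
  obtain ⟨s, hs, hc⟩ := exists_cover_card_eq hE hδ
  obtain ⟨t, ht⟩ := hne
  obtain ⟨a, ha⟩ := mem_iUnion.1 (hc ht)
  obtain ⟨ha, -⟩ := mem_iUnion.1 ha
  rw [← hs]
  exact Finset.card_pos.2 ⟨a, ha⟩

/-- The measure of a neighbourhood of `E` is bounded by the covering number. -/
theorem volume_infDist_le_le_coverNumber (hne : E.Nonempty) (hE : E ⊆ Icc 1 2) {δ : ℝ}
    (hδ : 0 < δ) :
    volume {r | Metric.infDist r E ≤ δ} ≤ ENNReal.ofReal (5 * (δ * coverNumber E δ)) := by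
  obtain ⟨s, hs, hc⟩ := exists_cover_card_eq hE hδ
  calc volume {r | Metric.infDist r E ≤ δ}
      ≤ volume (⋃ a ∈ s, Icc (a - 2 * δ) (a + 3 * δ)) := by
        refine measure_mono fun r hr => ?_
        -- The distance need not be attained; relaxing δ to 2δ yields an actual point of E. The
        -- enlarged intervals have length 5δ.
        have hr : Metric.infDist r E < 2 * δ := lt_of_le_of_lt hr (by linarith)
        obtain ⟨t, ht, hrt⟩ := (Metric.infDist_lt_iff hne).1 hr
        obtain ⟨a, ha⟩ := mem_iUnion.1 (hc ht)
        obtain ⟨ha, hta⟩ := mem_iUnion.1 ha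
        rw [Real.dist_eq, abs_lt] at hrt
        simp only [mem_iUnion, exists_prop]
        exact ⟨a, ha, by linarith [hta.1], by linarith [hta.2]⟩
    _ ≤ ∑ a ∈ s, volume (Icc (a - 2 * δ) (a + 3 * δ)) := measure_biUnion_finset_le _ _
    _ = ∑ a ∈ s, ENNReal.ofReal (5 * δ) := by
        refine Finset.sum_congr rfl fun a _ => ?_
        rw [Real.volume_Icc]; congr 1; ring
    _ = _ := by
        rw [Finset.sum_const, hs, nsmul_eq_mul, ← ENNReal.ofReal_natCast,
          ← ENNReal.ofReal_mul (by positivity)]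
        congr 1; ring

/-- The covering number is bounded by the measure of a neighbourhood of `E`. -/
theorem coverNumber_le_volume (hE : E ⊆ Icc 1 2) {δ : ℝ} (hδ : 0 < δ) :
    ENNReal.ofReal (δ * coverNumber E δ) ≤ volume (Metric.thickening δ E) := by
  obtain ⟨s, hs, hc⟩ := coverNumber_le_card_grid hE hδ
  set K := (floor_grid_finite hE hδ).toFinset with hK
  have h1 : coverNumber E δ ≤ K.card := by
    refine le_trans (Nat.sInf_le ?_) hs
    exact ⟨s, rfl, hc⟩
  calc ENNReal.ofReal (δ * coverNumber E δ) ≤ ENNReal.ofReal (δ * K.card) := by gcongr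
    _ = ∑ k ∈ K, volume (Ico ((k : ℝ) * δ) ((k + 1 : ℝ) * δ)) := by
        have : ∀ k ∈ K, volume (Ico ((k : ℝ) * δ) ((k + 1 : ℝ) * δ)) = ENNReal.ofReal δ :=
          fun k _ => by rw [Real.volume_Ico]; congr 1; ring
        rw [Finset.sum_congr rfl this, Finset.sum_const, nsmul_eq_mul, mul_comm,
          ENNReal.ofReal_mul (by positivity), ENNReal.ofReal_natCast]
    _ = volume (⋃ k ∈ K, Ico ((k : ℝ) * δ) ((k + 1 : ℝ) * δ)) := by
        refine (measure_biUnion_finset (fun k _ l _ hkl => ?_) fun _ _ => measurableSet_Ico).symm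
        refine disjoint_left.2 fun x hx hy => hkl ?_
        have e1 : ⌊x / δ⌋ = k := by
          rw [Int.floor_eq_iff, le_div_iff₀ hδ, div_lt_iff₀ hδ]; exact hx
        have e2 : ⌊x / δ⌋ = l := by
          rw [Int.floor_eq_iff, le_div_iff₀ hδ, div_lt_iff₀ hδ]; exact hy
        rw [← e1, e2]
    _ ≤ _ := by
        refine measure_mono (iUnion₂_subset fun k hk r hr => ?_)
        rw [hK, Finite.mem_toFinset] at hk
        obtain ⟨t, ht, htk⟩ := hk
        have h2 := Int.floor_eq_iff.1 htk
        rw [le_div_iff₀ hδ, div_lt_iff₀ hδ] at h2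
        -- Both points lie in the same half-open cell of length δ, so their distance is strictly
        -- less than δ.
        refine Metric.mem_thickening_iff.2 ⟨t, ht, abs_lt.2 ⟨?_, ?_⟩⟩ <;> nlinarith [hr.1, hr.2, h2.1, h2.2]

theorem mul_coverNumber_le (hE : E ⊆ Icc 1 2) {δ : ℝ} (hδ : 0 < δ) (hδ1 : δ ≤ 1) :
    δ * coverNumber E δ ≤ 3 := by
  have h := coverNumber_le_volume hE hδ
  have h2 : volume (Metric.thickening δ E) ≤ ENNReal.ofReal 3 := by
    calc _ ≤ volume (Icc (0 : ℝ) 3) := by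
          refine measure_mono ?_
          intro r hr
          obtain ⟨t, ht, hr⟩ := Metric.mem_thickening_iff.1 hr
          rw [Real.dist_eq, abs_lt] at hr
          have := hE ht
          constructor <;> linarith [this.1, this.2]
      _ = _ := by rw [Real.volume_Icc, sub_zero]
  exact (ENNReal.ofReal_le_ofReal_iff (by norm_num)).1 (h.trans h2)

theorem one_mem_minkowskiDim_set (hE : E ⊆ Icc 1 2) :
    (1 : ℝ) ∈ {a : ℝ | 0 < a ∧ ∃ c : ℝ, 0 < c ∧ ∀ δ ∈ Ioo (0 : ℝ) 1,
      (coverNumber E δ : ℝ) ≤ c * δ ^ (-a)} := by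
  refine ⟨one_pos, 3, by norm_num, fun δ hδ => ?_⟩
  rw [Real.rpow_neg_one, ← div_eq_mul_inv, le_div_iff₀ hδ.1, mul_comm]
  exact mul_coverNumber_le hE hδ.1 hδ.2.le

theorem minkowskiDim_nonneg (E : Set ℝ) : 0 ≤ minkowskiDim E :=
  Real.sInf_nonneg fun _ ha => ha.1.le

theorem minkowskiDim_le {a c : ℝ} (ha : 0 < a) (hc : 0 < c)
    (h : ∀ δ ∈ Ioo (0 : ℝ) 1, (coverNumber E δ : ℝ) ≤ c * δ ^ (-a)) : minkowskiDim E ≤ a :=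
  csInf_le ⟨0, fun _ ha => ha.1.le⟩ ⟨ha, c, hc, h⟩

theorem exists_coverNumber_le_of_minkowskiDim_lt (hE : E ⊆ Icc 1 2) {b : ℝ}
    (hb : minkowskiDim E < b) :
    ∃ c : ℝ, 0 < c ∧ ∀ δ ∈ Ioo (0 : ℝ) 1, (coverNumber E δ : ℝ) ≤ c * δ ^ (-b) := by
  obtain ⟨a, ⟨ha, c, hc, h⟩, hab⟩ := exists_lt_of_csInf_lt ⟨1, one_mem_minkowskiDim_set hE⟩ hb
  refine ⟨c, hc, fun δ hδ => (h δ hδ).trans ?_⟩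
  gcongr ?_ * ?_
  exact Real.rpow_le_rpow_of_exponent_ge hδ.1 hδ.2.le (by linarith)

variable {d : ℕ} {p q : ℝ}

theorem lintegral_Ioc_ofReal_inv {a b : ℝ} (ha : 0 < a) (hab : a ≤ b) :
    ∫⁻ s in Ioc a b, ENNReal.ofReal s⁻¹ = ENNReal.ofReal (Real.log (b / a)) := by
  have hint : IntervalIntegrable (fun s : ℝ => s⁻¹) volume a b :=
    (continuousOn_inv₀.mono fun s hs => by
      rw [uIcc_of_le hab] at hs
      exact (ha.trans_le hs.1).ne').intervalIntegrable
  rw [← integral_inv_of_pos ha (ha.trans_le hab), intervalIntegral.integral_of_le hab,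
    ofReal_integral_eq_lintegral_ofReal hint.1
      ((ae_restrict_mem measurableSet_Ioc).mono fun s hs => inv_nonneg.2 (ha.trans hs.1).le)]

/-- Hölder for the measure ds/s on the shell, whose mass is the logarithm of the ratio of the radii.
The power of s left over is (d-1)p - d, which vanishes exactly at p = d/(d-1). -/
theorem rpow_shell_integral_le (hd : 2 ≤ d) (hp : 1 ≤ p) {a b M : ℝ} (ha : 0 < a) (hab : a ≤ b)
    (hM : ∀ s ∈ Ioc a b, s ^ (((d : ℝ) - 1) * p - d) ≤ M) {F : ℝ → ℝ≥0∞} (hF : Measurable F) :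
    (∫⁻ s in Ioc a b, F s * ENNReal.ofReal (s ^ (d - 2))) ^ p ≤
      ENNReal.ofReal (Real.log (b / a)) ^ (p - 1) * ENNReal.ofReal M *
        ∫⁻ s in Ioc a b, ENNReal.ofReal (s ^ (d - 1)) * F s ^ p := by
  have hb : 0 < b := ha.trans_le hab
  have hp0 : 0 < p := by linarith
  set w : ℝ → ℝ≥0∞ := fun s => ENNReal.ofReal s⁻¹ with hw
  have hwm : Measurable w := by rw [hw]; fun_prop
  set ν : Measure ℝ := (volume.restrict (Ioc a b)).withDensity w with hν
  set X : ℝ → ℝ≥0∞ := fun s => F s * ENNReal.ofReal (s ^ (d - 1)) with hX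
  have hXm : Measurable X := hF.mul (by fun_prop)
  have h := rpow_lintegral_le (μ := ν) hp hXm.aemeasurable
  have e1 : ν univ = ENNReal.ofReal (Real.log (b / a)) := by
    rw [hν, withDensity_apply _ MeasurableSet.univ, Measure.restrict_univ,
      lintegral_Ioc_ofReal_inv ha hab]
  have e2 : ∫⁻ s, X s ∂ν = ∫⁻ s in Ioc a b, F s * ENNReal.ofReal (s ^ (d - 2)) := by
    rw [hν, lintegral_withDensity_eq_lintegral_mul _ hwm hXm]
    refine setLIntegral_congr_fun measurableSet_Ioc fun s hs => ?_
    have hs0 : 0 < s := ha.trans hs.1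
    simp only [Pi.mul_apply, hX, hw]
    rw [mul_left_comm, ← ENNReal.ofReal_mul (by positivity)]
    have : d - 1 = (d - 2) + 1 := by omega
    rw [this, pow_succ]
    congr 2
    field_simp
  have e3 : ∫⁻ s, X s ^ p ∂ν ≤
      ENNReal.ofReal M * ∫⁻ s in Ioc a b, ENNReal.ofReal (s ^ (d - 1)) * F s ^ p := by
    rw [hν, lintegral_withDensity_eq_lintegral_mul _ hwm (hXm.pow_const p),
      ← lintegral_const_mul' _ _ ENNReal.ofReal_ne_top]
    refine setLIntegral_mono' measurableSet_Ioc fun s hs => ?_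
    have hs0 : 0 < s := ha.trans hs.1
    have hM0 : 0 ≤ M := (Real.rpow_nonneg hs0.le _).trans (hM s hs)
    simp only [Pi.mul_apply, hX, hw]
    rw [ENNReal.mul_rpow_of_nonneg _ _ hp0.le, mul_left_comm,
      ENNReal.ofReal_rpow_of_pos (by positivity), ← ENNReal.ofReal_mul (by positivity),
      ← mul_assoc, ← ENNReal.ofReal_mul hM0, mul_comm]
    refine mul_le_mul' (ENNReal.ofReal_le_ofReal ?_) le_rfl
    refine le_trans (le_of_eq ?_) (mul_le_mul_of_nonneg_right (hM s hs) (by positivity))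
    rw [← Real.rpow_neg_one, ← Real.rpow_natCast, ← Real.rpow_mul hs0.le, ← Real.rpow_add hs0,
      ← Real.rpow_add hs0, Nat.cast_sub (by omega)]
    congr 1
    push_cast
    ring
  rw [e1, e2] at h
  refine h.trans ?_
  rw [mul_assoc]
  gcongr

/-- Boundedness of the maximal operator from estimates on shells around the diagonal. -/
theorem radialBounded_of_shells (hd : 3 ≤ d) (hp : 1 ≤ p) (hpq : p ≤ q) (hq : q ≤ d * p)
    (h1 : 1 < p ∨ q = 1) (hne : E.Nonempty) (hE : E ⊆ Icc 1 2) {ρ : ℕ → ℝ} (h0 : ρ 0 = 1)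
    (hanti : Antitone ρ) (hpos : ∀ k, 0 < ρ k) (hlim : Tendsto ρ atTop (𝓝 0)) {L D B : ℝ≥0∞}
    (hL : 1 < L) (hLt : L ≠ ∞) (hD : D ≠ ∞) (hB : B ≠ ∞)
    (H1 : ∀ k, ∀ F : ℝ → ℝ≥0∞, Measurable F →
      (∫⁻ s in Ioc (ρ (k + 1)) (ρ k), F s * ENNReal.ofReal (s ^ (d - 2))) ^ p ≤
        D * (L ^ k) ^ p * ∫⁻ s in Ioc (ρ (k + 1)) (ρ k), ENNReal.ofReal (s ^ (d - 1)) * F s ^ p)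
    (H2 : ∀ k, volume (Ico (1 / 2) 3 ∩ {r | Metric.infDist r E ≤ ρ k}) * (L ^ k) ^ q ≤ B) :
    RadialBounded d E (ENNReal.ofReal p) (ENNReal.ofReal q) := by
  have hq0 : 0 < q := by linarith
  -- The closure lies in every sublevel set of the distance, and `H2` bounds its measure by B /
  -- L^(kq), which tends to 0.
  have hE0 : volume (closure E) = 0 := by
    by_contra hv
    have hvk : ∀ k, volume (closure E) * (L ^ q) ^ k ≤ B := by
      intro k
      refine le_trans ?_ (H2 k)
      rw [← ENNReal.rpow_natCast (L ^ q), ← ENNReal.rpow_mul, mul_comm q, ENNReal.rpow_mul,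
        ENNReal.rpow_natCast]
      gcongr
      intro r hr
      refine ⟨?_, ?_⟩
      · have := closure_minimal hE isClosed_Icc hr
        exact ⟨by linarith [this.1], by linarith [this.2]⟩
      · have : Metric.infDist r E = 0 := (Metric.mem_closure_iff_infDist_zero hne).1 hr
        simp [this, (hpos k).le]
    have hLq : 1 < L ^ q := ENNReal.one_lt_rpow hL hq0
    have ht := ENNReal.tendsto_pow_atTop_nhds_top_iff.2 hLq
    have hvt : volume (closure E) ≠ ∞ := by
      refine ne_top_of_le_ne_top ?_ (measure_mono (closure_minimal hE isClosed_Icc))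
      simp
    have hlt : B / volume (closure E) < ∞ := (ENNReal.div_ne_top hB hv).lt_top
    obtain ⟨k, hk⟩ := (ht.eventually_const_lt hlt).exists
    rw [ENNReal.div_lt_iff (Or.inl hv) (Or.inl hvt), mul_comm] at hk
    exact absurd (hvk k) (not_le.2 hk)
  exact radialBounded_of_hardy hd hp hpq hq h1 hE hE0
    (exists_hardy_estimate hp hpq hne hE0 h0 hanti hpos hlim hL hLt hD hB H1 H2)

theorem volume_Ico_inter_le (S : Set ℝ) : volume (Ico (1 / 2 : ℝ) 3 ∩ S) ≤ ENNReal.ofReal 3 := by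
  refine (measure_mono inter_subset_left).trans ?_
  rw [Real.volume_Ico]
  exact ENNReal.ofReal_le_ofReal (by norm_num)

/-- Dyadic shells ρ_k = 2^(-k). The sublevel sets have measure of order 2^(-k(1-b)), which allows L
= 2^γ with γ = (1-b)/q; `hdim` says that the shell estimate grows no faster. -/
theorem radialBounded_of_coverNumber_le (hd : 3 ≤ d) (hp : 1 ≤ p) (hpq : p ≤ q) (hq : q ≤ d * p)
    (h1 : 1 < p ∨ q = 1) (hne : E.Nonempty) (hE : E ⊆ Icc 1 2) {b c : ℝ} (hb1 : b < 1)
    (hc : 0 < c) (hcov : ∀ δ ∈ Ioo (0 : ℝ) 1, (coverNumber E δ : ℝ) ≤ c * δ ^ (-b))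
    (hdim : d / p - (d - 1) ≤ (1 - b) / q) :
    RadialBounded d E (ENNReal.ofReal p) (ENNReal.ofReal q) := by
  have hp0 : 0 < p := by linarith
  have hq0 : 0 < q := by linarith
  set γ := (1 - b) / q with hγ
  have hγ0 : 0 < γ := div_pos (by linarith) hq0
  have hpow : ∀ k : ℕ, ((2 : ℝ)⁻¹) ^ k = (2 : ℝ) ^ (-(k : ℝ)) := fun k => by
    rw [Real.rpow_neg (by norm_num), Real.rpow_natCast, inv_pow]
  have hLk : ∀ (k : ℕ) (x : ℝ), 0 ≤ x →
      (ENNReal.ofReal (2 ^ γ) ^ k) ^ x = ENNReal.ofReal (2 ^ (k * γ * x)) := by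
    intro k x hx
    rw [← ENNReal.ofReal_pow (by positivity), ENNReal.ofReal_rpow_of_pos (by positivity),
      ← Real.rpow_natCast, ← Real.rpow_mul (by positivity), ← Real.rpow_mul (by positivity)]
    congr 2
    ring
  refine radialBounded_of_shells hd hp hpq hq h1 hne hE (ρ := fun k => (2 : ℝ)⁻¹ ^ k)
    (L := ENNReal.ofReal (2 ^ γ)) (D := ENNReal.ofReal (2 ^ (γ * p)))
    (B := ENNReal.ofReal (5 * c + 3)) (by simp)
    (fun m n h => pow_le_pow_of_le_one (by norm_num) (by norm_num) h) (fun k => by positivity)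
    (tendsto_pow_atTop_nhds_zero_of_lt_one (by norm_num) (by norm_num)) ?_ ENNReal.ofReal_ne_top
    ENNReal.ofReal_ne_top ENNReal.ofReal_ne_top ?_ ?_
  · rw [← ENNReal.ofReal_one, ENNReal.ofReal_lt_ofReal_iff (by positivity)]
    exact Real.one_lt_rpow (by norm_num) hγ0
  · intro k F hF
    have hM : ∀ s ∈ Ioc ((2 : ℝ)⁻¹ ^ (k + 1)) ((2 : ℝ)⁻¹ ^ k),
        s ^ (((d : ℝ) - 1) * p - d) ≤ 2 ^ (γ * p) * 2 ^ (k * γ * p) := by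
      intro s hs
      have hs0 : 0 < s := lt_trans (by positivity) hs.1
      have hs1 : s ≤ 1 := hs.2.trans (pow_le_one₀ (by norm_num) (by norm_num))
      have h3 : -(γ * p) ≤ ((d : ℝ) - 1) * p - d := by
        have : d - (d - 1) * p ≤ γ * p := by
          have h4 := mul_le_mul_of_nonneg_right hdim hp0.le
          rwa [sub_mul, div_mul_cancel₀ _ hp0.ne'] at h4
        linarith
      calc s ^ (((d : ℝ) - 1) * p - d) ≤ s ^ (-(γ * p)) :=
            Real.rpow_le_rpow_of_exponent_ge hs0 hs1 h3
        _ ≤ ((2 : ℝ)⁻¹ ^ (k + 1)) ^ (-(γ * p)) :=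
            Real.rpow_le_rpow_of_nonpos (by positivity) hs.1.le (by
              have : 0 < γ * p := by positivity
              linarith)
        _ = _ := by
            rw [hpow, ← Real.rpow_mul (by norm_num), ← Real.rpow_add (by norm_num)]
            congr 1
            push_cast
            ring
    have h4 := rpow_shell_integral_le (by omega) hp
      (by positivity : (0 : ℝ) < (2 : ℝ)⁻¹ ^ (k + 1))
      (pow_le_pow_of_le_one (by norm_num) (by norm_num) (Nat.le_succ k)) hM hF
    refine h4.trans ?_
    refine mul_le_mul' ?_ le_rfl
    rw [hLk k p hp0.le, ← ENNReal.ofReal_mul (by positivity)]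
    refine mul_le_of_le_one_left zero_le ?_
    refine ENNReal.rpow_le_one ?_ (by linarith)
    rw [ENNReal.ofReal_le_one]
    have : (2 : ℝ)⁻¹ ^ k / (2 : ℝ)⁻¹ ^ (k + 1) = 2 := by
      rw [pow_succ]; field_simp
    rw [this]
    linarith [Real.log_two_lt_d9]
  · intro k
    rw [hLk k q hq0.le]
    have hexp : k * γ * q = k * (1 - b) := by rw [hγ]; field_simp
    rw [hexp]
    -- The radius ρ 0 = 1 is outside the open range where the covering bound is assumed, hence the
    -- trivial bound and the summand 3 in B.
    rcases Nat.eq_zero_or_pos k with rfl | hk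
    · rw [Nat.cast_zero, zero_mul, Real.rpow_zero, ENNReal.ofReal_one, mul_one]
      exact (volume_Ico_inter_le _).trans (ENNReal.ofReal_le_ofReal (by linarith))
    · have hδ : (2 : ℝ)⁻¹ ^ k ∈ Ioo (0 : ℝ) 1 :=
        ⟨by positivity, pow_lt_one₀ (by norm_num) (by norm_num) (by omega)⟩
      grw [measure_mono inter_subset_right, volume_infDist_le_le_coverNumber hne hE hδ.1]
      rw [← ENNReal.ofReal_mul (by have := hδ.1; positivity)]
      refine ENNReal.ofReal_le_ofReal ?_
      have h5 := hcov _ hδ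
      calc 5 * ((2 : ℝ)⁻¹ ^ k * coverNumber E ((2 : ℝ)⁻¹ ^ k)) * 2 ^ ((k : ℝ) * (1 - b))
          ≤ 5 * ((2 : ℝ)⁻¹ ^ k * (c * ((2 : ℝ)⁻¹ ^ k) ^ (-b))) * 2 ^ ((k : ℝ) * (1 - b)) := by
            gcongr
        _ = 5 * c * ((2 : ℝ) ^ (-(k : ℝ)) * 2 ^ (-(k : ℝ) * -b) * 2 ^ ((k : ℝ) * (1 - b))) := by
            rw [hpow, ← Real.rpow_mul (by norm_num)]; ring
        _ = 5 * c := by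
            rw [← Real.rpow_add (by norm_num), ← Real.rpow_add (by norm_num)]
            ring_nf
            simp
        _ ≤ _ := by linarith

/-- The shell estimate costs only log(ρ_k/ρ_{k+1})^(p-1). With ρ_k = exp(1 - 2^k) this logarithm is
2^k and p - 1 = p/d, so L = 2^(1/d). Also log(1/ρ_k) = 2^k - 1 ≥ 2^k/2 for k ≥ 1, so `H2` becomes
the logarithmic condition at δ = ρ_k. -/
theorem radialBounded_critical (hd : 3 ≤ d) (hq1 : (d : ℝ) / (d - 1) ≤ q)
    (hq2 : q ≤ (d : ℝ) ^ 2 / (d - 1)) (hne : E.Nonempty) (hE : E ⊆ Icc 1 2) {c : ℝ}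
    (hc : ∀ δ ∈ Ioo (0 : ℝ) 1,
      Real.log (1 / δ) ^ (q / (d : ℝ)) * minkowskiChar E 1 δ ≤ c) :
    RadialBounded d E (ENNReal.ofReal ((d : ℝ) / (d - 1))) (ENNReal.ofReal q) := by
  have hdr : (3 : ℝ) ≤ d := by exact_mod_cast hd
  have hd1 : (0 : ℝ) < d - 1 := by linarith
  have hd0 : (0 : ℝ) < d := by linarith
  have hp1 : 1 < (d : ℝ) / (d - 1) := by rw [one_lt_div hd1]; linarith
  set p := (d : ℝ) / (d - 1) with hp
  have hp0 : 0 < p := by linarith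
  have hq0 : 0 < q := by linarith
  have hLk : ∀ (k : ℕ) (x : ℝ), 0 ≤ x →
      (ENNReal.ofReal (2 ^ (1 / (d : ℝ))) ^ k) ^ x = ENNReal.ofReal (((2 : ℝ) ^ k) ^ (x / d)) := by
    intro k x hx
    rw [← ENNReal.ofReal_pow (by positivity), ENNReal.ofReal_rpow_of_pos (by positivity),
      ← Real.rpow_natCast, ← Real.rpow_natCast, ← Real.rpow_mul (by positivity),
      ← Real.rpow_mul (by positivity), ← Real.rpow_mul (by positivity)]
    congr 2
    ring
  have htop : Tendsto (fun k : ℕ => (2 : ℝ) ^ k) atTop atTop :=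
    tendsto_pow_atTop_atTop_of_one_lt (by norm_num)
  refine radialBounded_of_shells hd hp1.le hq1 ?_ (Or.inl hp1) hne hE
    (ρ := fun k => Real.exp (1 - 2 ^ k))
    (L := ENNReal.ofReal (2 ^ (1 / (d : ℝ)))) (D := 1)
    (B := ENNReal.ofReal (5 * |c| * 2 ^ (q / d) + 3)) (by simp)
    (fun m n h => ?_) (fun k => Real.exp_pos _) ?_ ?_ ENNReal.ofReal_ne_top
    ENNReal.one_ne_top ENNReal.ofReal_ne_top ?_ ?_
  · refine hq2.trans (le_of_eq ?_)
    rw [hp]; ring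
  · dsimp only
    have : (2 : ℝ) ^ m ≤ 2 ^ n := pow_le_pow_right₀ (by norm_num) h
    gcongr
  · refine Real.tendsto_exp_atBot.comp ?_
    exact tendsto_atBot_add_const_left _ 1 (tendsto_neg_atTop_atBot.comp htop)
  · rw [← ENNReal.ofReal_one, ENNReal.ofReal_lt_ofReal_iff (by positivity)]
    exact Real.one_lt_rpow (by norm_num) (by positivity)
  · intro k F hF
    have h4 := rpow_shell_integral_le (d := d) (M := 1) (by omega) hp1.le
      (Real.exp_pos (1 - 2 ^ (k + 1))) (b := Real.exp (1 - 2 ^ k)) (by gcongr <;> simp) (by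
        intro s _
        have : ((d : ℝ) - 1) * p - d = 0 := by rw [hp]; field_simp; ring
        rw [this, Real.rpow_zero]) hF
    refine h4.trans ?_
    rw [hLk k p hp0.le, ENNReal.ofReal_one, mul_one, one_mul, ← Real.exp_sub, Real.log_exp]
    gcongr
    have h5 : (1 - (2 : ℝ) ^ k - (1 - 2 ^ (k + 1))) = 2 ^ k := by ring
    have h6 : p - 1 = p / d := by rw [hp]; field_simp; ring
    rw [h5, ENNReal.ofReal_rpow_of_pos (by positivity), h6]
  · intro k
    rw [hLk k q hq0.le]
    rcases Nat.eq_zero_or_pos k with rfl | hk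
    · rw [pow_zero, Real.one_rpow, ENNReal.ofReal_one, mul_one]
      refine (volume_Ico_inter_le _).trans (ENNReal.ofReal_le_ofReal ?_)
      have : 0 ≤ 5 * |c| * 2 ^ (q / d) := by positivity
      linarith
    · have h2k : (2 : ℝ) ≤ 2 ^ k := by
        calc (2 : ℝ) = 2 ^ 1 := by norm_num
          _ ≤ 2 ^ k := pow_le_pow_right₀ (by norm_num) hk
      have hδ : Real.exp (1 - 2 ^ k) ∈ Ioo (0 : ℝ) 1 :=
        ⟨Real.exp_pos _, by rw [Real.exp_lt_one_iff]; linarith⟩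
      grw [measure_mono inter_subset_right, volume_infDist_le_le_coverNumber hne hE hδ.1]
      rw [← ENNReal.ofReal_mul (by have := hδ.1; positivity)]
      refine ENNReal.ofReal_le_ofReal ?_
      have h5 := hc _ hδ
      rw [minkowskiChar, Real.rpow_one, one_div, ← Real.exp_neg, Real.log_exp] at h5
      set N := Real.exp (1 - 2 ^ k) * (coverNumber E (Real.exp (1 - 2 ^ k)) : ℝ) with hN
      have hN0 : 0 ≤ N := by positivity
      calc 5 * N * ((2 : ℝ) ^ k) ^ (q / d)
          ≤ 5 * N * (2 * -(1 - (2 : ℝ) ^ k)) ^ (q / d) := by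
            gcongr
            linarith
        _ = 5 * 2 ^ (q / d) * ((-(1 - (2 : ℝ) ^ k)) ^ (q / d) * N) := by
            rw [Real.mul_rpow (by norm_num) (by linarith)]; ring
        _ ≤ 5 * 2 ^ (q / d) * |c| := by
            gcongr
            exact h5.trans (le_abs_self c)
        _ ≤ _ := by linarith

end

/-! ### Test functions: large balls and thin shells. -/

noncomputable section

open Filter Topology

variable {d : ℕ} {E : Set ℝ}

theorem enorm_sphericalMean_of_nonneg (hd : d ≠ 0) {g : ℝ → ℝ≥0} (hg : Measurable g) {K : ℝ≥0}
    (hK : ∀ s, g s ≤ K) (t : ℝ) (x : EuclideanSpace ℝ (Fin d)) :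
    ‖sphericalMean t (fun x => ((g ‖x‖ : ℝ) : ℂ)) x‖ₑ =
      ∫⁻ y, (g ‖x - t • y.1‖ : ℝ≥0∞) ∂(sphereProb d) := by
  have := isProbabilityMeasure_sphereProb hd
  have hm : Measurable fun y : Metric.sphere (0 : EuclideanSpace ℝ (Fin d)) 1 =>
      (g ‖x - t • y.1‖ : ℝ) := (hg.comp (by fun_prop)).coe_nnreal_real
  have hi : Integrable (fun y : Metric.sphere (0 : EuclideanSpace ℝ (Fin d)) 1 =>
      (g ‖x - t • y.1‖ : ℝ)) (sphereProb d) := by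
    refine Integrable.of_bound hm.aestronglyMeasurable K (ae_of_all _ fun y => ?_)
    rw [Real.norm_of_nonneg (NNReal.coe_nonneg _)]
    exact_mod_cast hK _
  rw [sphericalMean, integral_complex_ofReal, ← ofReal_norm, Complex.norm_real, ofReal_norm,
    Real.enorm_of_nonneg (integral_nonneg fun _ => NNReal.coe_nonneg _),
    ofReal_integral_eq_lintegral_ofReal hi (ae_of_all _ fun _ => NNReal.coe_nonneg _)]
  simp

/-- Lower bounds for the maximal function of a radial test function. -/
theorem RadialBounded.exists_mul_volume_rpow_le (hd : d ≠ 0) {p q : ℝ≥0∞} (hq : q ≠ 0)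
    (h : RadialBounded d E p q) :
    ∃ C : ℝ≥0, ∀ g : ℝ → ℝ≥0, Measurable g → ∀ K : ℝ≥0, (∀ s, g s ≤ K) →
      MemLp (fun x : EuclideanSpace ℝ (Fin d) => ((g ‖x‖ : ℝ) : ℂ)) p volume →
      ∀ A : Set (EuclideanSpace ℝ (Fin d)), MeasurableSet A → volume A ≠ 0 → ∀ m : ℝ≥0∞,
      (∀ x ∈ A, ∃ t ∈ E, m ≤ ∫⁻ y, (g ‖x - t • y.1‖ : ℝ≥0∞) ∂(sphereProb d)) →
      m * volume A ^ (1 / q.toReal) ≤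
        C * eLpNorm (fun x : EuclideanSpace ℝ (Fin d) => ((g ‖x‖ : ℝ) : ℂ)) p volume := by
  obtain ⟨C, hC⟩ := h
  refine ⟨C, fun g hg K hK hmem A hA hA0 m hm => ?_⟩
  refine le_trans ?_ (hC _ (fun x y hxy => by simp only [hxy]) hmem).2.2
  have h1 := eLpNorm_indicator_const' (μ := volume) (c := m) hA hA0 hq
  rw [enorm_eq_self] at h1
  rw [← h1]
  refine eLpNorm_mono_enorm fun x => ?_
  by_cases hx : x ∈ A
  · obtain ⟨t, ht, hmt⟩ := hm x hx
    rw [indicator_of_mem hx, enorm_eq_self, enorm_eq_self, sphericalMaximal]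
    refine hmt.trans ?_
    rw [← enorm_sphericalMean_of_nonneg hd hg hK]
    exact le_iSup₂ (f := fun t _ => ‖sphericalMean t (fun x => ((g ‖x‖ : ℝ) : ℂ)) x‖ₑ) t ht
  · simp [indicator_of_notMem hx]

/-- This also holds at z = 0: the exponent is then ∞, `toReal` sends it to 0, and 1/0 = 0. The
endpoint exponents thus need no separate treatment in the tests. -/
theorem ofReal_inv_toReal_inv {z : ℝ} (hz : 0 ≤ z) : 1 / (ENNReal.ofReal z)⁻¹.toReal = z := by
  rw [ENNReal.toReal_inv, ENNReal.toReal_ofReal hz, one_div, inv_inv]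

theorem RadialBounded.exists_indicator_le (hd : d ≠ 0) {z₁ z₂ : ℝ} (hz₁ : 0 ≤ z₁) (hz₂ : 0 ≤ z₂)
    (h : RadialBounded d E (ENNReal.ofReal z₁)⁻¹ (ENNReal.ofReal z₂)⁻¹) :
    ∃ C : ℝ≥0, ∀ S : Set ℝ, MeasurableSet S →
      volume {x : EuclideanSpace ℝ (Fin d) | ‖x‖ ∈ S} ≠ ∞ →
      ∀ A : Set (EuclideanSpace ℝ (Fin d)), MeasurableSet A → volume A ≠ 0 → ∀ m : ℝ≥0∞,
      (∀ x ∈ A, ∃ t ∈ E,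
        m ≤ ∫⁻ y, S.indicator 1 ‖x - t • y.1‖ ∂(sphereProb d)) →
      m * volume A ^ z₂ ≤ C * volume {x : EuclideanSpace ℝ (Fin d) | ‖x‖ ∈ S} ^ z₁ := by
  obtain ⟨C, hC⟩ := h.exists_mul_volume_rpow_le hd (by simp)
  refine ⟨C, fun S hS hSt A hA hA0 m hm => ?_⟩
  have hS' : MeasurableSet {x : EuclideanSpace ℝ (Fin d) | ‖x‖ ∈ S} := measurable_norm hS
  have hf : (fun x : EuclideanSpace ℝ (Fin d) => (((S.indicator 1 ‖x‖ : ℝ≥0) : ℝ) : ℂ)) =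
      {x : EuclideanSpace ℝ (Fin d) | ‖x‖ ∈ S}.indicator fun _ => 1 := by
    ext x
    by_cases hx : ‖x‖ ∈ S <;> simp [hx]
  have h1 := hC (S.indicator 1) (measurable_one.indicator hS) 1
    (fun s => indicator_le_self' (by simp) s) (by
      rw [hf]; exact memLp_indicator_const _ hS' _ (Or.inr hSt)) A hA hA0 m (fun x hx => by
        obtain ⟨t, ht, hmt⟩ := hm x hx
        refine ⟨t, ht, hmt.trans (lintegral_mono fun y => ?_)⟩
        by_cases hy : ‖x - t • y.1‖ ∈ S <;> simp [hy])
  rw [hf, ofReal_inv_toReal_inv hz₂] at h1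
  refine h1.trans ?_
  gcongr
  refine (eLpNorm_indicator_const_le _ _).trans (le_of_eq ?_)
  rw [ofReal_inv_toReal_inv hz₁, enorm_one, one_mul]

/-- Converts extended nonnegative inequalities with fixed constants into real ones, with a constant
independent of x and y. -/
theorem exists_le_mul_of_ofReal_le {K₁ K₂ : ℝ≥0∞} (h₁ : K₁ ≠ 0) (h₂ : K₂ ≠ ∞) :
    ∃ C : ℝ, 0 ≤ C ∧ ∀ x y : ℝ, 0 ≤ y → K₁ * ENNReal.ofReal x ≤ K₂ * ENNReal.ofReal y →
      x ≤ C * y := by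
  refine ⟨(K₂ / K₁).toReal, ENNReal.toReal_nonneg, fun x y hy h => ?_⟩
  have hK : K₂ / K₁ ≠ ∞ := ENNReal.div_ne_top h₂ h₁
  rw [← ENNReal.ofReal_le_ofReal_iff (by positivity), ENNReal.ofReal_mul (by positivity),
    ENNReal.ofReal_toReal hK]
  rcases eq_or_ne K₁ ∞ with rfl | h₁'
  · have : ENNReal.ofReal x = 0 := by
      by_contra hx
      rw [ENNReal.top_mul hx, top_le_iff] at h
      exact ENNReal.mul_ne_top h₂ ENNReal.ofReal_ne_top h
    rw [this]
    exact zero_le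
  · calc ENNReal.ofReal x = K₁⁻¹ * (K₁ * ENNReal.ofReal x) := by
          rw [← mul_assoc, ENNReal.inv_mul_cancel h₁ h₁', one_mul]
      _ ≤ K₁⁻¹ * (K₂ * ENNReal.ofReal y) := by gcongr
      _ = _ := by rw [ENNReal.div_eq_inv_mul, mul_assoc]

theorem le_of_rpow_le_mul_rpow_atTop {a b C R₀ : ℝ} (h : ∀ R, R₀ ≤ R → R ^ a ≤ C * R ^ b) :
    a ≤ b := by
  by_contra! hab
  have ht := tendsto_rpow_atTop (sub_pos.2 hab)
  obtain ⟨R, ⟨hR, hR0⟩, hR1⟩ := ((ht.eventually_gt_atTop C).and (eventually_gt_atTop 0)).and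
    (eventually_ge_atTop R₀) |>.exists
  have := h R hR1
  have h2 : R ^ a = R ^ (a - b) * R ^ b := by rw [← Real.rpow_add hR0]; ring_nf
  rw [h2] at this
  have h3 := le_of_mul_le_mul_right this (Real.rpow_pos_of_pos hR0 b)
  linarith

theorem le_of_rpow_le_mul_rpow {a b C δ₀ : ℝ} (hδ₀ : 0 < δ₀)
    (h : ∀ δ, 0 < δ → δ < δ₀ → δ ^ a ≤ C * δ ^ b) : b ≤ a := by
  suffices -a ≤ -b by linarith
  refine le_of_rpow_le_mul_rpow_atTop (C := C) (R₀ := δ₀⁻¹ + 1) fun R hR => ?_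
  have hR0 : 0 < R := by have : 0 < δ₀⁻¹ := inv_pos.2 hδ₀; linarith
  have := h R⁻¹ (inv_pos.2 hR0) (inv_lt_of_inv_lt₀ hδ₀ (by linarith))
  rwa [Real.inv_rpow hR0.le, Real.inv_rpow hR0.le, ← Real.rpow_neg hR0.le,
    ← Real.rpow_neg hR0.le] at this

theorem volume_ball_eq (hd : d ≠ 0) {R : ℝ} (hR : 0 ≤ R) :
    volume (Metric.ball (0 : EuclideanSpace ℝ (Fin d)) R) =
      ENNReal.ofReal (R ^ d) * volume (Metric.ball (0 : EuclideanSpace ℝ (Fin d)) 1) := by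
  have : NeZero d := ⟨hd⟩
  rw [Measure.addHaar_ball _ _ hR, finrank_euclideanSpace_fin]

theorem volume_norm_mem (hd : d ≠ 0) {S : Set ℝ} (hS : MeasurableSet S) :
    volume {x : EuclideanSpace ℝ (Fin d) | ‖x‖ ∈ S} =
      (volume : Measure (EuclideanSpace ℝ (Fin d))).toSphere univ *
        ∫⁻ s in Ioi 0, ENNReal.ofReal (s ^ (d - 1)) * S.indicator 1 s := by
  have : NeZero d := ⟨hd⟩
  have h := lintegral_fun_norm (volume : Measure (EuclideanSpace ℝ (Fin d)))
    (measurable_one.indicator hS : Measurable (S.indicator (1 : ℝ → ℝ≥0∞)))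
  rw [finrank_euclideanSpace_fin] at h
  rw [← h]
  exact (lintegral_indicator_one (measurable_norm hS)).symm

theorem toSphere_univ_ne_zero (hd : d ≠ 0) :
    (volume : Measure (EuclideanSpace ℝ (Fin d))).toSphere univ ≠ 0 := by
  have : NeZero d := ⟨hd⟩
  rw [Ne, Measure.measure_univ_eq_zero]
  exact Measure.toSphere_ne_zero _

theorem volume_norm_lt (hd : d ≠ 0) {R : ℝ} (hR : 0 ≤ R) :
    volume {x : EuclideanSpace ℝ (Fin d) | ‖x‖ ∈ Iio R} =
      ENNReal.ofReal (R ^ d) * volume (Metric.ball (0 : EuclideanSpace ℝ (Fin d)) 1) := by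
  rw [← volume_ball_eq hd hR]
  congr 1
  ext x
  simp

theorem le_volume_norm_mem (hd : d ≠ 0) {S : Set ℝ} (hS : MeasurableSet S)
    (h : S ⊆ Ici (1 / 2)) :
    (volume : Measure (EuclideanSpace ℝ (Fin d))).toSphere univ *
      (ENNReal.ofReal ((1 / 2) ^ (d - 1)) * volume S) ≤
      volume {x : EuclideanSpace ℝ (Fin d) | ‖x‖ ∈ S} := by
  rw [volume_norm_mem hd hS]
  gcongr
  rw [← lintegral_indicator_one hS, ← lintegral_const_mul' _ _ ENNReal.ofReal_ne_top,
    ← lintegral_indicator measurableSet_Ioi]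
  refine lintegral_mono fun s => ?_
  by_cases hs : s ∈ S
  · have h1 : 1 / 2 ≤ s := h hs
    rw [indicator_of_mem (show s ∈ Ioi 0 from by simp only [mem_Ioi]; linarith)]
    gcongr
  · simp [hs]

theorem volume_norm_mem_le (hd : d ≠ 0) {S : Set ℝ} (hS : MeasurableSet S) {b : ℝ}
    (h : S ⊆ Iic b) :
    volume {x : EuclideanSpace ℝ (Fin d) | ‖x‖ ∈ S} ≤
      (volume : Measure (EuclideanSpace ℝ (Fin d))).toSphere univ *
      (ENNReal.ofReal (b ^ (d - 1)) * volume S) := by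
  rw [volume_norm_mem hd hS]
  gcongr
  rw [← lintegral_indicator_one hS, ← lintegral_const_mul' _ _ ENNReal.ofReal_ne_top]
  refine (setLIntegral_mono' measurableSet_Ioi fun s hs => ?_).trans (setLIntegral_le_lintegral _ _)
  by_cases hsS : s ∈ S
  · have h1 : s ≤ b := h hsS
    have h2 : 0 < s := hs
    gcongr
  · simp [hsS]

theorem ofReal_pow_mul_rpow {R z : ℝ} (hR : 0 ≤ R) (hz : 0 ≤ z) (V : ℝ≥0∞) :
    (ENNReal.ofReal (R ^ d) * V) ^ z = V ^ z * ENNReal.ofReal (R ^ (d * z)) := by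
  rw [ENNReal.mul_rpow_of_nonneg _ _ hz, ENNReal.ofReal_rpow_of_nonneg (by positivity) hz,
    ← Real.rpow_natCast R d, ← Real.rpow_mul hR, mul_comm]

/-- Test on the ball of radius 2R: the means equal 1 on the ball of radius R once R ≥ 3, so R^(d z₂)
≤ C R^(d z₁) as R → ∞. -/
theorem snd_le_fst_of_radialBounded (hd : d ≠ 0) {z₁ z₂ : ℝ} (hz₁ : 0 ≤ z₁) (hz₂ : 0 ≤ z₂)
    (hne : E.Nonempty) (hE : E ⊆ Icc 1 2)
    (h : RadialBounded d E (ENNReal.ofReal z₁)⁻¹ (ENNReal.ofReal z₂)⁻¹) : z₂ ≤ z₁ := by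
  have := isProbabilityMeasure_sphereProb hd
  obtain ⟨C, hC⟩ := h.exists_indicator_le hd hz₁ hz₂
  obtain ⟨t, ht⟩ := hne
  set V := volume (Metric.ball (0 : EuclideanSpace ℝ (Fin d)) 1) with hV
  have hV0 : V ≠ 0 := (Metric.measure_ball_pos _ _ one_pos).ne'
  have hVt : V ≠ ∞ := measure_ball_lt_top.ne
  obtain ⟨C', -, hC'⟩ := exists_le_mul_of_ofReal_le (K₁ := V ^ z₂)
    (K₂ := C * (ENNReal.ofReal (2 ^ d) * V) ^ z₁)
    (by simp [ENNReal.rpow_eq_zero_iff, hV0, hVt]) (by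
      refine ENNReal.mul_ne_top ENNReal.coe_ne_top (ENNReal.rpow_ne_top_of_nonneg hz₁ ?_)
      exact ENNReal.mul_ne_top ENNReal.ofReal_ne_top hVt)
  have hd0 : (0 : ℝ) < d := by exact_mod_cast Nat.pos_of_ne_zero hd
  suffices (d : ℝ) * z₂ ≤ d * z₁ from le_of_mul_le_mul_left this hd0
  refine le_of_rpow_le_mul_rpow_atTop (C := C') (R₀ := 3) fun R hR => ?_
  have hR0 : 0 ≤ R := by linarith
  refine hC' _ _ (by positivity) ?_
  have h2R : 0 ≤ 2 * R := by linarith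
  have h1 := hC (Iio (2 * R)) measurableSet_Iio (by
    rw [volume_norm_lt hd h2R]; exact ENNReal.mul_ne_top ENNReal.ofReal_ne_top hVt)
    {x | ‖x‖ ∈ Iio R} (measurable_norm measurableSet_Iio) (by
      rw [volume_norm_lt hd hR0]; exact mul_ne_zero (ENNReal.ofReal_pos.2 (by positivity)).ne' hV0) 1 (fun x hx => ⟨t, ht, by
        have hx : ‖x‖ < R := hx
        have : ∀ y : Metric.sphere (0 : EuclideanSpace ℝ (Fin d)) 1,
            (Iio (2 * R)).indicator (1 : ℝ → ℝ≥0∞) ‖x - t • y.1‖ = 1 := fun y => by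
          refine indicator_of_mem (a := ‖x - t • y.1‖) ?_ _
          have h3 := norm_sub_le x (t • y.1)
          rw [norm_smul, norm_eq_of_mem_sphere, Real.norm_of_nonneg (by linarith [(hE ht).1])] at h3
          have := (hE ht).2
          simp only [mem_Iio]
          linarith
        simp [this]⟩)
  rw [volume_norm_lt hd h2R, volume_norm_lt hd hR0, one_mul] at h1
  rw [mul_pow, mul_comm ((2 : ℝ) ^ d), ENNReal.ofReal_mul (by positivity), mul_assoc,
    ofReal_pow_mul_rpow hR0 hz₁, ofReal_pow_mul_rpow hR0 hz₂, ← mul_assoc] at h1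
  exact h1

/-- Test on the shell of radii within δ of one t ∈ E. Its volume is O(δ), and the mean at radius t
equals 1 on the ball of radius δ, so δ^(d z₂) ≤ C δ^(z₁) as δ → 0. -/
theorem fst_le_mul_snd_of_radialBounded (hd : d ≠ 0) {z₁ z₂ : ℝ} (hz₁ : 0 ≤ z₁) (hz₂ : 0 ≤ z₂)
    (hne : E.Nonempty) (hE : E ⊆ Icc 1 2)
    (h : RadialBounded d E (ENNReal.ofReal z₁)⁻¹ (ENNReal.ofReal z₂)⁻¹) : z₁ ≤ d * z₂ := by
  have := isProbabilityMeasure_sphereProb hd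
  obtain ⟨C, hC⟩ := h.exists_indicator_le hd hz₁ hz₂
  obtain ⟨t, ht⟩ := hne
  set V := volume (Metric.ball (0 : EuclideanSpace ℝ (Fin d)) 1) with hV
  set W := (volume : Measure (EuclideanSpace ℝ (Fin d))).toSphere univ with hW
  have hV0 : V ≠ 0 := (Metric.measure_ball_pos _ _ one_pos).ne'
  have hVt : V ≠ ∞ := measure_ball_lt_top.ne
  have hWt : W ≠ ∞ := measure_ne_top _ _
  obtain ⟨C', -, hC'⟩ := exists_le_mul_of_ofReal_le (K₁ := V ^ z₂)
    (K₂ := C * (W * (ENNReal.ofReal (3 ^ (d - 1)) * ENNReal.ofReal 2)) ^ z₁)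
    (by simp [ENNReal.rpow_eq_zero_iff, hV0, hVt]) (by
      refine ENNReal.mul_ne_top ENNReal.coe_ne_top (ENNReal.rpow_ne_top_of_nonneg hz₁ ?_)
      finiteness)
  refine le_of_rpow_le_mul_rpow (C := C') one_pos fun δ hδ hδ1 => ?_
  refine hC' _ _ (by positivity) ?_
  have ht1 := (hE ht).1
  have ht2 := (hE ht).2
  have hSv : volume {x : EuclideanSpace ℝ (Fin d) | ‖x‖ ∈ Icc (t - δ) (t + δ)} ≤
      W * (ENNReal.ofReal (3 ^ (d - 1)) * ENNReal.ofReal 2) * ENNReal.ofReal δ := by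
    refine (volume_norm_mem_le hd measurableSet_Icc (b := 3) fun s hs => ?_).trans (le_of_eq ?_)
    · have := hs.2
      simp only [mem_Iic]
      linarith
    · rw [Real.volume_Icc, mul_assoc, mul_assoc, ← ENNReal.ofReal_mul zero_le_two]
      congr 3
      ring
  have h1 := hC (Icc (t - δ) (t + δ)) measurableSet_Icc (ne_top_of_le_ne_top (by finiteness) hSv)
    {x | ‖x‖ ∈ Iio δ} (measurable_norm measurableSet_Iio) (by
      rw [volume_norm_lt hd hδ.le]; exact mul_ne_zero (ENNReal.ofReal_pos.2 (by positivity)).ne' hV0) 1 (fun x hx => ⟨t, ht, by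
        have hx : ‖x‖ < δ := hx
        have : ∀ y : Metric.sphere (0 : EuclideanSpace ℝ (Fin d)) 1,
            (Icc (t - δ) (t + δ)).indicator (1 : ℝ → ℝ≥0∞) ‖x - t • y.1‖ = 1 := fun y => by
          refine indicator_of_mem (a := ‖x - t • y.1‖) ?_ _
          have h3 := norm_sub_le x (t • y.1)
          have h4 := norm_sub_norm_le (t • y.1) x
          rw [norm_sub_rev] at h4
          rw [norm_smul, norm_eq_of_mem_sphere, Real.norm_of_nonneg (by linarith)] at h3 h4
          constructor <;> linarith
        simp [this]⟩)
  rw [volume_norm_lt hd hδ.le, one_mul, ofReal_pow_mul_rpow hδ.le hz₂] at h1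
  refine h1.trans ?_
  grw [hSv]
  rw [ENNReal.mul_rpow_of_nonneg _ _ hz₁, ENNReal.ofReal_rpow_of_nonneg hδ.le hz₁, mul_assoc]

end

/-! ### Test functions concentrated at the origin. -/

noncomputable section

open Filter Topology

variable {d : ℕ} {E : Set ℝ}

/-- Near the spheres `‖x‖ = t`, `t ∈ E`, the spherical means see the singularity at the origin. -/
theorem exists_le_lintegral_norm_sub (hd : 3 ≤ d) (hE : E ⊆ Icc 1 2) {δ : ℝ} (hδ : 0 < δ)
    (hδ' : δ ≤ 1 / 8) {x : EuclideanSpace ℝ (Fin d)} (hx : ‖x‖ ∈ Metric.thickening δ E) :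
    ∃ t ∈ E, ∀ φ : ℝ → ℝ≥0∞, Measurable φ →
      capConst d * ∫⁻ s in Ioc (2 * δ) (1 / 2), ENNReal.ofReal ((s / 24) ^ (d - 2)) * φ s ≤
        ∫⁻ y, φ ‖x - t • y.1‖ ∂(sphereProb d) := by
  obtain ⟨t, ht, hrt⟩ := Metric.mem_thickening_iff.1 hx
  rw [Real.dist_eq] at hrt
  obtain ⟨h1, h2⟩ := hE ht
  obtain ⟨h3, h4⟩ := abs_lt.1 hrt
  have hx0 : x ≠ 0 := norm_pos_iff.1 (by linarith)
  refine ⟨t, ht, fun φ hφ => ?_⟩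
  rw [lintegral_norm_sub_sphereProb hd hx0 (by linarith) hφ]
  refine mul_le_mul' le_rfl ?_
  calc _ ≤ ∫⁻ s in Ioc (2 * δ) (1 / 2), ENNReal.ofReal (radialKernel d ‖x‖ t s) * φ s := by
        refine setLIntegral_mono' measurableSet_Ioc fun s hs => ?_
        gcongr
        exact le_radialKernel hd (by linarith) (by linarith) h1 h2 (by linarith [hs.1]) hs.2
    _ ≤ _ := by
        refine lintegral_mono_set (Ioc_subset_Ioo (by linarith) (by linarith))

theorem exists_le_volume_norm_mem_thickening (hd : d ≠ 0) (hE : E ⊆ Icc 1 2) :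
    ∃ W : ℝ≥0∞, W ≠ 0 ∧ W ≠ ∞ ∧ ∀ δ, 0 < δ → δ ≤ 1 / 8 →
      W * ENNReal.ofReal (δ * coverNumber E δ) ≤
        volume {x : EuclideanSpace ℝ (Fin d) | ‖x‖ ∈ Metric.thickening δ E} := by
  refine ⟨(volume : Measure (EuclideanSpace ℝ (Fin d))).toSphere univ *
    ENNReal.ofReal ((1 / 2) ^ (d - 1)),
    mul_ne_zero (toSphere_univ_ne_zero hd) (ENNReal.ofReal_pos.2 (by positivity)).ne',
    ENNReal.mul_ne_top (measure_ne_top _ _) ENNReal.ofReal_ne_top, fun δ hδ hδ' => ?_⟩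
  refine le_trans ?_ (le_volume_norm_mem hd Metric.isOpen_thickening.measurableSet fun s hs => ?_)
  · rw [mul_assoc]
    gcongr
    exact coverNumber_le_volume hE hδ
  · obtain ⟨t, ht, hst⟩ := Metric.mem_thickening_iff.1 hs
    rw [Real.dist_eq, abs_lt] at hst
    have := (hE ht).1
    simp only [mem_Ici]
    linarith

/-- Test on the ball of radius 4δ. When ‖x‖ is within δ of some t ∈ E, the mean at t is at least of
order δ^(d-1), and such x fill a set of volume at least of order δ N(E,δ). -/
theorem exists_coverNumber_rpow_le (hd : 3 ≤ d) {z₁ z₂ : ℝ} (hz₁ : 0 ≤ z₁) (hz₂ : 0 ≤ z₂)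
    (hne : E.Nonempty) (hE : E ⊆ Icc 1 2)
    (h : RadialBounded d E (ENNReal.ofReal z₁)⁻¹ (ENNReal.ofReal z₂)⁻¹) :
    ∃ C : ℝ, 0 ≤ C ∧ ∀ δ, 0 < δ → δ ≤ 1 / 8 →
      δ ^ (d - 1) * (δ * coverNumber E δ) ^ z₂ ≤ C * δ ^ (d * z₁) := by
  have hd0 : d ≠ 0 := by omega
  obtain ⟨C, hC⟩ := h.exists_indicator_le hd0 hz₁ hz₂
  obtain ⟨W, hW0, hWt, hW⟩ := exists_le_volume_norm_mem_thickening hd0 hE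
  set V := volume (Metric.ball (0 : EuclideanSpace ℝ (Fin d)) 1) with hV
  have hVt : V ≠ ∞ := measure_ball_lt_top.ne
  obtain ⟨C', hC0, hC'⟩ := exists_le_mul_of_ofReal_le
    (K₁ := capConst d * ENNReal.ofReal (2 * (1 / 12) ^ (d - 2)) * W ^ z₂)
    (K₂ := C * (ENNReal.ofReal (4 ^ d) * V) ^ z₁)
    (mul_ne_zero (mul_ne_zero (capConst_ne_zero d) (ENNReal.ofReal_pos.2 (by positivity)).ne')
      (by simp [ENNReal.rpow_eq_zero_iff, hW0, hWt])) (by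
      refine ENNReal.mul_ne_top ENNReal.coe_ne_top (ENNReal.rpow_ne_top_of_nonneg hz₁ ?_)
      exact ENNReal.mul_ne_top ENNReal.ofReal_ne_top hVt)
  refine ⟨C', hC0, fun δ hδ hδ' => hC' _ _ (by positivity) ?_⟩
  have h4δ : 0 ≤ 4 * δ := by linarith
  have hN : (0 : ℝ) < δ * coverNumber E δ :=
    mul_pos hδ (by exact_mod_cast one_le_coverNumber hne hE hδ)
  have hA0 : volume {x : EuclideanSpace ℝ (Fin d) | ‖x‖ ∈ Metric.thickening δ E} ≠ 0 := by
    intro h0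
    have := hW δ hδ hδ'
    rw [h0, nonpos_iff_eq_zero, mul_eq_zero] at this
    exact this.elim hW0 (ENNReal.ofReal_pos.2 hN).ne'
  have h1 := hC (Iio (4 * δ)) measurableSet_Iio (by
    rw [volume_norm_lt hd0 h4δ]; exact ENNReal.mul_ne_top ENNReal.ofReal_ne_top hVt)
    {x | ‖x‖ ∈ Metric.thickening δ E} (measurable_norm Metric.isOpen_thickening.measurableSet) hA0
    (capConst d * (ENNReal.ofReal ((δ / 12) ^ (d - 2)) * ENNReal.ofReal (2 * δ))) (fun x hx => by
      obtain ⟨t, ht, htm⟩ := exists_le_lintegral_norm_sub hd hE hδ hδ' hx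
      refine ⟨t, ht, le_trans ?_ (htm _ (measurable_one.indicator measurableSet_Iio))⟩
      gcongr
      -- Only 2δ < s < 4δ is kept, where s/24 ≥ δ/12.
      calc ENNReal.ofReal ((δ / 12) ^ (d - 2)) * ENNReal.ofReal (2 * δ)
          = ∫⁻ s in Ioo (2 * δ) (4 * δ), ENNReal.ofReal ((δ / 12) ^ (d - 2)) := by
            rw [setLIntegral_const, Real.volume_Ioo]; congr 2; ring
        _ ≤ ∫⁻ s in Ioo (2 * δ) (4 * δ),
              ENNReal.ofReal ((s / 24) ^ (d - 2)) * (Iio (4 * δ)).indicator 1 s := by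
            refine setLIntegral_mono' measurableSet_Ioo fun s hs => ?_
            rw [indicator_of_mem (show s ∈ Iio (4 * δ) from hs.2), Pi.one_apply, mul_one]
            have := hs.1
            refine ENNReal.ofReal_le_ofReal (pow_le_pow_left₀ (by positivity) ?_ _)
            linarith
        _ ≤ _ := lintegral_mono_set
            (Ioo_subset_Ioc_self.trans (Ioc_subset_Ioc_right (by linarith))))
  rw [volume_norm_lt hd0 h4δ, mul_pow, mul_comm ((4 : ℝ) ^ d),
    ENNReal.ofReal_mul (pow_nonneg hδ.le d),
    mul_assoc (ENNReal.ofReal (δ ^ d)), ofReal_pow_mul_rpow hδ.le hz₁, ← mul_assoc (C : ℝ≥0∞)] at h1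
  refine le_trans ?_ h1
  refine le_trans (le_of_eq ?_) (mul_le_mul' le_rfl (ENNReal.rpow_le_rpow (hW δ hδ hδ') hz₂))
  rw [ENNReal.mul_rpow_of_nonneg _ _ hz₂, ENNReal.ofReal_rpow_of_pos hN,
    ENNReal.ofReal_mul (p := δ ^ (d - 1)) (by positivity)]
  have h5 : ENNReal.ofReal ((δ / 12) ^ (d - 2)) * ENNReal.ofReal (2 * δ) =
      ENNReal.ofReal (2 * (1 / 12) ^ (d - 2)) * ENNReal.ofReal (δ ^ (d - 1)) := by
    rw [← ENNReal.ofReal_mul (by positivity), ← ENNReal.ofReal_mul (by positivity)]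
    congr 1
    have : d - 1 = (d - 2) + 1 := by omega
    rw [this]
    ring
  rw [h5]
  ring

/-- Test with |x|^(1-d) on 2δ < |x| ≤ 1/2, and put L = log(1/(4δ)). At p = d/(d-1) its norm is of
order L^(1/p), while the maximal function is at least of order L on the δ-neighbourhood. Since 1 -
1/p = 1/d, this bounds L^(1/d) (δN)^(1/q). -/
theorem bddAbove_of_radialBounded_critical (hd : 3 ≤ d) (hne : E.Nonempty) (hE : E ⊆ Icc 1 2)
    {q : ℝ} (hq : 0 < q)
    (h : RadialBounded d E (ENNReal.ofReal ((d : ℝ) / ((d : ℝ) - 1))) (ENNReal.ofReal q)) :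
    ∃ C : ℝ, ∀ δ ∈ Ioo (0 : ℝ) 1, Real.log (1 / δ) ^ (q / (d : ℝ)) * minkowskiChar E 1 δ ≤ C := by
  have hd0 : d ≠ 0 := by omega
  have hdr : (3 : ℝ) ≤ d := by exact_mod_cast hd
  have hd1 : (0 : ℝ) < d - 1 := by linarith
  set p := (d : ℝ) / (d - 1) with hp
  have hp0 : 0 < p := by positivity
  obtain ⟨C, hC⟩ := h.exists_mul_volume_rpow_le hd0 (ENNReal.ofReal_pos.2 hq).ne'
  rw [ENNReal.toReal_ofReal hq.le] at hC
  obtain ⟨W, hW0, hWt, hW⟩ := exists_le_volume_norm_mem_thickening hd0 hE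
  set V := (volume : Measure (EuclideanSpace ℝ (Fin d))).toSphere univ with hV
  obtain ⟨C', hC0, hC'⟩ := exists_le_mul_of_ofReal_le
    (K₁ := capConst d * ENNReal.ofReal ((1 / 24) ^ (d - 2)) * W ^ (1 / q))
    (K₂ := C * V ^ (1 / p))
    (mul_ne_zero (mul_ne_zero (capConst_ne_zero d) (ENNReal.ofReal_pos.2 (by positivity)).ne')
      (by simp [ENNReal.rpow_eq_zero_iff, hW0, hWt])) (by
      refine ENNReal.mul_ne_top ENNReal.coe_ne_top (ENNReal.rpow_ne_top_of_nonneg (by positivity)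
        (measure_ne_top _ _)))
  have key : ∀ δ, 0 < δ → δ < 1 / 16 → Real.log (1 / 2 / (2 * δ)) * (δ * coverNumber E δ) ^ (1 / q) ≤
      C' * Real.log (1 / 2 / (2 * δ)) ^ (1 / p) := by
    intro δ hδ hδ'
    have h2δ : 0 < 2 * δ := by linarith
    set L := Real.log (1 / 2 / (2 * δ)) with hL
    have hL0 : 0 < L := Real.log_pos (by rw [lt_div_iff₀ h2δ]; linarith)
    have hN : (0 : ℝ) < δ * coverNumber E δ :=
      mul_pos hδ (by exact_mod_cast one_le_coverNumber hne hE hδ)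
    refine hC' _ _ (by positivity) ?_
    have hA0 : volume {x : EuclideanSpace ℝ (Fin d) | ‖x‖ ∈ Metric.thickening δ E} ≠ 0 := by
      intro h0
      have := hW δ hδ (by linarith)
      rw [h0, nonpos_iff_eq_zero, mul_eq_zero] at this
      exact this.elim hW0 (ENNReal.ofReal_pos.2 hN).ne'
    set g : ℝ → ℝ≥0 := (Ioc (2 * δ) (1 / 2)).indicator fun s => Real.toNNReal (s⁻¹ ^ (d - 1)) with hg
    have hgm : Measurable g := Measurable.indicator (by fun_prop) measurableSet_Ioc
    have hgs : ∀ s ∈ Ioc (2 * δ) (1 / 2), (g s : ℝ≥0∞) = ENNReal.ofReal (s⁻¹ ^ (d - 1)) :=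
      fun s hs => by rw [hg, indicator_of_mem hs]; rfl
    have hgK : ∀ s, g s ≤ Real.toNNReal ((2 * δ)⁻¹ ^ (d - 1)) := by
      intro s
      by_cases hs : s ∈ Ioc (2 * δ) (1 / 2)
      · rw [hg, indicator_of_mem hs]
        have hs0 : 0 < s := h2δ.trans hs.1
        have := hs.1
        gcongr
      · rw [hg, indicator_of_notMem hs]
        exact zero_le
    have hnorm : eLpNorm (fun x : EuclideanSpace ℝ (Fin d) => ((g ‖x‖ : ℝ) : ℂ))
        (ENNReal.ofReal p) volume = V ^ (1 / p) * ENNReal.ofReal (L ^ (1 / p)) := by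
      rw [eLpNorm_eq_lintegral_rpow_enorm_toReal (ENNReal.ofReal_pos.2 hp0).ne'
        ENNReal.ofReal_ne_top, ENNReal.toReal_ofReal hp0.le]
      have h1 : ∀ x : EuclideanSpace ℝ (Fin d), ‖((g ‖x‖ : ℝ) : ℂ)‖ₑ ^ p =
          (fun s => (g s : ℝ≥0∞) ^ p) ‖x‖ := fun x => by
        rw [← ofReal_norm, Complex.norm_real, ofReal_norm, Real.enorm_of_nonneg (NNReal.coe_nonneg _),
          ENNReal.ofReal_coe_nnreal]
      have : NeZero d := ⟨hd0⟩
      simp_rw [h1]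
      rw [lintegral_fun_norm volume (hgm.coe_nnreal_ennreal.pow_const p),
        finrank_euclideanSpace_fin, ENNReal.mul_rpow_of_nonneg _ _ (by positivity)]
      congr 1
      rw [← ENNReal.ofReal_rpow_of_pos hL0, hL, ← lintegral_Ioc_ofReal_inv h2δ (by linarith),
        ← lintegral_indicator measurableSet_Ioc, ← lintegral_indicator measurableSet_Ioi]
      congr 2
      ext s
      by_cases hs : s ∈ Ioc (2 * δ) (1 / 2)
      · have hs0 : 0 < s := h2δ.trans hs.1
        rw [indicator_of_mem (show s ∈ Ioi 0 from hs0), indicator_of_mem hs, hgs s hs,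
          ENNReal.ofReal_rpow_of_pos (by positivity), ← ENNReal.ofReal_mul (by positivity)]
        congr 1
        have : (s⁻¹ ^ (d - 1)) ^ p = (s ^ d)⁻¹ := by
          rw [← Real.rpow_natCast, ← Real.rpow_mul (by positivity), Nat.cast_sub (by omega)]
          have : ((d : ℝ) - (1 : ℕ)) * p = d := by rw [hp]; push_cast; field_simp
          rw [this, Real.rpow_natCast, inv_pow]
        rw [this]
        have hdd : d = (d - 1) + 1 := by omega
        nth_rw 2 [hdd]
        rw [pow_succ]
        field_simp
      · have : g s = 0 := indicator_of_notMem hs _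
        rw [indicator_of_notMem hs]
        simp [this, hp0]
    have h1 := hC g hgm _ hgK ⟨by
        refine Measurable.aestronglyMeasurable ?_
        fun_prop, by rw [hnorm]; finiteness⟩
      {x | ‖x‖ ∈ Metric.thickening δ E} (measurable_norm Metric.isOpen_thickening.measurableSet) hA0
      (capConst d * (ENNReal.ofReal ((1 / 24) ^ (d - 2)) * ENNReal.ofReal L)) (fun x hx => by
        obtain ⟨t, ht, htm⟩ := exists_le_lintegral_norm_sub hd hE hδ (by linarith) hx
        refine ⟨t, ht, le_trans ?_ (htm _ hgm.coe_nnreal_ennreal)⟩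
        gcongr
        rw [hL, ← lintegral_Ioc_ofReal_inv h2δ (by linarith),
          ← lintegral_const_mul' _ _ ENNReal.ofReal_ne_top]
        refine le_of_eq (setLIntegral_congr_fun measurableSet_Ioc fun s hs => ?_)
        have hs0 : 0 < s := h2δ.trans hs.1
        rw [hgs s hs, ← ENNReal.ofReal_mul (by positivity), ← ENNReal.ofReal_mul (by positivity)]
        congr 1
        have : d - 1 = (d - 2) + 1 := by omega
        rw [this, pow_succ, div_pow, div_pow, inv_pow]
        field_simp
        exact one_pow _)
    rw [hnorm, ← mul_assoc (C : ℝ≥0∞)] at h1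
    refine le_trans ?_ h1
    refine le_trans (le_of_eq ?_) (mul_le_mul' le_rfl (ENNReal.rpow_le_rpow (hW δ hδ (by linarith))
      (by positivity)))
    rw [ENNReal.mul_rpow_of_nonneg _ _ (by positivity), ENNReal.ofReal_rpow_of_pos hN,
      ENNReal.ofReal_mul (by positivity)]
    ring
  have key2 : ∀ δ, 0 < δ → δ < 1 / 16 →
      Real.log (1 / δ) ^ (q / (d : ℝ)) * (δ * coverNumber E δ) ≤ 2 ^ (q / (d : ℝ)) * C' ^ q := by
    intro δ hδ hδ'
    have h1 := key δ hδ hδ'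
    have h2δ : 0 < 2 * δ := by linarith
    set L := Real.log (1 / 2 / (2 * δ)) with hL
    have hL0 : 0 < L := Real.log_pos (by rw [lt_div_iff₀ h2δ]; linarith)
    set N := δ * (coverNumber E δ : ℝ) with hN
    have hN0 : 0 ≤ N := by positivity
    have h2 : L = L ^ (1 / p) * L ^ (1 / (d : ℝ)) := by
      rw [← Real.rpow_add hL0]
      have : 1 / p + 1 / (d : ℝ) = 1 := by rw [hp]; field_simp; ring
      rw [this, Real.rpow_one]
    have h3 : L ^ (1 / (d : ℝ)) * N ^ (1 / q) ≤ C' := by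
      have h4 : 0 < L ^ (1 / p) := Real.rpow_pos_of_pos hL0 _
      refine le_of_mul_le_mul_left ?_ h4
      rw [← mul_assoc, ← h2, mul_comm _ C']
      exact h1
    have h4 := Real.rpow_le_rpow (by positivity) h3 hq.le
    rw [Real.mul_rpow (by positivity) (by positivity), ← Real.rpow_mul hL0.le,
      ← Real.rpow_mul hN0, one_div_mul_cancel hq.ne', Real.rpow_one, one_div_mul_eq_div] at h4
    -- Equivalent to 1/δ ≤ 1/(4δ)², that is δ ≤ 1/16; larger δ are handled trivially at the end.
    have h5 : Real.log (1 / δ) ≤ 2 * L := by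
      rw [hL, ← Real.log_rpow (by positivity)]
      refine Real.log_le_log (by positivity) ?_
      rw [Real.rpow_two, div_div, div_pow, div_le_div_iff₀ hδ (by positivity)]
      nlinarith
    have h6 : 0 ≤ Real.log (1 / δ) := Real.log_nonneg (by rw [le_div_iff₀ hδ]; linarith)
    calc Real.log (1 / δ) ^ (q / (d : ℝ)) * N ≤ (2 * L) ^ (q / (d : ℝ)) * N := by gcongr
      _ = 2 ^ (q / (d : ℝ)) * (L ^ (q / (d : ℝ)) * N) := by
          rw [Real.mul_rpow (by norm_num) hL0.le, mul_assoc]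
      _ ≤ _ := by gcongr
  refine ⟨2 ^ (q / (d : ℝ)) * C' ^ q + Real.log 16 ^ (q / (d : ℝ)) * 3, fun δ hδ => ?_⟩
  have h16 : 0 ≤ Real.log 16 := Real.log_nonneg (by norm_num)
  rw [minkowskiChar, Real.rpow_one]
  rcases lt_or_ge δ (1 / 16) with h1 | h1
  · have := key2 δ hδ.1 h1
    have h2 : 0 ≤ Real.log 16 ^ (q / (d : ℝ)) * 3 := by positivity
    linarith
  · have h2 : 0 ≤ 2 ^ (q / (d : ℝ)) * C' ^ q := by positivity
    have h3 : Real.log (1 / δ) ≤ Real.log 16 := by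
      refine Real.log_le_log (by have := hδ.1; positivity) ?_
      rw [div_le_iff₀ hδ.1]; linarith
    have h4 : 0 ≤ Real.log (1 / δ) := Real.log_nonneg (by rw [le_div_iff₀ hδ.1]; linarith [hδ.2])
    have h5 : Real.log (1 / δ) ^ (q / (d : ℝ)) * (δ * coverNumber E δ) ≤
        Real.log 16 ^ (q / (d : ℝ)) * 3 := by
      have := hδ.1
      gcongr
      exact mul_coverNumber_le hE hδ.1 hδ.2.le
    linarith

end

/-! ### The triangle in terms of linear inequalities and the two inclusions. -/

noncomputable section

open Filter Topology

variable {d : ℕ} {E : Set ℝ}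

/-- The dimension is an infimum over positive exponents only, so a = 0 is reached by letting ε → 0.
-/
theorem minkowskiDim_le_of_nonneg {a c : ℝ} (ha : 0 ≤ a) (hc : 0 < c)
    (h : ∀ δ ∈ Ioo (0 : ℝ) 1, (coverNumber E δ : ℝ) ≤ c * δ ^ (-a)) : minkowskiDim E ≤ a := by
  refine le_of_forall_pos_le_add fun ε hε => minkowskiDim_le (by linarith) hc fun δ hδ => ?_
  refine (h δ hδ).trans ?_
  gcongr ?_ * ?_
  exact Real.rpow_le_rpow_of_exponent_ge hδ.1 hδ.2.le (by linarith)

theorem bddAbove_minkowskiChar_of_le {a c : ℝ}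
    (h : ∀ δ ∈ Ioo (0 : ℝ) 1, (coverNumber E δ : ℝ) ≤ c * δ ^ (-a)) :
    BddAbove (minkowskiChar E a '' Ioo 0 1) := by
  refine ⟨c, ?_⟩
  rintro _ ⟨δ, hδ, rfl⟩
  have h1 : 0 < δ ^ a := Real.rpow_pos_of_pos hδ.1 a
  have h2 := h δ hδ
  rw [Real.rpow_neg hδ.1.le, ← div_eq_mul_inv, le_div_iff₀ h1] at h2
  rw [minkowskiChar, mul_comm]
  exact h2

theorem exists_coverNumber_le_of_bddAbove {a : ℝ} (h : BddAbove (minkowskiChar E a '' Ioo 0 1)) :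
    ∃ c : ℝ, 0 < c ∧ ∀ δ ∈ Ioo (0 : ℝ) 1, (coverNumber E δ : ℝ) ≤ c * δ ^ (-a) := by
  obtain ⟨c, hc⟩ := h
  refine ⟨max c 1, by positivity, fun δ hδ => ?_⟩
  have h1 : 0 < δ ^ a := Real.rpow_pos_of_pos hδ.1 a
  rw [Real.rpow_neg hδ.1.le, ← div_eq_mul_inv, le_div_iff₀ h1, mul_comm]
  exact (hc ⟨δ, hδ, rfl⟩).trans (le_max_left _ _)

theorem bddAbove_minkowskiChar_of_one_le (hE : E ⊆ Icc 1 2) {a : ℝ} (ha : 1 ≤ a) :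
    BddAbove (minkowskiChar E a '' Ioo 0 1) := by
  refine ⟨3, ?_⟩
  rintro _ ⟨δ, hδ, rfl⟩
  refine le_trans ?_ (mul_coverNumber_le hE hδ.1 hδ.2.le)
  rw [minkowskiChar]
  gcongr
  calc δ ^ a ≤ δ ^ (1 : ℝ) := Real.rpow_le_rpow_of_exponent_ge hδ.1 hδ.2.le ha
    _ = δ := Real.rpow_one δ

/-- Boundedness of the maximal operator bounds the covering numbers. -/
theorem exists_coverNumber_le_of_radialBounded (hd : 3 ≤ d) {z₁ z₂ : ℝ} (hz₁ : 0 ≤ z₁)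
    (hz₂ : 0 < z₂) (hne : E.Nonempty) (hE : E ⊆ Icc 1 2)
    (h : RadialBounded d E (ENNReal.ofReal z₁)⁻¹ (ENNReal.ofReal z₂)⁻¹) {a : ℝ}
    (ha : a = 1 - (d * z₁ - (d - 1)) / z₂) :
    0 ≤ a ∧ ∃ c : ℝ, 0 < c ∧ ∀ δ ∈ Ioo (0 : ℝ) 1, (coverNumber E δ : ℝ) ≤ c * δ ^ (-a) := by
  obtain ⟨C, hC0, hC⟩ := exists_coverNumber_rpow_le hd hz₁ hz₂.le hne hE h
  have h1 : ∀ δ, 0 < δ → δ ≤ 1 / 8 → (coverNumber E δ : ℝ) ≤ C ^ (1 / z₂) * δ ^ (-a) := by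
    intro δ hδ hδ'
    have h2 := hC δ hδ hδ'
    set N := (coverNumber E δ : ℝ) with hN
    have hN0 : 0 ≤ δ * N := by positivity
    have h3 : (δ * N) ^ z₂ ≤ C * δ ^ (d * z₁ - (d - 1)) := by
      have h4 : (0 : ℝ) < δ ^ (d - 1) := by positivity
      refine le_of_mul_le_mul_left (h2.trans (le_of_eq ?_)) h4
      have h5 : (δ : ℝ) ^ (d - 1) = δ ^ ((d : ℝ) - 1) := by
        rw [← Real.rpow_natCast, Nat.cast_sub (by omega), Nat.cast_one]
      rw [h5, mul_left_comm, ← Real.rpow_add hδ]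
      ring_nf
    have h6 := Real.rpow_le_rpow (by positivity) h3 (by positivity : 0 ≤ 1 / z₂)
    rw [← Real.rpow_mul hN0, mul_one_div_cancel hz₂.ne', Real.rpow_one,
      Real.mul_rpow hC0 (by positivity), ← Real.rpow_mul hδ.le] at h6
    have h7 : -a = (d * z₁ - (d - 1)) * (1 / z₂) - 1 := by rw [ha]; ring
    rw [h7, Real.rpow_sub_one hδ.ne', ← mul_div_assoc, le_div_iff₀ hδ, mul_comm]
    exact h6
  -- A nonempty set has N ≥ 1, so the bound by a multiple of δ^(-a) cannot tend to 0 with δ.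
  have ha0 : 0 ≤ a := by
    have : -a ≤ 0 := by
      refine le_of_rpow_le_mul_rpow (C := C ^ (1 / z₂)) (by norm_num : (0 : ℝ) < 1 / 8)
        fun δ hδ hδ' => ?_
      rw [Real.rpow_zero]
      refine le_trans ?_ (h1 δ hδ hδ'.le)
      exact_mod_cast one_le_coverNumber hne hE hδ
    linarith
  -- For δ > 1/8 the trivial bound δN ≤ 3 gives N ≤ 24.
  refine ⟨ha0, C ^ (1 / z₂) + 24, by positivity, fun δ hδ => ?_⟩
  have hpow : 1 ≤ δ ^ (-a) := Real.one_le_rpow_of_pos_of_le_one_of_nonpos hδ.1 hδ.2.le (by linarith)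
  rw [add_mul]
  rcases le_or_gt δ (1 / 8) with h8 | h8
  · have := h1 δ hδ.1 h8
    linarith
  · have h9 := mul_coverNumber_le hE hδ.1 hδ.2.le
    have h10 : 0 ≤ C ^ (1 / z₂) * δ ^ (-a) := by positivity
    have h11 : (0 : ℝ) ≤ coverNumber E δ := Nat.cast_nonneg _
    nlinarith

/-- The δ-neighbourhood of E has measure O(δ^(1-b)). This is needed for p = q = ∞, where the only
obstruction is measurability. -/
theorem volume_closure_eq_zero (hne : E.Nonempty) (hE : E ⊆ Icc 1 2) {b c : ℝ} (hb1 : b < 1)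
    (hcov : ∀ δ ∈ Ioo (0 : ℝ) 1, (coverNumber E δ : ℝ) ≤ c * δ ^ (-b)) :
    volume (closure E) = 0 := by
  have ht : Tendsto (fun δ : ℝ => ENNReal.ofReal (5 * (c * δ ^ (1 - b)))) (𝓝[>] 0) (𝓝 0) := by
    have h1 : Tendsto (fun δ : ℝ => δ ^ (1 - b)) (𝓝[>] 0) (𝓝 0) := by
      have := (Real.continuousAt_rpow_const 0 (1 - b) (Or.inr (by linarith))).tendsto
      rw [Real.zero_rpow (by linarith)] at this
      exact this.mono_left nhdsWithin_le_nhds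
    have h2 := ENNReal.tendsto_ofReal ((h1.const_mul c).const_mul 5)
    simpa using h2
  refine le_antisymm (ge_of_tendsto ht ?_) zero_le
  filter_upwards [Ioo_mem_nhdsGT one_pos] with δ hδ
  calc volume (closure E) ≤ volume {r | Metric.infDist r E ≤ δ} := by
        refine measure_mono fun r hr => ?_
        have : Metric.infDist r E = 0 := (Metric.mem_closure_iff_infDist_zero hne).1 hr
        simp [this, hδ.1.le]
    _ ≤ ENNReal.ofReal (5 * (δ * coverNumber E δ)) :=
        volume_infDist_le_le_coverNumber hne hE hδ.1
    _ ≤ ENNReal.ofReal (5 * (δ * (c * δ ^ (-b)))) := by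
        have := hδ.1
        gcongr
        exact hcov δ hδ
    _ = _ := by
        rw [sub_eq_add_neg, Real.rpow_add hδ.1, Real.rpow_one]
        congr 1
        ring

theorem radialBounded_of_le (hd : 3 ≤ d) (hne : E.Nonempty) (hE : E ⊆ Icc 1 2) {b c : ℝ}
    (hb0 : 0 ≤ b) (hb1 : b < 1) (hc : 0 < c)
    (hcov : ∀ δ ∈ Ioo (0 : ℝ) 1, (coverNumber E δ : ℝ) ≤ c * δ ^ (-b)) {z₁ z₂ : ℝ}
    (hz₂ : 0 ≤ z₂) (hz₁ : z₁ ≤ 1) (h1 : z₂ ≤ z₁) (h2 : z₁ ≤ d * z₂)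
    (h3 : d * z₁ - (1 - b) * z₂ ≤ d - 1) :
    RadialBounded d E (ENNReal.ofReal z₁)⁻¹ (ENNReal.ofReal z₂)⁻¹ := by
  rcases hz₂.eq_or_lt with rfl | hz₂
  · have : z₁ = 0 := le_antisymm (by simpa using h2) h1
    subst this
    rw [ENNReal.ofReal_zero, ENNReal.inv_zero]
    exact radialBounded_top hd hE (volume_closure_eq_zero hne hE hb1 hcov)
  · have hz₁0 : 0 < z₁ := hz₂.trans_le h1
    rw [← ENNReal.ofReal_inv_of_pos hz₁0, ← ENNReal.ofReal_inv_of_pos hz₂]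
    refine radialBounded_of_coverNumber_le hd (by rwa [one_le_inv₀ hz₁0])
      (inv_anti₀ hz₂ h1) ?_ ?_ hne hE hb1 hc hcov ?_
    · rw [← div_eq_mul_inv, le_div_iff₀ hz₁0, inv_mul_le_iff₀ hz₂, mul_comm]
      exact h2
    -- If p = 1, the third inequality reads (1-b) z₂ ≥ 1, which with b ≥ 0 and z₂ ≤ 1 forces q = 1.
    · rcases hz₁.eq_or_lt with rfl | hlt
      · right
        have : z₂ = 1 := le_antisymm h1 (by nlinarith)
        rw [this, inv_one]
      · left
        rwa [one_lt_inv₀ hz₁0]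
    · rw [div_inv_eq_mul, div_inv_eq_mul]
      linarith

theorem mem_segment_vertex_iff (hd : 3 ≤ d) {β : ℝ} (hβ : 0 ≤ β) {z : ℝ × ℝ} :
    z ∈ segment ℝ (vertexQ₁ d β) (vertexQ₂ d β) ↔
      z.2 ≤ z.1 ∧ z.1 ≤ d * z.2 ∧ d * z.1 - (1 - β) * z.2 = d - 1 := by
  have hdr : (3 : ℝ) ≤ d := by exact_mod_cast hd
  obtain ⟨x, y⟩ := z
  have h1 : (0 : ℝ) < d - 1 := by linarith
  have h2 : (0 : ℝ) < d - 1 + β := by linarith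
  have h3 : (0 : ℝ) < (d : ℝ) ^ 2 - 1 + β := by nlinarith
  simp only [segment, mem_ofPred_eq, vertexQ₁, vertexQ₂, Prod.smul_mk, Prod.mk_add_mk,
    smul_eq_mul, Prod.mk.injEq]
  constructor
  · rintro ⟨u, v, hu, hv, huv, rfl, rfl⟩
    refine ⟨?_, ?_, ?_⟩
    · have : v * ((d - 1) / ((d : ℝ) ^ 2 - 1 + β)) ≤ v * (d * (d - 1) / ((d : ℝ) ^ 2 - 1 + β)) := by
        gcongr
        nlinarith
      linarith
    · have e1 : 0 ≤ u * ((d - 1) / ((d : ℝ) - 1 + β)) := by positivity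
      have e2 : v * (d * (d - 1) / ((d : ℝ) ^ 2 - 1 + β)) =
        d * (v * ((d - 1) / ((d : ℝ) ^ 2 - 1 + β))) := by ring
      nlinarith
    · have hv' : v = 1 - u := by linarith
      subst hv'
      field_simp
      ring
  · rintro ⟨hxy, hyx, heq⟩
    -- Barycentric coordinates: d y - x vanishes at Q₂ and x - y vanishes at Q₁, each normalized by
    -- its value at the other vertex.
    refine ⟨(d * y - x) * (d - 1 + β) / (d - 1) ^ 2, (x - y) * (d ^ 2 - 1 + β) / (d - 1) ^ 2,
      div_nonneg (mul_nonneg (by linarith) h2.le) (by positivity),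
      div_nonneg (mul_nonneg (by linarith) h3.le) (by positivity), ?_, ?_, ?_⟩
    · rw [← add_div, div_eq_one_iff_eq (by positivity)]
      linear_combination (d - 1 : ℝ) * heq
    · field_simp
      ring
    · field_simp
      ring

theorem mem_triangle_iff (hd : 3 ≤ d) {β : ℝ} (hβ : 0 ≤ β) {z : ℝ × ℝ} :
    z ∈ triangle d β ↔ z.2 ≤ z.1 ∧ z.1 ≤ d * z.2 ∧ d * z.1 - (1 - β) * z.2 ≤ d - 1 := by
  have hdr : (3 : ℝ) ≤ d := by exact_mod_cast hd
  have h1 : (0 : ℝ) < d - 1 := by linarith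
  have hQ₁ := (mem_segment_vertex_iff hd hβ).1 (left_mem_segment ℝ (vertexQ₁ d β) (vertexQ₂ d β))
  have hQ₂ := (mem_segment_vertex_iff hd hβ).1 (right_mem_segment ℝ (vertexQ₁ d β) (vertexQ₂ d β))
  constructor
  · intro hz
    have hconv : Convex ℝ {z : ℝ × ℝ | z.2 ≤ z.1 ∧ z.1 ≤ d * z.2 ∧
        d * z.1 - (1 - β) * z.2 ≤ d - 1} := by
      rintro x ⟨hx1, hx2, hx3⟩ y ⟨hy1, hy2, hy3⟩ a b ha hb hab
      simp only [mem_ofPred_eq, Prod.fst_add, Prod.snd_add, Prod.smul_fst, Prod.smul_snd,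
        smul_eq_mul]
      refine ⟨?_, ?_, ?_⟩
      · linarith [mul_le_mul_of_nonneg_left hx1 ha, mul_le_mul_of_nonneg_left hy1 hb]
      · linarith [mul_le_mul_of_nonneg_left hx2 ha, mul_le_mul_of_nonneg_left hy2 hb]
      · have e1 := mul_le_mul_of_nonneg_left hx3 ha
        have e2 := mul_le_mul_of_nonneg_left hy3 hb
        have e3 : a * ((d : ℝ) - 1) + b * (d - 1) = d - 1 := by rw [← add_mul, hab, one_mul]
        linarith
    refine convexHull_min ?_ hconv hz
    rintro w (rfl | rfl | rfl)
    · simp [h1.le]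
    · exact ⟨hQ₁.1, hQ₁.2.1, hQ₁.2.2.le⟩
    · exact ⟨hQ₂.1, hQ₂.2.1, hQ₂.2.2.le⟩
  · rintro ⟨hxy, hyx, hle⟩
    obtain ⟨x, y⟩ := z
    simp only at hxy hyx hle
    have hO : ((0 : ℝ), (0 : ℝ)) ∈ triangle d β := subset_convexHull ℝ _ (by simp)
    have hseg : segment ℝ (vertexQ₁ d β) (vertexQ₂ d β) ⊆ triangle d β :=
      (convex_convexHull ℝ _).segment_subset (subset_convexHull ℝ _ (by simp))
        (subset_convexHull ℝ _ (by simp))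
    have hy : 0 ≤ y := by nlinarith
    have hℓ : 0 ≤ d * x - (1 - β) * y := by nlinarith
    rcases hℓ.eq_or_lt with h0 | hpos
    · have hy0 : y = 0 := by nlinarith
      have hx0 : x = 0 := by nlinarith
      rw [hx0, hy0]
      exact hO
    · set l := d * x - (1 - β) * y with hl
      have hw : (((d - 1) / l * x, (d - 1) / l * y) : ℝ × ℝ) ∈ triangle d β := by
        refine hseg ((mem_segment_vertex_iff hd hβ).2 ⟨?_, ?_, ?_⟩)
        · simp only; gcongr
        · simp only
          rw [mul_left_comm]
          gcongr
        · simp only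
          calc (d : ℝ) * ((d - 1) / l * x) - (1 - β) * ((d - 1) / l * y)
              = (d - 1) / l * l := by rw [hl]; ring
            _ = d - 1 := div_mul_cancel₀ _ hpos.ne'
      have hc := convex_convexHull ℝ {((0 : ℝ), (0 : ℝ)), vertexQ₁ d β, vertexQ₂ d β} hO hw
        (a := 1 - l / (d - 1)) (b := l / (d - 1)) (by rw [sub_nonneg, div_le_one h1]; exact hle)
        (by positivity) (by ring)
      have e : ∀ s : ℝ, l / (d - 1) * ((d - 1) / l * s) = s := fun s => by field_simp
      simpa [triangle, e] using hc

theorem mem_Icc_of_mem_triangle (hd : 3 ≤ d) {β : ℝ} (hβ : 0 ≤ β) {z : ℝ × ℝ}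
    (hz : z ∈ triangle d β) : z.1 ∈ Icc (0 : ℝ) 1 ∧ z.2 ∈ Icc (0 : ℝ) 1 := by
  have hdr : (3 : ℝ) ≤ d := by exact_mod_cast hd
  obtain ⟨h1, h2, h3⟩ := (mem_triangle_iff hd hβ).1 hz
  have h4 : 0 ≤ z.2 := by nlinarith
  have h5 : z.1 ≤ 1 := by nlinarith
  exact ⟨⟨h4.trans h1, h5⟩, h4, h1.trans h5⟩

theorem mem_triangle_of_mem_radialTypeSet (hd : 3 ≤ d) (hne : E.Nonempty) (hE : E ⊆ Icc 1 2)
    {z : ℝ × ℝ} (hz : z ∈ radialTypeSet d E) : z ∈ triangle d (minkowskiDim E) := by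
  have hdr : (3 : ℝ) ≤ d := by exact_mod_cast hd
  obtain ⟨⟨hz₁, hz₁1⟩, ⟨hz₂, hz₂1⟩, h⟩ := hz
  have h1 := snd_le_fst_of_radialBounded (by omega) hz₁ hz₂ hne hE h
  have h2 := fst_le_mul_snd_of_radialBounded (by omega) hz₁ hz₂ hne hE h
  refine (mem_triangle_iff hd (minkowskiDim_nonneg E)).2 ⟨h1, h2, ?_⟩
  rcases hz₂.eq_or_lt with h0 | hpos
  · rw [← h0, mul_zero] at h2
    rw [← h0, le_antisymm h2 hz₁]
    linarith
  · obtain ⟨ha, c, hc, hcov⟩ := exists_coverNumber_le_of_radialBounded hd hz₁ hpos hne hE h rfl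
    have h3 := mul_le_mul_of_nonneg_right (minkowskiDim_le_of_nonneg ha hc hcov) hpos.le
    rw [sub_mul, div_mul_cancel₀ _ hpos.ne'] at h3
    linarith

/-- On the line through Q₁ and Q₂ the exponent a in `exists_coverNumber_le_of_radialBounded` is
exactly the dimension, so boundedness at one such point bounds the Minkowski characteristic. -/
theorem bddAbove_minkowskiChar_of_mem_segment (hd : 3 ≤ d) (hne : E.Nonempty) (hE : E ⊆ Icc 1 2)
    {z : ℝ × ℝ} (hz : z ∈ radialTypeSet d E)
    (hzs : z ∈ segment ℝ (vertexQ₁ d (minkowskiDim E)) (vertexQ₂ d (minkowskiDim E))) :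
    BddAbove (minkowskiChar E (minkowskiDim E) '' Ioo 0 1) := by
  have hdr : (3 : ℝ) ≤ d := by exact_mod_cast hd
  obtain ⟨⟨hz₁, hz₁1⟩, ⟨hz₂, hz₂1⟩, h⟩ := hz
  obtain ⟨h1, h2, h3⟩ := (mem_segment_vertex_iff hd (minkowskiDim_nonneg E)).1 hzs
  have hpos : 0 < z.2 := by
    refine hz₂.lt_of_ne' fun h0 => ?_
    rw [h0, mul_zero] at h2 h3
    nlinarith
  obtain ⟨-, c, -, hcov⟩ := exists_coverNumber_le_of_radialBounded (a := minkowskiDim E) hd hz₁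
    hpos hne hE h (by field_simp; linarith)
  exact bddAbove_minkowskiChar_of_le hcov

end

/-! ### The three characterizations. -/

theorem theorem1p2 (d : ℕ) (hd : 3 ≤ d) (E : Set ℝ) (hne : E.Nonempty) (hE : E ⊆ Set.Icc 1 2)
    (β : ℝ) (hβ : minkowskiDim E = β) :
    (β < 1 → BddAbove (minkowskiChar E β '' Set.Ioo 0 1) →
      radialTypeSet d E = triangle d β) ∧
    (¬ BddAbove (minkowskiChar E β '' Set.Ioo 0 1) →
      radialTypeSet d E = triangle d β \ segment ℝ (vertexQ₁ d β) (vertexQ₂ d β)) ∧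
    (∀ q : ℝ, (d : ℝ) / ((d : ℝ) - 1) ≤ q → q ≤ (d : ℝ) ^ 2 / ((d : ℝ) - 1) →
      (RadialBounded d E (ENNReal.ofReal ((d : ℝ) / ((d : ℝ) - 1))) (ENNReal.ofReal q) ↔
        BddAbove ((fun δ : ℝ => Real.log (1 / δ) ^ (q / (d : ℝ)) * minkowskiChar E 1 δ) ''
          Set.Ioo 0 1))) := by
  have hdr : (3 : ℝ) ≤ d := by exact_mod_cast hd
  have hβ0 : 0 ≤ β := hβ ▸ minkowskiDim_nonneg E
  refine ⟨fun hβ1 hb => ?_, fun hb => ?_, fun q hq1 hq2 => ⟨fun h => ?_, ?_⟩⟩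
  · refine Subset.antisymm (fun z hz => hβ ▸ mem_triangle_of_mem_radialTypeSet hd hne hE hz)
      fun z hz => ?_
    obtain ⟨c, hc, hcov⟩ := exists_coverNumber_le_of_bddAbove hb
    obtain ⟨hz1, hz2⟩ := mem_Icc_of_mem_triangle hd hβ0 hz
    obtain ⟨h1, h2, h3⟩ := (mem_triangle_iff hd hβ0).1 hz
    exact ⟨hz1, hz2, radialBounded_of_le hd hne hE hβ0 hβ1 hc hcov hz2.1 hz1.2 h1 h2 h3⟩
  -- An unbounded characteristic excludes β ≥ 1, because δN(E,δ) ≤ 3 always.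
  · have hβ1 : β < 1 := by
      by_contra! h
      exact hb (bddAbove_minkowskiChar_of_one_le hE h)
    refine Subset.antisymm (fun z hz => ⟨hβ ▸ mem_triangle_of_mem_radialTypeSet hd hne hE hz,
      fun hzs => hb ?_⟩) fun z hz => ?_
    · subst hβ
      exact bddAbove_minkowskiChar_of_mem_segment hd hne hE hz hzs
    · obtain ⟨hz, hzs⟩ := hz
      obtain ⟨hz1, hz2⟩ := mem_Icc_of_mem_triangle hd hβ0 hz
      obtain ⟨h1, h2, h3⟩ := (mem_triangle_iff hd hβ0).1 hz
      have hlt : d * z.1 - (1 - β) * z.2 < d - 1 :=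
        h3.lt_of_ne fun h => hzs ((mem_segment_vertex_iff hd hβ0).2 ⟨h1, h2, h⟩)
      -- Off the segment there is slack in the third inequality, so the exponent β may be raised to
      -- β + ε, for which a covering bound does hold; ε ≤ (1-β)/2 keeps it below 1.
      set ε := min ((1 - β) / 2) (d - 1 - (d * z.1 - (1 - β) * z.2)) with hε
      have hε0 : 0 < ε := lt_min (by linarith) (by linarith)
      have hε1 : ε ≤ (1 - β) / 2 := min_le_left _ _
      have hε2 : ε ≤ d - 1 - (d * z.1 - (1 - β) * z.2) := min_le_right _ _
      obtain ⟨c, hc, hcov⟩ := exists_coverNumber_le_of_minkowskiDim_lt hE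
        (b := β + ε) (by linarith)
      refine ⟨hz1, hz2, radialBounded_of_le hd hne hE (by linarith) (by linarith) hc hcov hz2.1
        hz1.2 h1 h2 ?_⟩
      have := mul_le_mul_of_nonneg_left hz2.2 hε0.le
      linarith
  · have hq : 0 < q := lt_of_lt_of_le (div_pos (by linarith) (by linarith)) hq1
    obtain ⟨C, hC⟩ := bddAbove_of_radialBounded_critical hd hne hE hq h
    exact ⟨C, by rintro _ ⟨δ, hδ, rfl⟩; exact hC δ hδ⟩
  · rintro ⟨C, hC⟩
    exact radialBounded_critical hd hq1 hq2 hne hE fun δ hδ => hC ⟨δ, hδ, rfl⟩
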